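/- **Conventions.** Monoids are commutative. A log structure on a scheme $X$ is a homomorphism $\alpha\colon M_X\to\mathcal O_X$ from a sheaf of monoids on the small étale site to the multiplicative monoid $\mathcal O_X$ such that $\alpha^{-1}\mathcal O_X^\times\to\mathcal O_X^\times$ is an isomorphism. A chart of $X$ by a monoid $Q$ is a homomorphism $\beta\colon Q\to M_X(X)$ exhibiting $M_X$ as the log structure associated with $Q\to\mathcal O_X(X)$. A log scheme is a scheme with a log structure that étale locally admits charts by finitely generated monoids. A morphism of log schemes $X\to Y$ is a morphism of schemes $f$ with a homomorphism $f^*M_Y\to M_X$ compatible with the maps to $\mathcal O_X$; it is strict if $f^*M_Y\to M_X$ is an isomorphism. A pointed morphism $X\to Y$ is a morphism of schemes $f$ with a homomorphism of sheaves of pointed monoids $(f^*M_Y)\cup\{\infty\}\to M_X\cup\{\infty\}$ compatible with the maps to $\mathcal O_X$, where $\infty\mapsto 0$. Every morphism of log schemes is in particular a pointed morphism. **Faces.** Let $U$ be a locally Noetherian log scheme with a chart $Q\to M_U(U)$ by a finitely generated monoid $Q$, let $p\subsetneq Q$ be a (possibly empty) prime ideal and $R=Q\setminus p$. Let $Z^p$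 be the closed subscheme $U\times_{\operatorname{Spec}\mathbb Z[Q]}\operatorname{Spec}(\mathbb Z[Q]/(p))$ with the log structure charted by $R$, and let $Z^p\to U$ be the pointed morphism given on charts by $Q\cup\{\infty\}\to R\cup\{\infty\}$, which is the identity on $R$ and sends $p$ to $\infty$. The faces of the chart are the connected components of the $Z^p$, for all $p$. For a locally Noetherian log scheme $Y$, a face map of $Y$ is a pointed morphism $\varphi\colon F\to Y$ of log schemes such that $F$ is connected and, for every strict étale morphism $U\to Y$ of log schemes and every chart of $U$ by a finitely generated monoid, $F\times_Y U\to U$ (with the log structure of $F$ restricted to $F\times_YU$) is isomorphic to a disjoint union of pairwise different faces of this chart. **Proposition.** Let $f\colon X\to Y$ be a pointed morphism of log schemes, where the scheme underlying $Y$ is locally Noetherian. Then there are a log scheme $F$, a morphism of log schemes $g\colon X\to F$ and a pointed morphism $\varphi\colon F\to Y$ such that $f=\varphi\circ g$ and $\varphi$ is a disjoint union of face maps, i.e. $F$ is the disjoint union of log schemes $F_i$ such that every restriction $\varphi|_{F_i}\colon F_i\to Y$ is a face map of $Y$. -/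

import Mathlib

open CategoryTheory Opposite AlgebraicGeometry TopologicalSpace

universe u

noncomputable section

namespace LogGeom

/-! ### The étale site and its structure sheaf -/

/-- The scheme `X` as the final object of its small étale site. -/
def topEt (X : Scheme.{u}) : X.Etale := MorphismProperty.Over.mk ⊤ (𝟙 X) inferInstance

/-- An open subscheme `D` of a scheme `U` étale over `X`, as an object of the étale site. -/
def restr {X : Scheme.{u}} (U : X.Etale) (D : U.left.Opens) : X.Etale :=
  MorphismProperty.Over.mk ⊤ (D.ι ≫ U.hom) (by
    have : Etale U.hom := U.prop
    exact inferInstanceAs (Etale (D.ι ≫ U.hom)))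

/-- The morphism of open subschemes induced by a morphism of the étale site. -/
def restrHom {X : Scheme.{u}} {V U : X.Etale} (k : V ⟶ U) (D : U.left.Opens)
    (E : V.left.Opens) (e : E ≤ k.left ⁻¹ᵁ D) : restr V E ⟶ restr U D :=
  MorphismProperty.Over.homMk (k.left.resLE D E e) (by
    have := MorphismProperty.Over.w k
    change k.left.resLE D E e ≫ D.ι ≫ U.hom = E.ι ≫ V.hom
    rw [← this, Scheme.Hom.resLE_comp_ι_assoc])

/-- The structure sheaf `𝒪_X` on the étale site, as a sheaf of multiplicative monoids. -/
def structureMon (X : Scheme.{u}) : X.Etaleᵒᵖ ⥤ CommMonCat.{u} where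
  obj U := CommMonCat.of Γ(U.unop.left, ⊤)
  map k := CommMonCat.ofHom (k.unop.left.appTop.hom : _ →* _)
  map_id U := by
    ext x
    change (𝟙 U.unop.left : U.unop.left ⟶ _).appTop.hom x = x
    simp
  map_comp k l := by
    ext x
    change (l.unop.left ≫ k.unop.left).appTop.hom x = _
    rw [Scheme.Hom.comp_appTop]
    rfl

/-! ### Prelog and log structures -/

/-- A monoid with a multiplicative map to the structure sheaf.  (The sheaf condition on `M` is
part of `PrelogStructure.IsLog`.) -/
structure PrelogStructure (X : Scheme.{u}) where
  M : X.Etaleᵒᵖ ⥤ CommMonCat.{u}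
  α : M ⟶ structureMon X

namespace PrelogStructure

variable {X : Scheme.{u}} (L : PrelogStructure X)

/-- Sections of `M` over `U`. -/
abbrev sec (U : X.Etale) : Type u := L.M.obj (op U)

/-- Restriction of sections. -/
def res {V U : X.Etale} (k : V ⟶ U) : L.sec U →* L.sec V := (L.M.map k.op).hom

/-- The structure map `α` on sections over `U`. -/
def val (U : X.Etale) : L.sec U →* Γ(U.left, ⊤) := (L.α.app (op U)).hom

lemma res_id (U : X.Etale) (m : L.sec U) : L.res (𝟙 U) m = m := by
  simp [res]

lemma res_res {W V U : X.Etale} (l : W ⟶ V) (k : V ⟶ U) (m : L.sec U) :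
    L.res l (L.res k m) = L.res (l ≫ k) m := by
  simp [res]

lemma val_res {V U : X.Etale} (k : V ⟶ U) (m : L.sec U) :
    L.val V (L.res k m) = k.left.appTop.hom (L.val U m) :=
  congrArg (fun t => t.hom m) (L.α.naturality k.op)

/-- `α : M → 𝒪_X` is a log structure: `M` is an étale sheaf and `α⁻¹ 𝒪_X^× → 𝒪_X^×` is an
isomorphism. -/
structure IsLog : Prop where
  isSheaf : Presheaf.IsSheaf X.smallEtaleTopology L.M
  existsUnique_val_eq : ∀ (U : X.Etale) (a : Γ(U.left, ⊤)), IsUnit a → ∃! m : L.sec U, L.val U m = a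

/-- A monoid homomorphism `β : Q → M(X)` is a chart: `M` is the log structure associated with the
prelog structure `Q → M(X) → 𝒪_X(X)`, that is, it is initial among the log structures to which
that prelog structure maps. -/
def IsChart {Q : Type u} [CommMonoid Q] (β : Q →* L.sec (topEt X)) : Prop :=
  ∀ (N : PrelogStructure X), N.IsLog → ∀ γ : Q →* N.sec (topEt X),
    (∀ q, N.val _ (γ q) = L.val _ (β q)) →
    ∃! η : L.M ⟶ N.M, η ≫ N.α = L.α ∧ ∀ q, (η.app (op (topEt X))).hom (β q) = γ q

end PrelogStructure

/-- A morphism `f⁻¹ K → L` of sheaves of monoids, compatible with the maps to the structure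
sheaves, along a morphism of schemes `f : X ⟶ Y`: a compatible system of homomorphisms
`K(U) → L(V)` for all `h : V ⟶ U` over `f`, where `V` is étale over `X` and `U` is étale over `Y`. -/
@[ext]
structure Comorphism {X Y : Scheme.{u}} (f : X ⟶ Y) (L : PrelogStructure X)
    (K : PrelogStructure Y) where
  map : ∀ {V : X.Etale} {U : Y.Etale} (h : V.left ⟶ U.left), h ≫ U.hom = V.hom ≫ f →
    (K.sec U →* L.sec V)
  map_comp_left : ∀ {V' V : X.Etale} {U : Y.Etale} (k : V' ⟶ V) (h : V.left ⟶ U.left)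
    (w : h ≫ U.hom = V.hom ≫ f) (w' : (k.left ≫ h) ≫ U.hom = V'.hom ≫ f) (m : K.sec U),
    map (k.left ≫ h) w' m = L.res k (map h w m)
  map_comp_right : ∀ {V : X.Etale} {U' U : Y.Etale} (h : V.left ⟶ U'.left) (k : U' ⟶ U)
    (w : h ≫ U'.hom = V.hom ≫ f) (w' : (h ≫ k.left) ≫ U.hom = V.hom ≫ f) (m : K.sec U),
    map (h ≫ k.left) w' m = map h w (K.res k m)
  val_map : ∀ {V : X.Etale} {U : Y.Etale} (h : V.left ⟶ U.left) (w : h ≫ U.hom = V.hom ≫ f)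
    (m : K.sec U), L.val V (map h w m) = h.appTop.hom (K.val U m)

namespace Comorphism

variable {X Y Z : Scheme.{u}} {f : X ⟶ Y} {g : Y ⟶ Z} {L : PrelogStructure X}
  {K : PrelogStructure Y} {J : PrelogStructure Z}

lemma map_congr (c : Comorphism f L K) {V : X.Etale} {U : Y.Etale} {h h' : V.left ⟶ U.left}
    (e : h = h') (w : h ≫ U.hom = V.hom ≫ f) (m : K.sec U) :
    c.map h w m = c.map h' (e ▸ w) m := by
  subst e; rfl

/-- The base change along `g : Y ⟶ Z` of a scheme étale over `Z`. -/
def pb (g : Y ⟶ Z) (W : Z.Etale) : Y.Etale :=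
  MorphismProperty.Over.mk ⊤ (Limits.pullback.fst g W.hom) (by
    have : Etale W.hom := W.prop
    exact inferInstanceAs (Etale (Limits.pullback.fst g W.hom)))

/-- The projection of the base change. -/
def pbSnd (g : Y ⟶ Z) (W : Z.Etale) : (pb g W).left ⟶ W.left := Limits.pullback.snd g W.hom

lemma pbSnd_w (g : Y ⟶ Z) (W : Z.Etale) : pbSnd g W ≫ W.hom = (pb g W).hom ≫ g :=
  Limits.pullback.condition.symm

/-- The universal morphism to the base change. -/
def pbLift {T : Scheme.{u}} (g : Y ⟶ Z) (W : Z.Etale) (a : T ⟶ Y) (b : T ⟶ W.left)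
    (w : b ≫ W.hom = a ≫ g) : T ⟶ (pb g W).left :=
  Limits.pullback.lift a b w.symm

lemma pbLift_snd {T : Scheme.{u}} (g : Y ⟶ Z) (W : Z.Etale) (a : T ⟶ Y) (b : T ⟶ W.left)
    (w : b ≫ W.hom = a ≫ g) : pbLift g W a b w ≫ pbSnd g W = b :=
  Limits.pullback.lift_snd _ _ _

lemma pbLift_hom {T : Scheme.{u}} (g : Y ⟶ Z) (W : Z.Etale) (a : T ⟶ Y) (b : T ⟶ W.left)
    (w : b ≫ W.hom = a ≫ g) : pbLift g W a b w ≫ (pb g W).hom = a :=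
  Limits.pullback.lift_fst _ _ _

lemma pb_ext {T : Scheme.{u}} (g : Y ⟶ Z) (W : Z.Etale) {a b : T ⟶ (pb g W).left}
    (h₁ : a ≫ (pb g W).hom = b ≫ (pb g W).hom) (h₂ : a ≫ pbSnd g W = b ≫ pbSnd g W) : a = b :=
  Limits.pullback.hom_ext h₁ h₂

/-- Auxiliary: the composite on sections, through the base change. -/
def compMap (c : Comorphism f L K) (d : Comorphism g K J) {V : X.Etale} {W : Z.Etale}
    (h : V.left ⟶ W.left) (w : h ≫ W.hom = V.hom ≫ f ≫ g) : J.sec W →* L.sec V :=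
  (c.map (pbLift g W (V.hom ≫ f) h (by simpa using w)) (pbLift_hom _ _ _ _ _)).comp
    (d.map (pbSnd g W) (pbSnd_w g W))

lemma compMap_eq (c : Comorphism f L K) (d : Comorphism g K J) {V : X.Etale} {U : Y.Etale}
    {W : Z.Etale} (h₁ : V.left ⟶ U.left) (h₂ : U.left ⟶ W.left)
    (w₁ : h₁ ≫ U.hom = V.hom ≫ f) (w₂ : h₂ ≫ W.hom = U.hom ≫ g)
    (w : (h₁ ≫ h₂) ≫ W.hom = V.hom ≫ f ≫ g) (m : J.sec W) :
    compMap c d (h₁ ≫ h₂) w m = c.map h₁ w₁ (d.map h₂ w₂ m) := by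
  let k : U ⟶ pb g W := MorphismProperty.Over.homMk (pbLift g W U.hom h₂ w₂) (pbLift_hom _ _ _ _ _)
  have hk : k.left = pbLift g W U.hom h₂ w₂ := rfl
  have e₂ : h₂ = k.left ≫ pbSnd g W := by rw [hk, pbLift_snd]
  rw [d.map_congr e₂ w₂, d.map_comp_left k (pbSnd g W) (pbSnd_w g W),
    ← c.map_comp_right h₁ k w₁ (by rw [Category.assoc, hk, pbLift_hom, w₁])]
  refine c.map_congr ?_ _ _
  apply pb_ext
  · rw [pbLift_hom, Category.assoc, hk, pbLift_hom, w₁]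
  · rw [pbLift_snd, Category.assoc, hk, pbLift_snd]

/-- Composition of comorphisms. -/
def comp (c : Comorphism f L K) (d : Comorphism g K J) : Comorphism (f ≫ g) L J where
  map h w := compMap c d h w
  map_comp_left {V' V W} k h w w' m := by
    change c.map _ _ _ = _
    rw [compMap, MonoidHom.comp_apply, ← c.map_comp_left k _ _ (by
      rw [Category.assoc, pbLift_hom, ← Category.assoc, MorphismProperty.Over.w k])]
    refine c.map_congr ?_ _ _
    apply pb_ext
    · rw [pbLift_hom, Category.assoc, pbLift_hom, ← Category.assoc, MorphismProperty.Over.w k]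
    · rw [pbLift_snd, Category.assoc, pbLift_snd]
  map_comp_right {V W' W} h k w w' m := by
    have e : h ≫ k.left = pbLift g W' (V.hom ≫ f) h (by simpa using w) ≫ pbSnd g W' ≫ k.left := by
      rw [← Category.assoc, pbLift_snd]
    have w₂ : (pbSnd g W' ≫ k.left) ≫ W.hom = (pb g W').hom ≫ g := by
      rw [Category.assoc, MorphismProperty.Over.w k, pbSnd_w]
    have : compMap c d (h ≫ k.left) w' m = compMap c d _ (e ▸ w') m := by
      congr 2
    rw [this, compMap_eq c d _ _ (pbLift_hom _ _ _ _ _) w₂, d.map_comp_right _ _ (pbSnd_w g W')]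
    rfl
  val_map {V W} h w m := by
    change L.val V (c.map _ _ _) = _
    rw [c.val_map, d.val_map, ← CommRingCat.comp_apply, ← Scheme.Hom.comp_appTop, pbLift_snd]

/-- `c` exhibits `L` as the pullback log structure `f^* K`. -/
def IsStrict (c : Comorphism f L K) : Prop :=
  ∀ (N : PrelogStructure X), N.IsLog → ∀ d : Comorphism f N K,
    ∃! η : L.M ⟶ N.M, η ≫ N.α = L.α ∧
      ∀ {V : X.Etale} {U : Y.Etale} (h : V.left ⟶ U.left) (w : h ≫ U.hom = V.hom ≫ f)
        (m : K.sec U), (η.app (op V)).hom (c.map h w m) = d.map h w m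

end Comorphism


/-- The complement of an open and closed subset. -/
def clopenCompl {U : Scheme.{u}} (D : U.Opens) (hD : IsClosed (D : Set U)) : U.Opens :=
  ⟨(D : Set U)ᶜ, hD.isOpen_compl⟩

lemma glue_unique {U : Scheme.{u}} (D : U.Opens) (hD : IsClosed (D : Set U)) {s t : Γ(U, ⊤)}
    (h₁ : D.ι.appTop.hom s = D.ι.appTop.hom t)
    (h₂ : (clopenCompl D hD).ι.appTop.hom s = (clopenCompl D hD).ι.appTop.hom t) : s = t := by
  rw [Scheme.Opens.ι_appTop] at h₁ h₂
  refine U.sheaf.eq_of_locally_eq₂ (homOfLE le_top) (homOfLE le_top) ?_ s t h₁ h₂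
  intro x _
  simp only [Scheme.Opens.ι_image_top]
  by_cases hx : x ∈ D
  · exact Or.inl hx
  · exact Or.inr hx

lemma glue_exists {U : Scheme.{u}} (D : U.Opens) (hD : IsClosed (D : Set U))
    (a : Γ((D : Scheme.{u}), ⊤)) :
    ∃ s : Γ(U, ⊤), D.ι.appTop.hom s = a ∧ (clopenCompl D hD).ι.appTop.hom s = 0 := by
  let E := clopenCompl D hD
  have hdis : (D.ι ''ᵁ ⊤) ⊓ (E.ι ''ᵁ ⊤) = ⊥ := by
    simp only [Scheme.Opens.ι_image_top]
    ext x
    simp [E, clopenCompl]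
  let F : Bool → U.Opens := fun b => Bool.rec (E.ι ''ᵁ ⊤) (D.ι ''ᵁ ⊤) b
  let sf : ∀ b, Γ(U, F b) := fun b => Bool.rec (motive := fun b => Γ(U, F b)) 0 a b
  have hsub : ∀ V : U.Opens, V = ⊥ → Subsingleton Γ(U, V) := by
    rintro V rfl
    infer_instance
  obtain ⟨s, hs, -⟩ := U.sheaf.existsUnique_gluing' F ⊤ (fun b => homOfLE le_top) (by
      intro x _
      rw [Opens.mem_iSup]
      by_cases hx : x ∈ D
      · refine ⟨true, ?_⟩
        change x ∈ D.ι ''ᵁ ⊤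
        rwa [Scheme.Opens.ι_image_top]
      · refine ⟨false, ?_⟩
        change x ∈ E.ι ''ᵁ ⊤
        rw [Scheme.Opens.ι_image_top]
        exact hx) sf (by
      rintro (_ | _) (_ | _)
      · rfl
      · exact (hsub _ (by rw [← hdis, inf_comm])).elim _ _
      · exact (hsub _ hdis).elim _ _
      · rfl)
  refine ⟨s, ?_, ?_⟩
  · rw [Scheme.Opens.ι_appTop]
    exact hs true
  · rw [Scheme.Opens.ι_appTop]
    exact hs false

/-- Extension by zero of a function on an open and closed subscheme. -/
def extendZero {U : Scheme.{u}} (D : U.Opens) (hD : IsClosed (D : Set U))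
    (a : Γ((D : Scheme.{u}), ⊤)) : Γ(U, ⊤) := (glue_exists D hD a).choose

lemma extendZero_self {U : Scheme.{u}} (D : U.Opens) (hD : IsClosed (D : Set U))
    (a : Γ((D : Scheme.{u}), ⊤)) : D.ι.appTop.hom (extendZero D hD a) = a :=
  (glue_exists D hD a).choose_spec.1

lemma extendZero_compl {U : Scheme.{u}} (D : U.Opens) (hD : IsClosed (D : Set U))
    (a : Γ((D : Scheme.{u}), ⊤)) : (clopenCompl D hD).ι.appTop.hom (extendZero D hD a) = 0 :=
  (glue_exists D hD a).choose_spec.2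

lemma extendZero_pullback {V U : Scheme.{u}} (h : V ⟶ U) (D : U.Opens) (hD : IsClosed (D : Set U))
    (hD' : IsClosed ((h ⁻¹ᵁ D : V.Opens) : Set V)) (a : Γ((D : Scheme.{u}), ⊤)) :
    extendZero (h ⁻¹ᵁ D) hD' ((h.resLE D (h ⁻¹ᵁ D) le_rfl).appTop.hom a) =
      h.appTop.hom (extendZero D hD a) := by
  apply glue_unique (h ⁻¹ᵁ D) hD'
  · rw [extendZero_self, ← CommRingCat.comp_apply, ← Scheme.Hom.comp_appTop,
      ← Scheme.Hom.resLE_comp_ι h le_rfl, Scheme.Hom.comp_appTop, CommRingCat.comp_apply,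
      extendZero_self]
  · have e : clopenCompl (h ⁻¹ᵁ D) hD' ≤ h ⁻¹ᵁ clopenCompl D hD := le_rfl
    rw [extendZero_compl, ← CommRingCat.comp_apply, ← Scheme.Hom.comp_appTop,
      ← Scheme.Hom.resLE_comp_ι h e, Scheme.Hom.comp_appTop, CommRingCat.comp_apply,
      extendZero_compl, map_zero]

lemma ι_appTop_eq_of_le {U : Scheme.{u}} {E D : U.Opens} (e : E ≤ D) (s : Γ(U, ⊤)) :
    E.ι.appTop.hom s = (U.homOfLE e).appTop.hom (D.ι.appTop.hom s) := by
  rw [← CommRingCat.comp_apply, ← Scheme.Hom.comp_appTop, Scheme.homOfLE_ι]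

lemma extendZero_le {U : Scheme.{u}} {E D : U.Opens} (e : E ≤ D) (hD : IsClosed (D : Set U))
    (a : Γ((D : Scheme.{u}), ⊤)) :
    E.ι.appTop.hom (extendZero D hD a) = (U.homOfLE e).appTop.hom a := by
  rw [ι_appTop_eq_of_le e, extendZero_self]

lemma extendZero_mul {U : Scheme.{u}} (D E : U.Opens) (hD : IsClosed (D : Set U))
    (hE : IsClosed (E : Set U)) (h : IsClosed ((D ⊓ E : U.Opens) : Set U))
    (a : Γ((D : Scheme.{u}), ⊤)) (b : Γ((E : Scheme.{u}), ⊤)) :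
    extendZero (D ⊓ E) h ((U.homOfLE inf_le_left).appTop.hom a *
      (U.homOfLE inf_le_right).appTop.hom b) = extendZero D hD a * extendZero E hE b := by
  apply glue_unique (D ⊓ E) h
  · rw [extendZero_self, map_mul, extendZero_le inf_le_left, extendZero_le inf_le_right]
  · rw [extendZero_compl, map_mul]
    have hA : (clopenCompl D hD).ι.appTop.hom (extendZero D hD a * extendZero E hE b) = 0 := by
      rw [map_mul, extendZero_compl, zero_mul]
    have hB : (clopenCompl E hE).ι.appTop.hom (extendZero D hD a * extendZero E hE b) = 0 := by
      rw [map_mul, extendZero_compl, mul_zero]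
    rw [← map_mul]
    generalize extendZero D hD a * extendZero E hE b = x at hA hB
    rw [Scheme.Opens.ι_appTop] at hA hB ⊢
    have lA : (clopenCompl D hD).ι ''ᵁ ⊤ ≤ (clopenCompl (D ⊓ E) h).ι ''ᵁ ⊤ := by
      simp only [Scheme.Opens.ι_image_top]
      exact fun y hy hy' => hy hy'.1
    have lB : (clopenCompl E hE).ι ''ᵁ ⊤ ≤ (clopenCompl (D ⊓ E) h).ι ''ᵁ ⊤ := by
      simp only [Scheme.Opens.ι_image_top]
      exact fun y hy hy' => hy hy'.2
    refine (U.sheaf.eq_of_locally_eq₂ (homOfLE lA) (homOfLE lB) ?_ _ _ ?_ ?_).symm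
    · simp only [Scheme.Opens.ι_image_top]
      intro y hy
      by_cases hyD : y ∈ D
      · exact Or.inr fun hyE => hy ⟨hyD, hyE⟩
      · exact Or.inl hyD
    · refine Eq.trans ?_ (hA.trans (map_zero (U.presheaf.map (homOfLE lA).op).hom).symm)
      change (U.presheaf.map _ ≫ U.presheaf.map _).hom x = _
      rw [← U.presheaf.map_comp]
      rfl
    · refine Eq.trans ?_ (hB.trans (map_zero (U.presheaf.map (homOfLE lB).op).hom).symm)
      change (U.presheaf.map _ ≫ U.presheaf.map _).hom x = _
      rw [← U.presheaf.map_comp]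
      rfl


/-- The inclusion between open subschemes. -/
def restrLE {X : Scheme.{u}} (U : X.Etale) {E D : U.left.Opens} (e : E ≤ D) :
    restr U E ⟶ restr U D :=
  MorphismProperty.Over.homMk (U.left.homOfLE e) (by
    change U.left.homOfLE e ≫ D.ι ≫ U.hom = E.ι ≫ U.hom
    rw [Scheme.homOfLE_ι_assoc])

/-- The inclusion of an open subscheme. -/
def restrι {X : Scheme.{u}} (U : X.Etale) (D : U.left.Opens) : restr U D ⟶ U :=
  MorphismProperty.Over.homMk D.ι rfl

lemma restr_hom_ext {X : Scheme.{u}} {W U : X.Etale} {D : U.left.Opens} {a b : W ⟶ restr U D}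
    (h : a ≫ restrι U D = b ≫ restrι U D) : a = b :=
  MorphismProperty.Over.Hom.ext
    ((cancel_mono D.ι).1 (congrArg (fun t : W ⟶ U => (t.left : W.left ⟶ U.left)) h))

@[simp]
lemma restrLE_ι {X : Scheme.{u}} (U : X.Etale) {E D : U.left.Opens} (e : E ≤ D) :
    restrLE U e ≫ restrι U D = restrι U E :=
  MorphismProperty.Over.Hom.ext (Scheme.homOfLE_ι _ e)

@[simp]
lemma restrHom_ι {X : Scheme.{u}} {V U : X.Etale} (k : V ⟶ U) (D : U.left.Opens)
    (E : V.left.Opens) (e : E ≤ k.left ⁻¹ᵁ D) :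
    restrHom k D E e ≫ restrι U D = restrι V E ≫ k :=
  MorphismProperty.Over.Hom.ext (Scheme.Hom.resLE_comp_ι _ _)

lemma restrLE_comp_restrLE {X : Scheme.{u}} (U : X.Etale) {G E D : U.left.Opens} (e' : G ≤ E)
    (e : E ≤ D) : restrLE U e' ≫ restrLE U e = restrLE U (e'.trans e) :=
  restr_hom_ext (by simp)

lemma restrLE_refl {X : Scheme.{u}} (U : X.Etale) {D : U.left.Opens} (e : D ≤ D) :
    restrLE U e = 𝟙 _ :=
  restr_hom_ext (by simp)

lemma restr_sq {X : Scheme.{u}} {V U : X.Etale} (k : V ⟶ U) {G D : U.left.Opens} {E : V.left.Opens}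
    (e : G ≤ D) (e₁ : E ≤ k.left ⁻¹ᵁ G) (e₂ : E ≤ k.left ⁻¹ᵁ D) :
    restrLE V e₁ ≫ restrHom k G _ le_rfl ≫ restrLE U e =
      restrLE V e₂ ≫ restrHom k D _ le_rfl :=
  restr_hom_ext (by
    simp only [Category.assoc, restrLE_ι, restrHom_ι]
    simp only [← Category.assoc, restrLE_ι])

lemma restrHom_comp_restrHom {X : Scheme.{u}} {W V U : X.Etale} (l : W ⟶ V) (k : V ⟶ U)
    (D : U.left.Opens) (E : V.left.Opens) (G : W.left.Opens) (e : E ≤ k.left ⁻¹ᵁ D)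
    (e' : G ≤ l.left ⁻¹ᵁ E) (e'' : G ≤ (l ≫ k).left ⁻¹ᵁ D) :
    restrHom l E G e' ≫ restrHom k D E e = restrHom (l ≫ k) D G e'' :=
  restr_hom_ext (by rw [Category.assoc, restrHom_ι, restrHom_ι, ← Category.assoc, restrHom_ι,
    Category.assoc])

namespace PrelogStructure

variable {X : Scheme.{u}} (L : PrelogStructure X)

/-- A section over `U` of the sheaf of pointed monoids `M ∪ {∞}` (the sheaf associated with the
presheaf `U ↦ M(U) ∪ {∞}`): since the locus where a local section equals `∞` is both open and
closed, it is an open and closed part `D` of `U` together with a section of `M` over `D`; on the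
complement of `D` the section is `∞`. -/
structure PSec (U : X.Etale) where
  D : U.left.Opens
  isClosed : IsClosed (D : Set U.left)
  m : L.sec (restr U D)

namespace PSec

variable {L}

lemma ext' {U : X.Etale} {s t : L.PSec U} (h : s.D = t.D)
    (hm : L.res (restrLE U h.ge) s.m = t.m) : s = t := by
  obtain ⟨D, hD, m⟩ := s
  obtain ⟨D', hD', m'⟩ := t
  dsimp only at h hm
  subst h
  rw [restrLE_refl, res_id] at hm
  rw [hm]

/-- The product of sections of `M ∪ {∞}`; it is finite exactly where both factors are. -/
instance (U : X.Etale) : Mul (L.PSec U) where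
  mul s t := ⟨s.D ⊓ t.D, s.isClosed.inter t.isClosed,
    L.res (restrLE U inf_le_left) s.m * L.res (restrLE U inf_le_right) t.m⟩

instance (U : X.Etale) : One (L.PSec U) where
  one := ⟨⊤, isClosed_univ, 1⟩

/-- The section `∞`. (For a log structure, there is only one section of `M` over `∅`.) -/
def infty (U : X.Etale) : L.PSec U := ⟨⊥, isClosed_empty, 1⟩

lemma mul_D {U : X.Etale} (s t : L.PSec U) : (s * t).D = s.D ⊓ t.D := rfl

lemma mul_m {U : X.Etale} (s t : L.PSec U) :
    (s * t).m = L.res (restrLE U inf_le_left) s.m * L.res (restrLE U inf_le_right) t.m := rfl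

instance (U : X.Etale) : CommMonoid (L.PSec U) where
  mul_assoc a b c := by
    refine ext' (inf_assoc a.D b.D c.D) ?_
    simp only [mul_m, map_mul, res_res, restrLE_comp_restrLE, mul_assoc]
  one_mul a := by
    refine ext' (top_inf_eq a.D) ?_
    rw [mul_m, map_mul, res_res, res_res, restrLE_comp_restrLE, restrLE_comp_restrLE, restrLE_refl,
      res_id]
    change L.res _ 1 * _ = _
    rw [map_one, one_mul]
  mul_one a := by
    refine ext' (inf_top_eq a.D) ?_
    rw [mul_m, map_mul, res_res, res_res, restrLE_comp_restrLE, restrLE_comp_restrLE, restrLE_refl,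
      res_id]
    change _ * L.res _ 1 = _
    rw [map_one, mul_one]
  mul_comm a b := by
    refine ext' (inf_comm a.D b.D) ?_
    rw [mul_m, mul_m, map_mul, res_res, res_res, restrLE_comp_restrLE, restrLE_comp_restrLE,
      mul_comm]

/-- The inclusion of `M` into `M ∪ {∞}`. -/
def ofSec {U : X.Etale} (m : L.sec U) : L.PSec U :=
  ⟨⊤, isClosed_univ, L.res (restrι U ⊤) m⟩

/-- Restriction of sections of `M ∪ {∞}`. -/
def res {V U : X.Etale} (k : V ⟶ U) : L.PSec U →* L.PSec V where
  toFun s := ⟨k.left ⁻¹ᵁ s.D, s.isClosed.preimage k.left.continuous,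
    L.res (restrHom k s.D _ le_rfl) s.m⟩
  map_one' := ext' rfl (by
    change L.res _ (L.res _ 1) = 1
    rw [map_one, map_one])
  map_mul' s t := by
    refine ext' rfl ?_
    simp only [mul_m, map_mul, res_res]
    congr 1
    · exact congrArg (fun z => L.res z s.m) (restr_sq k inf_le_left _ _)
    · exact congrArg (fun z => L.res z t.m) (restr_sq k inf_le_right _ _)

/-- The structure map `M ∪ {∞} → 𝒪_X`, extending `α` by `∞ ↦ 0`. -/
def val (U : X.Etale) : L.PSec U →* Γ(U.left, ⊤) where
  toFun s := extendZero s.D s.isClosed (L.val (restr U s.D) s.m)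
  map_one' := by
    apply glue_unique ⊤ isClosed_univ
    · refine (extendZero_self _ _ _).trans ?_
      change L.val _ 1 = _
      rw [map_one]
      exact (map_one _).symm
    · have : IsEmpty (clopenCompl (⊤ : U.left.Opens) isClosed_univ : Scheme.{u}) :=
        ⟨fun x => x.2 trivial⟩
      exact Subsingleton.elim _ _
  map_mul' s t := by
    refine Eq.trans ?_ (extendZero_mul s.D t.D s.isClosed t.isClosed
      (s.isClosed.inter t.isClosed) _ _)
    congr 1
    change L.val _ (L.res _ _ * L.res _ _) = _
    rw [map_mul, val_res, val_res]
    rfl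

lemma res_eq {V U : X.Etale} {k : V ⟶ U} {s : L.PSec U} {t : L.PSec V}
    (h : t.D = k.left ⁻¹ᵁ s.D) (hm : t.m = L.res (restrHom k s.D t.D h.le) s.m) :
    res k s = t := by
  obtain ⟨D, hD, m⟩ := t
  dsimp only at h hm
  subst h
  rw [hm]
  rfl

lemma res_id (U : X.Etale) (s : L.PSec U) : res (𝟙 U) s = s := by
  refine res_eq rfl ?_
  refine (L.res_id _ s.m).symm.trans ?_
  congr 2
  exact restr_hom_ext (by rw [restrHom_ι, Category.id_comp, Category.comp_id])

lemma res_comp {W V U : X.Etale} (l : W ⟶ V) (k : V ⟶ U) (s : L.PSec U) :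
    res (l ≫ k) s = res l (res k s) := by
  refine res_eq rfl ?_
  refine (L.res_res _ _ s.m).trans ?_
  congr 2
  exact restrHom_comp_restrHom _ _ _ _ _ _ _ _

lemma val_res {V U : X.Etale} (k : V ⟶ U) (s : L.PSec U) :
    val V (res k s) = k.left.appTop.hom (val U s) := by
  refine Eq.trans ?_ (extendZero_pullback k.left s.D s.isClosed
    (s.isClosed.preimage k.left.continuous) (L.val _ s.m))
  refine congrArg (extendZero _ _) ?_
  exact L.val_res _ _

end PSec

/-- The sheaf of pointed monoids `M ∪ {∞}`, with its map to `𝒪_X`. -/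
def pointed : PrelogStructure X where
  M :=
    { obj := fun U => CommMonCat.of (L.PSec U.unop)
      map := fun k => CommMonCat.ofHom (PSec.res k.unop)
      map_id := fun U => by
        ext s
        exact PSec.res_id _ _
      map_comp := fun k l => by
        ext s
        exact PSec.res_comp _ _ _ }
  α :=
    { app := fun U => CommMonCat.ofHom (PSec.val U.unop)
      naturality := fun U V k => by
        ext s
        exact PSec.val_res _ _ }

end PrelogStructure


/-- The inclusion of an open subscheme, as a morphism of schemes. -/
def ιl {X : Scheme.{u}} (U : X.Etale) (D : U.left.Opens) : (restr U D).left ⟶ U.left := D.ι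

lemma restr_left_ext {X : Scheme.{u}} {T : Scheme.{u}} {U : X.Etale} {D : U.left.Opens}
    {a b : T ⟶ (restr U D).left} (h : a ≫ ιl U D = b ≫ ιl U D) : a = b :=
  (cancel_mono D.ι).1 h

lemma ιl_hom {X : Scheme.{u}} (U : X.Etale) (D : U.left.Opens) :
    ιl U D ≫ U.hom = (restr U D).hom := rfl

lemma restrLE_ιl {X : Scheme.{u}} (U : X.Etale) {E D : U.left.Opens} (e : E ≤ D) :
    (restrLE U e).left ≫ ιl U D = ιl U E := Scheme.homOfLE_ι _ e

lemma restrHom_ιl {X : Scheme.{u}} {V U : X.Etale} (k : V ⟶ U) (D : U.left.Opens)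
    (E : V.left.Opens) (e : E ≤ k.left ⁻¹ᵁ D) :
    (restrHom k D E e).left ≫ ιl U D = ιl V E ≫ k.left :=
  Scheme.Hom.resLE_comp_ι _ _

section

variable {X Y : Scheme.{u}} {V : X.Etale} {U : Y.Etale}

/-- The restriction of a morphism to open subschemes. -/
def resOver (h : V.left ⟶ U.left) (D : U.left.Opens) (E : V.left.Opens) (e : E ≤ h ⁻¹ᵁ D) :
    (restr V E).left ⟶ (restr U D).left := h.resLE D E e

lemma resOver_ιl (h : V.left ⟶ U.left) (D : U.left.Opens) (E : V.left.Opens) (e : E ≤ h ⁻¹ᵁ D) :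
    resOver h D E e ≫ ιl U D = ιl V E ≫ h := Scheme.Hom.resLE_comp_ι _ _

lemma resOver_w {f : X ⟶ Y} (h : V.left ⟶ U.left) (w : h ≫ U.hom = V.hom ≫ f)
    (D : U.left.Opens) (E : V.left.Opens) (e : E ≤ h ⁻¹ᵁ D) :
    resOver h D E e ≫ (restr U D).hom = (restr V E).hom ≫ f := by
  rw [← ιl_hom, ← ιl_hom, ← Category.assoc, resOver_ιl, Category.assoc, w, Category.assoc]

lemma restrHom_resOver {V' : X.Etale} (k : V' ⟶ V) (h : V.left ⟶ U.left) (D : U.left.Opens)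
    (E : V.left.Opens) (e : E ≤ h ⁻¹ᵁ D) (E' : V'.left.Opens) (e' : E' ≤ k.left ⁻¹ᵁ E)
    (e'' : E' ≤ (k.left ≫ h) ⁻¹ᵁ D) :
    (restrHom k E E' e').left ≫ resOver h D E e = resOver (k.left ≫ h) D E' e'' :=
  restr_left_ext (by rw [Category.assoc, resOver_ιl, resOver_ιl, ← Category.assoc,
    restrHom_ιl, Category.assoc])

lemma resOver_restrHom {U' : Y.Etale} (h : V.left ⟶ U'.left) (k : U' ⟶ U) (D : U.left.Opens)
    (D' : U'.left.Opens) (e : D' ≤ k.left ⁻¹ᵁ D) (E : V.left.Opens) (e' : E ≤ h ⁻¹ᵁ D')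
    (e'' : E ≤ (h ≫ k.left) ⁻¹ᵁ D) :
    resOver h D' E e' ≫ (restrHom k D D' e).left = resOver (h ≫ k.left) D E e'' :=
  restr_left_ext (by rw [Category.assoc, resOver_ιl, restrHom_ιl, ← Category.assoc,
    resOver_ιl, Category.assoc])

end

namespace Comorphism

variable {X Y : Scheme.{u}} {f : X ⟶ Y} {L : PrelogStructure X} {K : PrelogStructure Y}

lemma map_res (c : Comorphism f L K) {V : X.Etale} {U' U : Y.Etale} {h : V.left ⟶ U'.left}
    {h' : V.left ⟶ U.left} (k : U' ⟶ U) (w : h ≫ U'.hom = V.hom ≫ f)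
    (w' : h' ≫ U.hom = V.hom ≫ f) (e : h ≫ k.left = h') (m : K.sec U) :
    c.map h w (K.res k m) = c.map h' w' m := by
  subst e
  exact (c.map_comp_right h k w w' m).symm

lemma res_map (c : Comorphism f L K) {V' V : X.Etale} {U : Y.Etale} {h : V.left ⟶ U.left}
    {h' : V'.left ⟶ U.left} (k : V' ⟶ V) (w : h ≫ U.hom = V.hom ≫ f)
    (w' : h' ≫ U.hom = V'.hom ≫ f) (e : k.left ≫ h = h') (m : K.sec U) :
    L.res k (c.map h w m) = c.map h' w' m := by
  subst e
  exact (c.map_comp_left k h w w' m).symm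

/-- The map on sections of `M ∪ {∞}`. -/
def pmap (c : Comorphism f L K) {V : X.Etale} {U : Y.Etale} (h : V.left ⟶ U.left)
    (w : h ≫ U.hom = V.hom ≫ f) (s : K.PSec U) : L.PSec V :=
  ⟨h ⁻¹ᵁ s.D, s.isClosed.preimage h.continuous,
    c.map (resOver h s.D _ le_rfl) (resOver_w h w _ _ _) s.m⟩

lemma pmap_eq (c : Comorphism f L K) {V : X.Etale} {U : Y.Etale} {h : V.left ⟶ U.left}
    {w : h ≫ U.hom = V.hom ≫ f} {s : K.PSec U} {t : L.PSec V} (e : t.D = h ⁻¹ᵁ s.D)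
    (hm : t.m = c.map (resOver h s.D t.D e.le) (resOver_w h w _ _ _) s.m) :
    c.pmap h w s = t := by
  obtain ⟨D, hD, m⟩ := t
  dsimp only at e hm
  subst e
  rw [hm]
  rfl

lemma res_map_eq_map_res (c : Comorphism f L K) {V : X.Etale} {U : Y.Etale} (h : V.left ⟶ U.left)
    (w : h ≫ U.hom = V.hom ≫ f) {D G : U.left.Opens} {E : V.left.Opens} (l : G ≤ D)
    (l' : E ≤ h ⁻¹ᵁ D) (e : E ≤ h ⁻¹ᵁ G) (m : K.sec (restr U D)) :
    L.res (restrLE V l') (c.map (resOver h D _ le_rfl) (resOver_w h w _ _ _) m) =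
      c.map (resOver h G E e) (resOver_w h w _ _ _) (K.res (restrLE U l) m) := by
  rw [c.map_res (restrLE U l) _ (resOver_w h w D E l'), c.res_map (restrLE V l')]
  · exact restr_left_ext (by rw [Category.assoc, resOver_ιl, resOver_ιl, ← Category.assoc,
      restrLE_ιl])
  · exact restr_left_ext (by rw [Category.assoc, restrLE_ιl, resOver_ιl, resOver_ιl])

lemma pmap_infty (c : Comorphism f L K) {V : X.Etale} {U : Y.Etale} (h : V.left ⟶ U.left)
    (w : h ≫ U.hom = V.hom ≫ f) :
    c.pmap h w (PrelogStructure.PSec.infty U) = PrelogStructure.PSec.infty V :=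
  c.pmap_eq rfl (map_one (c.map _ _)).symm

/-- The morphism of sheaves of pointed monoids induced by a morphism of sheaves of monoids. -/
def pointed (c : Comorphism f L K) : Comorphism f L.pointed K.pointed where
  map {V U} h w :=
    { toFun := fun s => c.pmap h w s
      map_one' := c.pmap_eq rfl (map_one (c.map _ _)).symm
      map_mul' := fun (s t : K.PSec U) => c.pmap_eq rfl (by
        change L.res _ (c.map _ _ s.m) * L.res _ (c.map _ _ t.m) =
          c.map _ _ (K.res _ s.m * K.res _ t.m)
        refine Eq.trans ?_ (map_mul (c.map _ _) _ _).symm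
        exact congrArg₂ _ (c.res_map_eq_map_res h w inf_le_left inf_le_left _ s.m)
          (c.res_map_eq_map_res h w inf_le_right inf_le_right _ t.m)) }
  map_comp_left {V' V U} k h w w' s := c.pmap_eq (w := w') rfl
    (c.res_map _ _ (resOver_w _ w' _ _ _) (restrHom_resOver k h _ _ _ _ _ _) _)
  map_comp_right {V U' U} h k w w' s := c.pmap_eq (w := w') rfl
    (c.map_res _ _ (resOver_w _ w' _ _ _) (resOver_restrHom h k _ _ _ _ _ _) _)
  val_map {V U} h w s := by
    refine Eq.trans ?_ (extendZero_pullback h s.D s.isClosed (s.isClosed.preimage h.continuous) _)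
    refine congrArg (extendZero _ _) ?_
    exact c.val_map _ _ _

end Comorphism


/-! ### Log schemes, morphisms and pointed morphisms -/

/-- A log scheme: a scheme with a log structure which étale locally admits charts by finitely
generated monoids. -/
structure LogScheme where
  toScheme : Scheme.{u}
  str : PrelogStructure toScheme
  isLog : str.IsLog
  exists_chart : ∀ x : toScheme, ∃ (U : Scheme.{u}) (j : U ⟶ toScheme) (K : PrelogStructure U)
    (c : Comorphism j K str) (Q : Type u) (_ : CommMonoid Q) (β : Q →* K.sec (topEt U)),
    Etale j ∧ x ∈ Set.range j ∧ K.IsLog ∧ c.IsStrict ∧ Monoid.FG Q ∧ K.IsChart β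

/-- A morphism of log schemes. -/
@[ext]
structure LogHom (X Y : LogScheme.{u}) where
  base : X.toScheme ⟶ Y.toScheme
  comor : Comorphism base X.str Y.str

/-- A strict morphism of log schemes. -/
def LogHom.IsStrict {X Y : LogScheme.{u}} (f : LogHom X Y) : Prop := f.comor.IsStrict

/-- A pointed morphism of log schemes: a morphism of schemes together with a morphism of sheaves of
pointed monoids `f^* M_Y ∪ {∞} → M_X ∪ {∞}`, compatible with the structure maps to `𝒪_X`
(where `∞ ↦ 0`). -/
@[ext]
structure PointedHom (X Y : LogScheme.{u}) where
  base : X.toScheme ⟶ Y.toScheme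
  comor : Comorphism base X.str.pointed Y.str.pointed
  map_infty : ∀ {V : X.toScheme.Etale} {U : Y.toScheme.Etale} (h : V.left ⟶ U.left)
    (w : h ≫ U.hom = V.hom ≫ base),
    comor.map h w (PrelogStructure.PSec.infty U) = PrelogStructure.PSec.infty V

/-- A morphism of log schemes, viewed as a pointed morphism. -/
def LogHom.toPointed {X Y : LogScheme.{u}} (f : LogHom X Y) : PointedHom X Y where
  base := f.base
  comor := f.comor.pointed
  map_infty h w := f.comor.pmap_infty h w

/-- Composition of pointed morphisms. -/
def PointedHom.comp {X Y Z : LogScheme.{u}} (f : PointedHom X Y) (g : PointedHom Y Z) :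
    PointedHom X Z where
  base := f.base ≫ g.base
  comor := f.comor.comp g.comor
  map_infty h w := by
    change f.comor.map _ _ (g.comor.map _ _ _) = _
    rw [g.map_infty, f.map_infty]

/-! ### Faces -/

/-- A prime ideal of a (multiplicatively written) commutative monoid. -/
structure IsPrimeIdeal {Q : Type u} [CommMonoid Q] (p : Set Q) : Prop where
  mul_mem : ∀ a ∈ p, ∀ b, a * b ∈ p
  ne_univ : p ≠ Set.univ
  mem_or_mem : ∀ a b, a * b ∈ p → a ∈ p ∨ b ∈ p

/-- The face complementary to a prime ideal. -/
def IsPrimeIdeal.face {Q : Type u} [CommMonoid Q] {p : Set Q} (hp : IsPrimeIdeal p) :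
    Submonoid Q where
  carrier := pᶜ
  one_mem' h := hp.ne_univ (Set.eq_univ_of_forall fun b => by simpa using hp.mul_mem 1 h b)
  mul_mem' ha hb h := (hp.mem_or_mem _ _ h).elim ha hb

/-- The closed immersion `Spec (ℤ[Q]/(p)) ⟶ Spec ℤ[Q]`. -/
def specQuot {Q : Type u} [CommMonoid Q] (p : Set Q) :
    Spec (CommRingCat.of (MonoidAlgebra ℤ Q ⧸ Ideal.span (MonoidAlgebra.of ℤ Q '' p))) ⟶
      Spec (CommRingCat.of (MonoidAlgebra ℤ Q)) :=
  Spec.map (CommRingCat.ofHom (Ideal.Quotient.mk _))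

/-- The morphism of schemes `U ⟶ Spec ℤ[Q]` given by a homomorphism `Q → M_U(U)`. -/
def toSpecMonoid {U : LogScheme.{u}} {Q : Type u} [CommMonoid Q]
    (β : Q →* U.str.sec (topEt U.toScheme)) :
    U.toScheme ⟶ Spec (CommRingCat.of (MonoidAlgebra ℤ Q)) :=
  U.toScheme.toSpecΓ ≫ Spec.map (CommRingCat.ofHom
    (MonoidAlgebra.lift ℤ Γ(U.toScheme, ⊤) Q ((U.str.val (topEt U.toScheme)).comp β)).toRingHom)

/-- The map of a pointed morphism on global sections. -/
def PointedHom.mapTop {X Y : LogScheme.{u}} (f : PointedHom X Y) :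
    Y.str.PSec (topEt Y.toScheme) →* X.str.PSec (topEt X.toScheme) :=
  f.comor.map (V := topEt X.toScheme) (U := topEt Y.toScheme) f.base
    ((Category.comp_id _).trans (Category.id_comp _).symm)

/-- Let `β : Q → M_U(U)` be a chart and `p` a prime ideal of `Q` with complementary face `R`.
`z : Z → U` is the face `Z^p`: its underlying scheme is
`U ×_{Spec ℤ[Q]} Spec (ℤ[Q]/(p))`, its log structure has a chart by `R`, and the pointed morphism
is given on charts by `Q ∪ {∞} → R ∪ {∞}`, the identity on `R` and `∞` on `p`. -/
def IsFaceOfChart {U : LogScheme.{u}} {Q : Type u} [CommMonoid Q]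
    (β : Q →* U.str.sec (topEt U.toScheme)) {p : Set Q} (hp : IsPrimeIdeal p)
    {Z : LogScheme.{u}} (z : PointedHom Z U) : Prop :=
  (∃ t, IsPullback z.base t (toSpecMonoid β) (specQuot p)) ∧
  ∃ γ : hp.face →* Z.str.sec (topEt Z.toScheme), Z.str.IsChart γ ∧
    (∀ r : hp.face, z.mapTop (PrelogStructure.PSec.ofSec (β r)) =
      PrelogStructure.PSec.ofSec (γ r)) ∧
    ∀ q ∈ p, z.mapTop (PrelogStructure.PSec.ofSec (β q)) = PrelogStructure.PSec.infty _

/-- `c : C → U` is a connected component of the face `Z^p`, with the restricted log structure. -/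
def IsComponentOfFace {U : LogScheme.{u}} {Q : Type u} [CommMonoid Q]
    (β : Q →* U.str.sec (topEt U.toScheme)) {p : Set Q} (hp : IsPrimeIdeal p)
    {C : LogScheme.{u}} (c : PointedHom C U) : Prop :=
  ∃ (Z : LogScheme.{u}) (z : PointedHom Z U) (e : LogHom C Z), IsFaceOfChart β hp z ∧
    IsOpenImmersion e.base ∧ IsClosed (Set.range e.base) ∧ ConnectedSpace C.toScheme ∧
    e.IsStrict ∧ e.toPointed.comp z = c

/-- `W` is the disjoint union of the log schemes `C i`. -/
structure IsDisjointUnion {ι : Type u} {C : ι → LogScheme.{u}} {W : LogScheme.{u}}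
    (e : ∀ i, LogHom (C i) W) : Prop where
  isStrict : ∀ i, (e i).IsStrict
  isColimit : Nonempty (Limits.IsColimit
    (Limits.Cofan.mk W.toScheme (fun i => (e i).base)))

/-- `w : W → U` is a disjoint union of pairwise different faces of `U`, where faces are
taken with respect to the chart `β`. -/
def IsUnionOfFacesOfChart {U : LogScheme.{u}} {Q : Type u} [CommMonoid Q]
    (β : Q →* U.str.sec (topEt U.toScheme)) {W : LogScheme.{u}} (w : PointedHom W U) : Prop :=
  ∃ (ι : Type u) (C : ι → LogScheme.{u}) (e : ∀ i, LogHom (C i) W) (p : ι → Set Q)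
    (hp : ∀ i, IsPrimeIdeal (p i)),
    IsDisjointUnion e ∧ (∀ i, IsComponentOfFace β (hp i) ((e i).toPointed.comp w)) ∧
    ∀ i j, i ≠ j → p i = p j →
      Disjoint (Set.range ((e i).base ≫ w.base)) (Set.range ((e j).base ≫ w.base))

/-- `φ : F → Y` is a face map: `F` is connected, and on every strict étale `U → Y` with a chart
by a finitely generated monoid, `F` restricts to a disjoint union of pairwise different faces
of the chart.  (This is the étale-local notion: étale locally on `Y` a face map is a disjoint union
of closed immersions.  If `Y` itself has a chart, a face map is the same as a connected component
of one of the faces `Z^p` of that chart.) -/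
def IsFaceMap {F Y : LogScheme.{u}} (φ : PointedHom F Y) : Prop :=
  ConnectedSpace F.toScheme ∧
  ∀ (U : LogScheme.{u}) (j : LogHom U Y), j.IsStrict → Etale j.base →
    ∀ (Q : Type u) [CommMonoid Q] [Monoid.FG Q] (β : Q →* U.str.sec (topEt U.toScheme)),
      U.str.IsChart β →
      ∃ (W : LogScheme.{u}) (k : LogHom W F) (w : PointedHom W U), k.IsStrict ∧
        IsPullback k.base w.base φ.base j.base ∧
        k.toPointed.comp φ = w.comp j.toPointed ∧ IsUnionOfFacesOfChart β w

/-- `φ : F → Y` is a disjoint union of face maps. -/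
def IsDisjointUnionOfFaceMaps {F Y : LogScheme.{u}} (φ : PointedHom F Y) : Prop :=
  ∃ (ι : Type u) (C : ι → LogScheme.{u}) (e : ∀ i, LogHom (C i) F),
    IsDisjointUnion e ∧ ∀ i, IsFaceMap ((e i).toPointed.comp φ)

end LogGeom

end

set_option linter.unusedVariables false

noncomputable section

namespace LogGeom

/-! The target `F` can be chosen independently of `X`: it is a scheme `E` over `Y` classifying the
possible patterns of infinite sections. For a pointed morphism `T → Y`, the locus where the image of
a section of `M_Y` is finite is open and closed, so it is recorded by an idempotent `e`; the value
`a` of the section vanishes elsewhere, which says `e * a = a`. Such pairs `(e, a)` form a log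
structure `supp T` on every scheme `T`, because a unit `a` forces `e = 1`. A morphism `T ⟶ Y` with a
comorphism to `supp T`, a `SuppPoint`, therefore remembers which sections become infinite and needs
no other log structure on `T`.

Representability. Over a chart by `Q`, a point with support is a multiplicative family of
idempotents `e q` with `e q * θ q = θ q`, where `θ q` is the value of `q` (`IsVal.unique_point`,
`IsVal.unique_val`, `exists_point`). On an affine base this is represented by the spectrum of
`SupportRing` (`exists_isRep_chart`). Affine étale descent (`IsRep.affine_descend`) and Zariski
gluing (`exists_isRep_id`) give a scheme `E` over all of `Y` (`LogScheme.exists_isRep`).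

The log structure on `E`. Pull `M_Y` back to `E`. The sections with `e = 1` form a log structure
`univLog`; any other section is finite on an open and closed part and is declared `∞` on the rest,
which gives the universal pointed morphism `E → Y`. Pointed morphisms to `Y` with a prescribed
support are the same as morphisms of log structures out of `univLog` (`existsUnique_lift`). Hence
classifying the support of `f` yields `X → E`, and lifting it to log structures yields the
factorization (`exists_comp_suppMap_eq`).

Faces. Let `U → Y` be strict étale with a chart by a finitely generated `Q`, and `W = E ×_Y U`. At a
point of `W` the elements of `Q` with `e q = 0` form a prime ideal, and this prime is locally
constant because finitely many generators determine it (`primeAt_isLocallyConstant`). So `W` is the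
disjoint union of open and closed strata, one for each prime `p`. On a stratum the elements of `p`
have value `0`; conversely a morphism `T → U` on which they have value `0` carries exactly one
support with `e = 0` on `p` and `e = 1` off `p`. Thus the stratum is the scheme `Z^p`
(`IsChartUniv.isPullback_stratum`), and the universal property of `univLog` turns the chart `Q` into
a chart by the face `Q \ p` (`IsChartUniv.exists_face_chart`). Strata are closed in the locally
Noetherian scheme `U`, so `E` is locally connected and is the disjoint union of its components; over
`U` a component of `E` becomes a disjoint union of components of strata (`suppMap_isFaceMap`). -/

/-! ### Étale covers and the sheaf condition on sections -/

/-- A jointly surjective family in the étale site. -/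
def JointlySurj {X : Scheme.{u}} {U : X.Etale} {ι : Type u} {V : ι → X.Etale}
    (k : ∀ i, V i ⟶ U) : Prop :=
  ∀ x : U.left, ∃ (i : ι) (y : (V i).left), (k i).left y = x

lemma JointlySurj.mem {X : Scheme.{u}} {U : X.Etale} {ι : Type u} {V : ι → X.Etale}
    {k : ∀ i, V i ⟶ U} (hk : JointlySurj k) :
    Sieve.ofArrows _ k ∈ X.smallEtaleTopology U := by
  rw [Scheme.ofArrows_mem_smallEtaleTopology_iff]
  ext x
  simpa using hk x

/-- A covering sieve is generated by the family of all its own arrows, so the surjectivity criterion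
for families applies to it. -/
lemma exists_of_mem {X : Scheme.{u}} {U : X.Etale} {S : Sieve U}
    (hS : S ∈ X.smallEtaleTopology U) (x : U.left) :
    ∃ (V : X.Etale) (k : V ⟶ U), S k ∧ ∃ y : V.left, k.left y = x := by
  have h : S = Sieve.ofArrows (fun t : Σ V : X.Etale, {k : V ⟶ U // S k} => t.1)
      (fun t => t.2.1) := by
    ext V k
    rw [Sieve.mem_ofArrows_iff]
    constructor
    · intro hk
      exact ⟨⟨V, k, hk⟩, 𝟙 _, by simp⟩
    · rintro ⟨t, a, rfl⟩
      exact S.downward_closed t.2.2 _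
  rw [h, Scheme.ofArrows_mem_smallEtaleTopology_iff] at hS
  have := Set.mem_univ x
  rw [← hS] at this
  simp only [Set.mem_iUnion, Set.mem_range] at this
  obtain ⟨t, y, hy⟩ := this
  exact ⟨t.1, t.2.1, t.2.2, y, hy⟩

/-- The fibre product in the étale site. -/
def prodEt {X : Scheme.{u}} {U V W : X.Etale} (a : V ⟶ U) (b : W ⟶ U) : X.Etale :=
  MorphismProperty.Over.mk ⊤ (Limits.pullback.fst a.left b.left ≫ V.hom) (by
    have : Etale V.hom := V.prop
    have : Etale b.left := by
      have h1 : Etale U.hom := U.prop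
      have h2 : Etale (b.left ≫ U.hom) := by
        rw [MorphismProperty.Over.w b]; exact W.prop
      exact MorphismProperty.of_postcomp (W := @Etale) (W' := @Etale) b.left U.hom h1 h2
    exact inferInstanceAs (Etale (Limits.pullback.fst a.left b.left ≫ V.hom)))

/-- The first projection. -/
def prodFst {X : Scheme.{u}} {U V W : X.Etale} (a : V ⟶ U) (b : W ⟶ U) : prodEt a b ⟶ V :=
  MorphismProperty.Over.homMk (Limits.pullback.fst a.left b.left) rfl

/-- The second projection. -/
def prodSnd {X : Scheme.{u}} {U V W : X.Etale} (a : V ⟶ U) (b : W ⟶ U) : prodEt a b ⟶ W :=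
  MorphismProperty.Over.homMk (Limits.pullback.snd a.left b.left) (by
    change _ = Limits.pullback.fst a.left b.left ≫ V.hom
    have ha : a.left ≫ U.hom = V.hom := MorphismProperty.Over.w a
    have hb : b.left ≫ U.hom = W.hom := MorphismProperty.Over.w b
    refine (congrArg (Limits.pullback.snd a.left b.left ≫ ·) hb.symm).trans ?_
    refine Eq.trans ?_ (congrArg (Limits.pullback.fst a.left b.left ≫ ·) ha)
    exact Limits.pullback.condition_assoc (f := a.left) (g := b.left) U.hom |>.symm)

lemma prod_condition {X : Scheme.{u}} {U V W : X.Etale} (a : V ⟶ U) (b : W ⟶ U) :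
    prodFst a b ≫ a = prodSnd a b ≫ b :=
  MorphismProperty.Over.Hom.ext Limits.pullback.condition

lemma exists_prod_point {X : Scheme.{u}} {U V W : X.Etale} (a : V ⟶ U) (b : W ⟶ U)
    (x : V.left) (y : W.left) (h : a.left x = b.left y) :
    ∃ z : (prodEt a b).left, (prodFst a b).left z = x ∧ (prodSnd a b).left z = y :=
  Scheme.Pullback.exists_preimage_pullback x y h

namespace PrelogStructure

variable {X : Scheme.{u}} (L : PrelogStructure X)

/-- The sheaf condition in terms of sections. -/
structure Gluing : Prop where
  ext : ∀ {U : X.Etale} {ι : Type u} {V : ι → X.Etale} (k : ∀ i, V i ⟶ U), JointlySurj k →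
    ∀ s t : L.sec U, (∀ i, L.res (k i) s = L.res (k i) t) → s = t
  glue : ∀ {U : X.Etale} {ι : Type u} {V : ι → X.Etale} (k : ∀ i, V i ⟶ U), JointlySurj k →
    ∀ x : ∀ i, L.sec (V i), (∀ i j (W : X.Etale) (a : W ⟶ V i) (b : W ⟶ V j),
      a ≫ k i = b ≫ k j → L.res a (x i) = L.res b (x j)) →
    ∃ s, ∀ i, L.res (k i) s = x i

variable {L}

/-- A sieve has too many arrows for the index universe of `Gluing`. One arrow through each point of
`U` is enough: this family is indexed by points and still covers, and the value on any other arrow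
of the sieve is recovered on fibre products with the chosen ones. -/
lemma Gluing.isSheaf (h : L.Gluing) : Presheaf.IsSheaf X.smallEtaleTopology L.M := by
  intro E U S hS
  have hsep : ∀ {W : X.Etale} {T : Sieve W}, T ∈ X.smallEtaleTopology W →
      ∀ s t : L.sec W, (∀ V (k : V ⟶ W), T k → L.res k s = L.res k t) → s = t := by
    intro W T hT s t hst
    choose V k hk y hy using exists_of_mem hT
    exact h.ext k (fun x => ⟨x, y x, hy x⟩) s t fun i => hst _ _ (hk i)
  intro x hx
  choose V k hk y hy using exists_of_mem hS
  have hkc : JointlySurj k := fun x => ⟨x, y x, hy x⟩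
  have hg : ∀ e : E, ∃ s : L.sec U, ∀ i, L.res (k i) s = (x (k i) (hk i)).hom e := by
    intro e
    refine h.glue k hkc _ fun i j W a b hab => ?_
    have := hx a b (hk i) (hk j) hab
    exact congrArg (fun t => t.hom e) this
  have hall : ∀ (e : E) (s : L.sec U), (∀ i, L.res (k i) s = (x (k i) (hk i)).hom e) →
      ∀ W (l : W ⟶ U) (hl : S l), L.res l s = (x l hl).hom e := by
    intro e s hs W l hl
    refine h.ext (fun i => prodFst l (k i)) ?_ _ _ fun i => ?_
    · intro w
      obtain ⟨z, hz, -⟩ := exists_prod_point l (k (l.left w)) w (y (l.left w)) (hy _).symm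
      exact ⟨_, z, hz⟩
    · rw [L.res_res, prod_condition, ← L.res_res, hs]
      have := hx (prodFst l (k i)) (prodSnd l (k i)) hl (hk i) (prod_condition _ _)
      exact (congrArg (fun t => t.hom e) this).symm
  choose s hs using hg
  have hs' := fun e => hall e (s e) (hs e)
  let σ : E →* L.sec U :=
    { toFun := s
      map_one' := h.ext k hkc _ _ fun i => by
        rw [hs, map_one, map_one]
      map_mul' := fun a b => h.ext k hkc _ _ fun i => by
        rw [hs, map_mul, map_mul, hs, hs] }
  refine ⟨CommMonCat.ofHom σ, ?_, ?_⟩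
  · intro W l hl
    exact CommMonCat.hom_ext (MonoidHom.ext fun e => hs' e W l hl)
  · intro τ hτ
    refine CommMonCat.hom_ext (MonoidHom.ext fun e => ?_)
    refine hsep hS _ _ fun W l hl => ?_
    rw [show (CommMonCat.ofHom σ).hom e = s e from rfl, hs' e W l hl, ← hτ l hl]
    rfl

/-- Elements of a monoid as homomorphisms. -/
def elemHom {M : CommMonCat.{u}} (m : M) :
    CommMonCat.of (ULift.{u} (Multiplicative ℕ)) ⟶ M :=
  CommMonCat.ofHom ((powersHom M m).comp MulEquiv.ulift.toMonoidHom)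

lemma elemHom_apply {M : CommMonCat.{u}} (m : M) :
    (elemHom m).hom ⟨Multiplicative.ofAdd 1⟩ = m := by
  change m ^ 1 = m
  exact pow_one m

lemma elemHom_comp {M N : CommMonCat.{u}} (m : M) (f : M ⟶ N) :
    elemHom m ≫ f = elemHom (f.hom m) := by
  ext e
  change f.hom (m ^ _) = (f.hom m) ^ _
  rw [map_pow]

/-- Elements of a monoid are homomorphisms from the free monoid on one generator, so the sheaf
condition tested on that object is gluing of sections. -/
lemma gluing_of_isSheaf (h : Presheaf.IsSheaf X.smallEtaleTopology L.M) : L.Gluing := by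
  have key := fun {U : X.Etale} {ι : Type u} {V : ι → X.Etale} (k : ∀ i, V i ⟶ U)
    (hk : JointlySurj k) => (Presieve.isSheafFor_arrows_iff _ _).1
      ((Presieve.isSheafFor_iff_generate _).2
        (h (CommMonCat.of (ULift.{u} (Multiplicative ℕ))) _ hk.mem))
  constructor
  · intro U ι V k hk s t hst
    obtain ⟨r, -, hr⟩ := key k hk (fun i => elemHom (L.res (k i) s)) (by
      intro i j W a b hab
      change elemHom _ ≫ L.M.map a.op = elemHom _ ≫ L.M.map b.op
      rw [elemHom_comp, elemHom_comp]
      congr 1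
      exact (L.res_res a (k i) s).trans ((congrArg (fun c => L.res c s) hab).trans
        (L.res_res b (k j) s).symm))
    have h1 := hr (elemHom s) (fun i => elemHom_comp s (L.M.map (k i).op))
    have h2 := hr (elemHom t) (fun i => (elemHom_comp t (L.M.map (k i).op)).trans
      (congrArg elemHom (hst i).symm))
    rw [← elemHom_apply s, h1, ← h2, elemHom_apply]
  · intro U ι V k hk x hx
    obtain ⟨r, hr, -⟩ := key k hk (fun i => elemHom (x i)) (by
      intro i j W a b hab
      change elemHom _ ≫ L.M.map a.op = elemHom _ ≫ L.M.map b.op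
      rw [elemHom_comp, elemHom_comp]
      exact congrArg elemHom (hx i j W a b hab))
    refine ⟨r.hom ⟨Multiplicative.ofAdd 1⟩, fun i => ?_⟩
    exact (congrArg (fun t => t.hom ⟨Multiplicative.ofAdd 1⟩) (hr i)).trans (elemHom_apply _)

lemma IsLog.gluing (h : L.IsLog) : L.Gluing := gluing_of_isSheaf h.isSheaf

end PrelogStructure

/-! ### Étale descent of morphisms and functions -/

/-- Morphisms glue along étale covers. -/
lemma existsUnique_glue {U A : Scheme.{u}} {ι : Type u} {V : ι → Scheme.{u}}
    (k : ∀ i, V i ⟶ U) [∀ i, Etale (k i)] (hk : ∀ x : U, ∃ (i : ι) (y : V i), k i y = x)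
    (g : ∀ i, V i ⟶ A)
    (hg : ∀ i j, Limits.pullback.fst (k i) (k j) ≫ g i = Limits.pullback.snd (k i) (k j) ≫ g j) :
    ∃! r : U ⟶ A, ∀ i, k i ≫ r = g i := by
  -- Étale morphisms are flat and locally of finite presentation, and the fppf topology is
  -- subcanonical.
  have hmem : Presieve.ofArrows V k ∈ Scheme.fppfPrecoverage U := by
    rw [Scheme.fppfPrecoverage, Scheme.ofArrows_mem_precoverage_iff]
    refine ⟨fun x => ?_, fun i => ⟨inferInstance, inferInstance⟩⟩
    obtain ⟨i, y, h⟩ := hk x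
    exact ⟨i, y, h⟩
  have hs : Presieve.IsSheafFor (yoneda.obj A) (Presieve.ofArrows V k) := 
    (GrothendieckTopology.Subcanonical.isSheaf_of_isRepresentable
      (J := Scheme.fppfTopology) (yoneda.obj A)).isSheafFor _
      (Precoverage.generate_mem_toGrothendieck hmem)
  exact (Presieve.isSheafFor_arrows_iff _ _).1 hs g fun i j Z a b hab => by
    have h1 := congrArg (Limits.pullback.lift a b hab ≫ ·) (hg i j)
    rw [← Category.assoc, ← Category.assoc, Limits.pullback.lift_fst,
        Limits.pullback.lift_snd] at h1
    exact h1

/-- Functions glue along étale covers. -/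
lemma existsUnique_glue_fun {U : Scheme.{u}} {ι : Type u} {V : ι → Scheme.{u}}
    (k : ∀ i, V i ⟶ U) [∀ i, Etale (k i)] (hk : ∀ x : U, ∃ (i : ι) (y : V i), k i y = x)
    (a : ∀ i, Γ(V i, ⊤))
    (ha : ∀ i j, (Limits.pullback.fst (k i) (k j)).appTop (a i) = 
      (Limits.pullback.snd (k i) (k j)).appTop (a j)) :
    ∃! r : Γ(U, ⊤), ∀ i, (k i).appTop.hom r = a i := by
  -- Functions are morphisms to the affine line over `ℤ`, so their descent is a case of
  -- `existsUnique_glue`.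
  let e := fun (T : Scheme.{u}) => AffineSpace.toSpecMvPolyIntEquiv (X := T) PUnit.{u+1}
  have he : ∀ {T T' : Scheme.{u}} (f : T ⟶ T') (p : T' ⟶ _) , e T (f ≫ p) = fun i => f.appTop
      (e T' p i) := by
    intro T T' f p
    ext i
    simp [e, AffineSpace.toSpecMvPolyIntEquiv]
    rfl
  have he' : ∀ {T T' : Scheme.{u}} (f : T ⟶ T') (p : _) , f ≫ (e T').symm p =
      (e T).symm  fun i => f.appTop (p i) := by
    intro T T' f p
    apply (e T).injective
    rw [he]
    simp
  obtain ⟨r, hr, hu⟩ := existsUnique_glue k hk (fun i => (e _).symm fun _ => a i) (by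
    intro i j
    rw [he', he', ha])
  refine ⟨e _ r PUnit.unit, fun i => ?_, fun t ht => ?_⟩
  · have := congrArg (fun p => e _ p PUnit.unit) (hr i)
    rw [he] at this
    simpa using this
  · rw [← hu ((e _).symm fun _ => t) fun i => by rw [he']; congr 1; ext; exact ht i]
    simp

lemma etale_left {X : Scheme.{u}} {U V : X.Etale} (k : V ⟶ U) : Etale k.left := by
  have h1 : Etale U.hom := U.prop
  have h2 : Etale (k.left ≫ U.hom) := by
    rw [MorphismProperty.Over.w k]; exact V.prop
  exact MorphismProperty.of_postcomp (W := @Etale) (W' := @Etale) k.left U.hom h1 h2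

lemma JointlySurj.glue_fun {X : Scheme.{u}} {U : X.Etale} {ι : Type u} {V : ι → X.Etale}
    {k : ∀ i, V i ⟶ U} (hk : JointlySurj k) (a : ∀ i, Γ((V i).left, ⊤))
    (ha : ∀ i j (W : X.Etale) (p : W ⟶ V i) (q : W ⟶ V j), p ≫ k i = q ≫ k j →
      p.left.appTop.hom (a i) = q.left.appTop.hom (a j)) :
    ∃ r : Γ(U.left, ⊤), ∀ i, (k i).left.appTop.hom r = a i := by
  have := fun i => etale_left (k i)
  exact (existsUnique_glue_fun (fun i => (k i).left) hk a fun i j =>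
    ha i j _ (prodFst (k i) (k j)) (prodSnd (k i) (k j)) (prod_condition _ _)).exists

lemma JointlySurj.ext_fun {X : Scheme.{u}} {U : X.Etale} {ι : Type u} {V : ι → X.Etale}
    {k : ∀ i, V i ⟶ U} (hk : JointlySurj k) {a b : Γ(U.left, ⊤)}
    (h : ∀ i, (k i).left.appTop.hom a = (k i).left.appTop.hom b) : a = b := by
  have := fun i => etale_left (k i)
  refine (existsUnique_glue_fun (fun i => (k i).left) hk (fun i => (k i).left.appTop.hom a)
    fun i j => ?_).unique (fun i => rfl) fun i => (h i).symm
  rw [← CommRingCat.comp_apply, ← CommRingCat.comp_apply, ← Scheme.Hom.comp_appTop,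
    ← Scheme.Hom.comp_appTop, Limits.pullback.condition]

/-! ### The log structure of supports -/

/-- The monoid of pairs `(e, a)` of functions with `e` idempotent and `e * a = a`. -/
def supported (R : Type u) [CommRing R] : Submonoid (R × R) where
  carrier := {p | p.1 * p.1 = p.1 ∧ p.1 * p.2 = p.2}
  one_mem' := by simp
  mul_mem' := by
    rintro ⟨a, b⟩ ⟨c, d⟩ ⟨h1, h2⟩ ⟨h3, h4⟩
    dsimp at *
    exact ⟨by linear_combination c * c * h1 + a * h3, by linear_combination c * d * h2 + b * h4⟩

/-- The map on supported pairs induced by a ring homomorphism. -/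
def supportedMap {R S : Type u} [CommRing R] [CommRing S] (f : R →+* S) :
    supported R →* supported S where
  toFun p := ⟨(f p.1.1, f p.1.2), by rw [← map_mul, p.2.1], by rw [← map_mul, p.2.2]⟩
  map_one' := Subtype.ext (Prod.ext (map_one f) (map_one f))
  map_mul' p q := Subtype.ext (Prod.ext (map_mul f _ _) (map_mul f _ _))

/-- The log structure of functions together with an open and closed set outside of which they
vanish. -/
def supp (X : Scheme.{u}) : PrelogStructure X where
  M :=
    { obj := fun U => CommMonCat.of (supported Γ(U.unop.left, ⊤))
      map := fun k => CommMonCat.ofHom (supportedMap k.unop.left.appTop.hom)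
      map_id := fun _ => CommMonCat.hom_ext (MonoidHom.ext fun p => Subtype.ext (Prod.ext
        (congrArg (fun t => t.hom p.1.1) ((structureMon X).map_id _))
        (congrArg (fun t => t.hom p.1.2) ((structureMon X).map_id _))))
      map_comp := fun k l => CommMonCat.hom_ext (MonoidHom.ext fun p => Subtype.ext (Prod.ext
        (congrArg (fun t => t.hom p.1.1) ((structureMon X).map_comp k l))
        (congrArg (fun t => t.hom p.1.2) ((structureMon X).map_comp k l)))) }
  α :=
    { app := fun _ => CommMonCat.ofHom ((MonoidHom.snd _ _).comp (Submonoid.subtype _))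
      naturality := fun _ _ _ => rfl }

lemma PrelogStructure.Gluing.isLog {X : Scheme.{u}} {L : PrelogStructure X} (h : L.Gluing)
    (h' : ∀ (U : X.Etale) (a : Γ(U.left, ⊤)), IsUnit a → ∃! m : L.sec U, L.val U m = a) :
    L.IsLog := ⟨h.isSheaf, h'⟩

/-- Pairs of functions glue, and the two equations are local. Over a unit `a` the equation `e * a =
a` leaves only `e = 1`. -/
lemma supp_isLog (X : Scheme.{u}) : (supp X).IsLog := by
  refine PrelogStructure.Gluing.isLog ⟨?_, ?_⟩ ?_
  · intro U ι V k hk s t hst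
    refine Subtype.ext (Prod.ext (hk.ext_fun fun i => ?_) (hk.ext_fun fun i => ?_))
    · exact congrArg (fun p : supported _ => p.1.1) (hst i)
    · exact congrArg (fun p : supported _ => p.1.2) (hst i)
  · intro U ι V k hk x hx
    obtain ⟨e, he⟩ := hk.glue_fun (fun i => (x i).1.1) fun i j W a b hab =>
      congrArg (fun p : supported _ => p.1.1) (hx i j W a b hab)
    obtain ⟨r, hr⟩ := hk.glue_fun (fun i => (x i).1.2) fun i j W a b hab =>
      congrArg (fun p : supported _ => p.1.2) (hx i j W a b hab)
    refine ⟨⟨(e, r), hk.ext_fun fun i => ?_, hk.ext_fun fun i => ?_⟩, fun i => ?_⟩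
    · rw [map_mul, he]; exact (x i).2.1
    · rw [map_mul, he, hr]; exact (x i).2.2
    · exact Subtype.ext (Prod.ext (he i) (hr i))
  · intro U a ha
    refine ⟨⟨(1, a), mul_one _, one_mul _⟩, rfl, ?_⟩
    rintro ⟨⟨e, b⟩, h1, h2⟩ (rfl : b = a)
    have : e = 1 := by
      obtain ⟨v, hv⟩ := ha
      dsimp at h2
      rw [← hv] at h2
      exact v.isUnit.mul_eq_right.1 h2
    exact Subtype.ext (Prod.ext this rfl)

end LogGeom
end

noncomputable section

namespace LogGeom

section

variable {X : Scheme.{u}} {U V W : X.Etale}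

lemma left_w (k : V ⟶ U) : k.left ≫ U.hom = V.hom := MorphismProperty.Over.w k

lemma comp_left (l : W ⟶ V) (k : V ⟶ U) : (l ≫ k).left = l.left ≫ k.left := rfl

lemma appTop_comp_apply {A B C : Scheme.{u}} (f : A ⟶ B) (g : B ⟶ C) (x : Γ(C, ⊤)) :
    (f ≫ g).appTop.hom x = f.appTop.hom (g.appTop.hom x) := by
  rw [Scheme.Hom.comp_appTop, CommRingCat.comp_apply]

lemma id_w (U : X.Etale) : 𝟙 U.left ≫ U.hom = U.hom ≫ 𝟙 X :=
  (Category.id_comp _).trans (Category.comp_id _).symm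

lemma left_w_id (k : V ⟶ U) : k.left ≫ U.hom = V.hom ≫ 𝟙 X :=
  (left_w k).trans (Category.comp_id _).symm

/-- A morphism of the étale site. -/
def mkHom (h : V.left ⟶ U.left) (w : h ≫ U.hom = V.hom) : V ⟶ U :=
  MorphismProperty.Over.homMk h w

lemma mkHom_left (h : V.left ⟶ U.left) (w : h ≫ U.hom = V.hom) : (mkHom h w).left = h := rfl

lemma et_hom_ext {a b : V ⟶ U} (h : a.left = b.left) : a = b := MorphismProperty.Over.Hom.ext h

end

/-! ### Direct images -/

namespace Comorphism

variable {X Y : Scheme.{u}}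

lemma pbMap_w (f : X ⟶ Y) {U' U : Y.Etale} (k : U' ⟶ U) :
    (pbSnd f U' ≫ k.left) ≫ U.hom = (pb f U').hom ≫ f := by
  rw [Category.assoc, ← pbSnd_w, left_w]

/-- The map of base changes induced by a morphism of the étale site. -/
def pbMap (f : X ⟶ Y) {U' U : Y.Etale} (k : U' ⟶ U) : pb f U' ⟶ pb f U :=
  mkHom (pbLift f U (pb f U').hom (pbSnd f U' ≫ k.left) (pbMap_w f k))
    (pbLift_hom _ _ _ _ (pbMap_w f k))

lemma pbMap_snd (f : X ⟶ Y) {U' U : Y.Etale} (k : U' ⟶ U) :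
    (pbMap f k).left ≫ pbSnd f U = pbSnd f U' ≫ k.left := pbLift_snd _ _ _ _ (pbMap_w f k)

/-- The universal morphism to the base change, in the étale site. -/
def toPb (f : X ⟶ Y) {V : X.Etale} {U : Y.Etale} (h : V.left ⟶ U.left)
    (w : h ≫ U.hom = V.hom ≫ f) : V ⟶ pb f U :=
  mkHom (pbLift f U V.hom h w) (pbLift_hom f U V.hom h w)

lemma toPb_snd (f : X ⟶ Y) {V : X.Etale} {U : Y.Etale} (h : V.left ⟶ U.left)
    (w : h ≫ U.hom = V.hom ≫ f) : (toPb f h w).left ≫ pbSnd f U = h := pbLift_snd f U V.hom h w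

lemma pb_hom_ext (f : X ⟶ Y) {V : X.Etale} {U : Y.Etale} {a b : V ⟶ pb f U}
    (h : a.left ≫ pbSnd f U = b.left ≫ pbSnd f U) : a = b :=
  MorphismProperty.Over.Hom.ext (pb_ext f U
    ((MorphismProperty.Over.w a).trans (MorphismProperty.Over.w b).symm) h)

lemma pbMap_id (f : X ⟶ Y) (U : Y.Etale) : pbMap f (𝟙 U) = 𝟙 _ :=
  pb_hom_ext f (by
    rw [pbMap_snd]
    exact (Category.comp_id _).trans (Category.id_comp _).symm)

lemma pbMap_comp (f : X ⟶ Y) {U'' U' U : Y.Etale} (l : U'' ⟶ U') (k : U' ⟶ U) :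
    pbMap f (l ≫ k) = pbMap f l ≫ pbMap f k :=
  pb_hom_ext f (by
    rw [pbMap_snd]
    rw [comp_left, comp_left, Category.assoc, pbMap_snd, ← Category.assoc, ← Category.assoc,
      pbMap_snd])

end Comorphism

open Comorphism

namespace PrelogStructure

section

variable {X : Scheme.{u}} {L N : PrelogStructure X}

lemma app_res (η : L.M ⟶ N.M) {V U : X.Etale} (k : V ⟶ U) (m : L.sec U) :
    (η.app (op V)).hom (L.res k m) = N.res k ((η.app (op U)).hom m) :=
  congrArg (fun t => t.hom m) (η.naturality k.op)

lemma val_app {η : L.M ⟶ N.M} (hη : η ≫ N.α = L.α) {U : X.Etale} (m : L.sec U) :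
    N.val U ((η.app (op U)).hom m) = L.val U m :=
  congrArg (fun t => (t.app (op U)).hom m) hη

end

variable {X Y : Scheme.{u}}

/-- Sections of the direct image. -/
def pushSec (f : X ⟶ Y) (N : PrelogStructure X) (U : Y.Etale) :
    Submonoid (N.sec (pb f U) × Γ(U.left, ⊤)) where
  carrier := {p | N.val _ p.1 = (pbSnd f U).appTop.hom p.2}
  one_mem' := by simp
  mul_mem' := by
    rintro a b (ha : _ = _) (hb : _ = _)
    simp only [Set.mem_ofPred_eq, Prod.fst_mul, Prod.snd_mul, map_mul, ha, hb]

/-- Restriction of sections of the direct image. -/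
def pushRes (f : X ⟶ Y) (N : PrelogStructure X) {U' U : Y.Etale} (k : U' ⟶ U) :
    pushSec f N U →* pushSec f N U' where
  toFun p := ⟨(N.res (pbMap f k) p.1.1, k.left.appTop.hom p.1.2), by
    change N.val _ (N.res _ _) = (pbSnd f U').appTop.hom (k.left.appTop.hom _)
    rw [N.val_res, p.2, ← CommRingCat.comp_apply, ← CommRingCat.comp_apply,
      ← Scheme.Hom.comp_appTop, ← Scheme.Hom.comp_appTop, pbMap_snd]⟩
  map_one' := Subtype.ext (Prod.ext (map_one _) (map_one _))
  map_mul' p q := Subtype.ext (Prod.ext (map_mul _ _ _) (map_mul _ _ _))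

/-- The direct image of a log structure. -/
def push (f : X ⟶ Y) (N : PrelogStructure X) : PrelogStructure Y where
  M :=
    { obj := fun U => CommMonCat.of (pushSec f N U.unop)
      map := fun k => CommMonCat.ofHom (pushRes f N k.unop)
      map_id := fun U => CommMonCat.hom_ext (MonoidHom.ext fun p => Subtype.ext (Prod.ext
        ((congrArg (fun t => N.res t p.1.1) (pbMap_id f _)).trans (N.res_id _ _))
        (congrArg (fun t => t.hom p.1.2) ((structureMon Y).map_id U))))
      map_comp := fun k l => CommMonCat.hom_ext (MonoidHom.ext fun p => Subtype.ext (Prod.ext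
        ((congrArg (fun t => N.res t p.1.1) (pbMap_comp f _ _)).trans (N.res_res _ _ _).symm)
        (congrArg (fun t => t.hom p.1.2) ((structureMon Y).map_comp k l)))) }
  α :=
    { app := fun _ => CommMonCat.ofHom ((MonoidHom.snd _ _).comp (Submonoid.subtype _))
      naturality := fun _ _ _ => rfl }

variable (f : X ⟶ Y) (N : PrelogStructure X)

/-- A section of the direct image. -/
def mkPush {U : Y.Etale} (n : N.sec (pb f U)) (a : Γ(U.left, ⊤))
    (h : N.val _ n = (pbSnd f U).appTop.hom a) : (push f N).sec U := ⟨(n, a), h⟩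

/-- The underlying section on the base change. -/
def pushFst {U : Y.Etale} : (push f N).sec U →* N.sec (pb f U) :=
  (MonoidHom.fst _ _).comp (Submonoid.subtype (pushSec f N U))

variable {f N}

lemma push_ext {U : Y.Etale} {p q : (push f N).sec U} (h1 : pushFst f N p = pushFst f N q)
    (h2 : (push f N).val U p = (push f N).val U q) : p = q :=
  Subtype.ext (Prod.ext h1 h2)

lemma pushFst_res {U' U : Y.Etale} (k : U' ⟶ U) (p : (push f N).sec U) :
    pushFst f N ((push f N).res k p) = N.res (pbMap f k) (pushFst f N p) := rfl

lemma pushFst_val {U : Y.Etale} (p : (push f N).sec U) :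
    N.val _ (pushFst f N p) = (pbSnd f U).appTop.hom ((push f N).val U p) := p.2

lemma push_val_mk {U : Y.Etale} (n : N.sec (pb f U)) (a : Γ(U.left, ⊤)) (h) :
    (push f N).val _ (mkPush f N n a h) = a := rfl

lemma jointlySurj_pbMap (f : X ⟶ Y) {U : Y.Etale} {ι : Type u} {V : ι → Y.Etale}
    {k : ∀ i, V i ⟶ U} (hk : JointlySurj k) : JointlySurj (fun i => pbMap f (k i)) := by
  intro x
  obtain ⟨i, y, hy⟩ := hk (pbSnd f U x)
  obtain ⟨z, hz, hz'⟩ := Scheme.Pullback.exists_preimage_pullback (f := pbSnd f U)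
    (g := (k i).left) x y hy.symm
  let p := Limits.pullback.fst (pbSnd f U) (k i).left
  let q := Limits.pullback.snd (pbSnd f U) (k i).left
  have hpq : p ≫ pbSnd f U = q ≫ (k i).left := Limits.pullback.condition
  have hw : (k i).left ≫ U.hom = (V i).hom := MorphismProperty.Over.w (k i)
  let r := pbLift f (V i) (p ≫ (pb f U).hom) q (by
    rw [← hw, ← Category.assoc, ← hpq, Category.assoc, pbSnd_w, Category.assoc])
  have hr : r ≫ (pbMap f (k i)).left = p := by
    refine pb_ext f U ?_ ?_
    · refine (Category.assoc _ _ _).trans ?_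
      refine (congrArg (r ≫ ·) (MorphismProperty.Over.w (pbMap f (k i)))).trans ?_
      exact pbLift_hom _ _ _ _ _
    · rw [Category.assoc, pbMap_snd, ← Category.assoc, pbLift_snd, hpq]
  refine ⟨i, r z, ?_⟩
  rw [← Scheme.Hom.comp_apply, hr]
  exact hz

/-- The direct image is the fibre product of `f_* N` and `𝒪_Y` over `f_* 𝒪_X`, so it inherits gluing
from both factors. A unit of `𝒪_Y` pulls back to a unit, which has exactly one lift to `N`. -/
lemma push_isLog (f : X ⟶ Y) (hN : N.IsLog) : (push f N).IsLog := by
  have hg := hN.gluing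
  refine Gluing.isLog ⟨?_, ?_⟩ ?_
  · intro U ι V k hk s t hst
    refine push_ext (hg.ext _ (jointlySurj_pbMap f hk) _ _ fun i => ?_)
      (hk.ext_fun fun i => ?_)
    · rw [← pushFst_res, hst, pushFst_res]
    · rw [← val_res, hst, val_res]
  · intro U ι V k hk x hx
    obtain ⟨r, hr⟩ := hk.glue_fun (fun i => (push f N).val _ (x i)) fun i j W a b hab => by
      rw [← val_res, hx i j W a b hab, val_res]
    obtain ⟨n, hn⟩ := hg.glue _ (jointlySurj_pbMap f hk) (fun i => pushFst f N (x i))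
      (fun i j W a b hab => by
        have hw : (a.left ≫ pbSnd f (V i)) ≫ (k i).left = (b.left ≫ pbSnd f (V j)) ≫ (k j).left :=
            by
          rw [Category.assoc, Category.assoc, ← pbMap_snd, ← pbMap_snd]
          have := congrArg (fun t : W ⟶ pb f U => t.left ≫ pbSnd f U) hab
          change (a.left ≫ (pbMap f (k i)).left) ≫ _ = (b.left ≫ (pbMap f (k j)).left) ≫ _ at this
          rwa [Category.assoc, Category.assoc] at this
        -- `W` lies over the base change of the overlap `V i ×_U V j`; both `a` and `b` factor
        -- through it, and there the compatibility of `x` applies.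
        let c : W.left ⟶ (prodEt (k i) (k j)).left := Limits.pullback.lift _ _ hw
        have hc1 : c ≫ (prodFst (k i) (k j)).left = a.left ≫ pbSnd f (V i) :=
          Limits.pullback.lift_fst _ _ _
        have hc2 : c ≫ (prodSnd (k i) (k j)).left = b.left ≫ pbSnd f (V j) :=
          Limits.pullback.lift_snd _ _ _
        have hwc : c ≫ (prodEt (k i) (k j)).hom = W.hom ≫ f := by
          have h1 : (prodFst (k i) (k j)).left ≫ (V i).hom = (prodEt (k i) (k j)).hom :=
            MorphismProperty.Over.w (prodFst (k i) (k j))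
          have h2 : a.left ≫ (pb f (V i)).hom = W.hom := MorphismProperty.Over.w a
          rw [← h1, ← Category.assoc, hc1, Category.assoc, pbSnd_w, ← Category.assoc, h2]
        have ea : a = toPb f c hwc ≫ pbMap f (prodFst (k i) (k j)) := pb_hom_ext f (by
          change _ = ((toPb f c hwc).left ≫ (pbMap f _).left) ≫ _
          rw [Category.assoc, pbMap_snd, ← Category.assoc, toPb_snd, hc1])
        have eb : b = toPb f c hwc ≫ pbMap f (prodSnd (k i) (k j)) := pb_hom_ext f (by
          change _ = ((toPb f c hwc).left ≫ (pbMap f _).left) ≫ _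
          rw [Category.assoc, pbMap_snd, ← Category.assoc, toPb_snd, hc2])
        rw [ea, eb, ← N.res_res, ← N.res_res, ← pushFst_res, ← pushFst_res,
          hx i j _ _ _ (prod_condition _ _)])
    refine ⟨mkPush f N n r (hg_val hN (jointlySurj_pbMap f hk) fun i => ?_), fun i =>
      push_ext (hn i) ?_⟩
    · rw [← N.val_res, hn, pushFst_val, ← hr, ← CommRingCat.comp_apply, ← CommRingCat.comp_apply,
        ← Scheme.Hom.comp_appTop, ← Scheme.Hom.comp_appTop, pbMap_snd]
    · rw [val_res, push_val_mk, hr]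
  · intro U a ha
    obtain ⟨n, hn, hu⟩ := hN.existsUnique_val_eq (pb f U) ((pbSnd f U).appTop.hom a) (ha.map _)
    refine ⟨mkPush f N n a hn, rfl, fun p hp => push_ext (hu _ ?_) hp⟩
    exact (pushFst_val p).trans (congrArg _ hp)
where
  hg_val {N : PrelogStructure X} (_ : N.IsLog) {U : X.Etale} {ι : Type u} {V : ι → X.Etale}
      {k : ∀ i, V i ⟶ U} (hk : JointlySurj k) {a b : Γ(U.left, ⊤)}
      (h : ∀ i, (k i).left.appTop.hom a = (k i).left.appTop.hom b) : a = b := hk.ext_fun h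

end PrelogStructure

open PrelogStructure

/-! ### Strict comorphisms are cartesian -/

namespace Comorphism

variable {T X Y Z : Scheme.{u}} {e : T ⟶ X} {f : X ⟶ Y} {g : T ⟶ Y} {N N' : PrelogStructure T}
  {L : PrelogStructure X} {K : PrelogStructure Y}

/-- A morphism to the direct image, as a comorphism. -/
def ofPush (η : K.M ⟶ (push f L).M) (hη : η ≫ (push f L).α = K.α) : Comorphism f L K where
  map {_ U} h w := ((L.res (toPb f h w)).comp (pushFst f L)).comp (η.app (op U)).hom
  map_comp_left k h w w' m := by
    refine Eq.trans (congrArg (fun t => L.res t _) (?_ : toPb f (k.left ≫ h) w' = k ≫ toPb f h w))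
      (L.res_res _ _ _).symm
    refine pb_hom_ext f ?_
    change _ = (k.left ≫ (toPb f h w).left) ≫ _
    rw [toPb_snd, Category.assoc, toPb_snd]
  map_comp_right {V U' U} h k w w' m := by
    have h1 : (η.app (op U')).hom (K.res k m) = (push f L).res k ((η.app (op U)).hom m) :=
      congrArg (fun t => t.hom m) (η.naturality k.op)
    change _ = L.res _ (pushFst f L ((η.app (op U')).hom (K.res k m)))
    rw [h1, pushFst_res, L.res_res]
    refine congrArg (fun t => L.res t _) (pb_hom_ext f ?_)
    change _ = ((toPb f h w).left ≫ (pbMap f k).left) ≫ _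
    rw [toPb_snd, Category.assoc, pbMap_snd, ← Category.assoc, toPb_snd]
  val_map {V U} h w m := by
    have h1 : (push f L).val U ((η.app (op U)).hom m) = K.val U m :=
      congrArg (fun t => (t.app (op U)).hom m) hη
    change L.val V (L.res _ (pushFst f L _)) = _
    rw [L.val_res, pushFst_val, h1, ← CommRingCat.comp_apply, ← Scheme.Hom.comp_appTop, toPb_snd]

/-- A comorphism, as a morphism to the direct image. -/
def toPush (c : Comorphism f L K) : K.M ⟶ (push f L).M where
  app U := CommMonCat.ofHom
    { toFun := fun m => mkPush f L (c.map (pbSnd f U.unop) (pbSnd_w f _) m) (K.val _ m)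
        (c.val_map _ _ _)
      map_one' := push_ext (map_one (c.map _ _)) (map_one (K.val _))
      map_mul' := fun _ _ => push_ext (map_mul (c.map _ _) _ _) (map_mul (K.val _) _ _) }
  naturality U V k := CommMonCat.hom_ext (MonoidHom.ext fun m => push_ext (by
    have hk := pbMap_snd f k.unop
    refine (c.map_res k.unop (pbSnd_w f _) (by
      rw [Category.assoc, left_w, pbSnd_w]) rfl m).trans ?_
    exact (c.res_map (pbMap f k.unop) (pbSnd_w f _) _ hk m).symm) (K.val_res k.unop m))

lemma toPush_α (c : Comorphism f L K) : c.toPush ≫ (push f L).α = K.α := rfl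

lemma toPush_fst (c : Comorphism f L K) {U : Y.Etale} (m : K.sec U) :
    pushFst f L ((c.toPush.app (op U)).hom m) = c.map (pbSnd f U) (pbSnd_w f U) m := rfl

lemma ofPush_map (η : K.M ⟶ (push f L).M) (hη : η ≫ (push f L).α = K.α) {V : X.Etale}
    {U : Y.Etale} (h : V.left ⟶ U.left) (w : h ≫ U.hom = V.hom ≫ f) (m : K.sec U) :
    (ofPush η hη).map h w m = L.res (toPb f h w) (pushFst f L ((η.app (op U)).hom m)) := rfl

/-- One half of the adjunction between comorphisms along `f` and morphisms into the direct image.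
This half lets uniqueness of morphisms into the direct image pass to uniqueness of comorphisms. -/
lemma ofPush_toPush (c : Comorphism f L K) : ofPush c.toPush c.toPush_α = c := by
  refine Comorphism.ext ?_
  funext V U h w
  refine MonoidHom.ext fun m => ?_
  rw [ofPush_map, toPush_fst]
  exact c.res_map _ _ _ (toPb_snd f h w) _

/-- `c` is the composite of `a` and `b`. -/
structure Factors (a : Comorphism e N L) (b : Comorphism f L K) (c : Comorphism g N K) :
    Prop where
  eq : ∀ {V : T.Etale} {W : X.Etale} {U : Y.Etale} (h : V.left ⟶ W.left) (k : W.left ⟶ U.left)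
    (w₁ : h ≫ W.hom = V.hom ≫ e) (w₂ : k ≫ U.hom = W.hom ≫ f)
    (w₃ : (h ≫ k) ≫ U.hom = V.hom ≫ g) (m : K.sec U),
    a.map h w₁ (b.map k w₂ m) = c.map (h ≫ k) w₃ m

lemma factors_comp (a : Comorphism e N L) (b : Comorphism f L K) : Factors a b (a.comp b) :=
  ⟨fun h k w₁ w₂ w₃ m => (compMap_eq a b h k w₁ w₂ w₃ m).symm⟩

lemma map_ext {c c' : Comorphism f L K}
    (h : ∀ {V : X.Etale} {U : Y.Etale} (h : V.left ⟶ U.left) (w : h ≫ U.hom = V.hom ≫ f)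
      (m : K.sec U), c.map h w m = c'.map h w m) : c = c' := by
  refine Comorphism.ext ?_
  funext V U k w
  exact MonoidHom.ext fun m => h k w m

/-- Every `V → U` over `Y` passes through the base change of `U` to `X`, and there both composites
are prescribed. -/
lemma Factors.unique {a : Comorphism e N L} {b : Comorphism f L K} {c c' : Comorphism g N K}
    (hg : e ≫ f = g) (h : Factors a b c) (h' : Factors a b c') : c = c' := by
  subst hg
  refine map_ext fun {V U} k w m => ?_
  have hw : k ≫ U.hom = (V.hom ≫ e) ≫ f := by rw [w, Category.assoc]
  have e1 : pbLift f U (V.hom ≫ e) k hw ≫ pbSnd f U = k := pbLift_snd _ _ _ _ _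
  rw [c.map_congr e1.symm w, c'.map_congr e1.symm w,
    ← h.eq _ _ (pbLift_hom _ _ _ _ _) (pbSnd_w f U), ← h'.eq _ _ (pbLift_hom _ _ _ _ _)
        (pbSnd_w f U)]

/-- A comorphism through which all other comorphisms factor uniquely. -/
def IsCart (c : Comorphism f L K) : Prop :=
  ∀ {T : Scheme.{u}} {e : T ⟶ X} {g : T ⟶ Y} (_ : e ≫ f = g) {N : PrelogStructure T}
    (_ : N.IsLog) (d : Comorphism g N K), ∃! d' : Comorphism e N L, Factors d' c d

/-- A morphism `L → N` over the structure sheaf, as a comorphism over the identity. -/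
def ofHom {N : PrelogStructure X} (η : L.M ⟶ N.M) (hη : η ≫ N.α = L.α) :
    Comorphism (𝟙 X) N L where
  map {V _} h w := (η.app (op V)).hom.comp (L.res (mkHom h (w.trans (Category.comp_id _))))
  map_comp_left {V' V _} k h w w' m := by
    rw [MonoidHom.comp_apply, MonoidHom.comp_apply, ← app_res, L.res_res]
    rfl
  map_comp_right {V _ _} h k w w' m := by
    rw [MonoidHom.comp_apply, MonoidHom.comp_apply, L.res_res]
    rfl
  val_map {V _} h w m := by
    rw [MonoidHom.comp_apply, val_app hη, L.val_res, mkHom_left]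

/-- A comorphism over the identity, as a morphism over the structure sheaf. -/
def toHom {N : PrelogStructure X} (c : Comorphism (𝟙 X) N L) : L.M ⟶ N.M where
  app V := CommMonCat.ofHom (c.map (𝟙 V.unop.left) (id_w _))
  naturality _ _ k := CommMonCat.hom_ext (MonoidHom.ext fun m =>
    (c.map_res k.unop (id_w _) (h' := k.unop.left) (left_w_id _) (Category.id_comp _) m).trans
    (c.res_map k.unop (id_w _) (left_w_id _) (Category.comp_id _) m).symm)

lemma toHom_α {N : PrelogStructure X} (c : Comorphism (𝟙 X) N L) : c.toHom ≫ N.α = L.α := by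
  ext V m
  exact (c.val_map _ (id_w _) m).trans (congrArg (fun t => t.hom (L.val V.unop m))
    ((structureMon X).map_id V))

lemma toHom_app {N : PrelogStructure X} (c : Comorphism (𝟙 X) N L) {V : X.Etale} (m : L.sec V) :
    (c.toHom.app (op V)).hom m = c.map (𝟙 V.left) (id_w _) m :=
  rfl

lemma toHom_ofHom {N : PrelogStructure X} (η : L.M ⟶ N.M) (hη : η ≫ N.α = L.α) :
    (ofHom η hη).toHom = η := by
  ext V m
  exact congrArg (η.app V).hom (L.res_id _ m)

/-- Composition of a comorphism with a morphism over the structure sheaf. -/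
def post {L' : PrelogStructure X} (c : Comorphism f L K) (η : L.M ⟶ L'.M)
    (hη : η ≫ L'.α = L.α) : Comorphism f L' K where
  map {V _} h w := (η.app (op V)).hom.comp (c.map h w)
  map_comp_left k h w w' m := by
    rw [MonoidHom.comp_apply, MonoidHom.comp_apply, ← app_res, ← c.map_comp_left k h w w']
  map_comp_right h k w w' m := by
    rw [MonoidHom.comp_apply, MonoidHom.comp_apply, ← c.map_comp_right h k w w']
  val_map h w m := by
    rw [MonoidHom.comp_apply, val_app hη, c.val_map]

/-- Strictness speaks only about log structures on `X`, while cartesianness allows any `T` over `X`.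
The direct image `e_* N` is a log structure on `X`, and comorphisms into `N` along `e ≫ f` amount to
comorphisms into `e_* N` along `f`. -/
lemma IsStrict.isCart {c : Comorphism f L K} (hc : c.IsStrict) : c.IsCart := by
  intro T e g hg N hN d
  subst hg
  have hw : ∀ {V : X.Etale} {U : Y.Etale} {h : V.left ⟶ U.left}, h ≫ U.hom = V.hom ≫ f →
      (pbSnd e V ≫ h) ≫ U.hom = (pb e V).hom ≫ e ≫ f := fun {V U h} w => by
    rw [Category.assoc, w, ← Category.assoc, pbSnd_w, Category.assoc]
  -- The transpose of `d`: its value on the base change of `V` to `T`, paired with the function on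
  -- `V` given by `K`.
  let d₂ : Comorphism f (push e N) K :=
    { map := fun {V U} h w =>
        { toFun := fun m => mkPush e N (d.map (pbSnd e V ≫ h) (hw w) m)
            (h.appTop.hom (K.val U m)) (by
              rw [d.val_map, Scheme.Hom.comp_appTop, CommRingCat.comp_apply])
          map_one' := push_ext (map_one (d.map _ _)) (by simp [push_val_mk])
          map_mul' := fun _ _ => push_ext (map_mul (d.map _ _) _ _) (by simp [push_val_mk]) }
      map_comp_left := fun {V' V U} k h w w' m => push_ext
        ((d.res_map (pbMap e k) (hw w) (hw w') (by
          rw [← Category.assoc, pbMap_snd, Category.assoc]) m).symm) (by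
          change (k.left ≫ h).appTop.hom _ = k.left.appTop.hom (h.appTop.hom _)
          rw [Scheme.Hom.comp_appTop, CommRingCat.comp_apply])
      map_comp_right := fun {V U' U} h k w w' m => push_ext
        (d.map_res k (hw w) (hw w') (by rw [Category.assoc]) m).symm (by
          change (h ≫ k.left).appTop.hom _ = h.appTop.hom (K.val _ _)
          rw [K.val_res, Scheme.Hom.comp_appTop, CommRingCat.comp_apply])
      val_map := fun h w m => rfl }
  have hd₂ : ∀ {V : X.Etale} {U : Y.Etale} (h : V.left ⟶ U.left) (w : h ≫ U.hom = V.hom ≫ f)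
      (m : K.sec U), pushFst e N (d₂.map h w m) = d.map (pbSnd e V ≫ h) (hw w) m :=
    fun _ _ _ => rfl
  obtain ⟨η, ⟨hη, hη'⟩, hu⟩ := hc _ (push_isLog e hN) d₂
  refine ⟨ofPush η hη, ⟨?_⟩, fun d' hd' => ?_⟩
  · intro V W U h k w₁ w₂ w₃ m
    rw [ofPush_map, hη', hd₂]
    exact d.res_map _ _ _ (by rw [← Category.assoc, toPb_snd]) m
  · rw [← ofPush_toPush d']
    have : d'.toPush = η := hu _ ⟨d'.toPush_α, fun {V U} h w m => push_ext (by
      rw [toPush_fst, hd₂]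
      exact hd'.eq _ _ _ _ _ _) ?_⟩
    · subst this; rfl
    · exact c.val_map h w m

lemma IsCart.isStrict {c : Comorphism f L K} (hc : c.IsCart) : c.IsStrict := by
  intro N hN d
  obtain ⟨d', hd', hu⟩ := hc (Category.id_comp f) hN d
  refine ⟨d'.toHom, ⟨d'.toHom_α, fun {V U} h w m => ?_⟩, ?_⟩
  · rw [toHom_app, hd'.eq _ _ _ w (by rw [Category.id_comp, w])]
    exact d.map_congr (Category.id_comp _) _ _
  · rintro η ⟨hη, hη'⟩
    have : ofHom η hη = d' := hu _ ⟨fun {V W U} h k w₁ w₂ w₃ m => by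
      rw [← hη']
      exact congrArg (η.app (op V)).hom (c.res_map (mkHom h _) w₂ w₃ rfl m)⟩
    rw [← this, toHom_ofHom]

end Comorphism

end LogGeom
end

noncomputable section

namespace LogGeom

open PrelogStructure Comorphism

/-! ### Restriction along étale morphisms -/

lemma etale_comp {A B C : Scheme.{u}} (f : A ⟶ B) (g : B ⟶ C) (_ : Etale f) (_ : Etale g) :
    Etale (f ≫ g) := inferInstance

section

variable {A B C D E : Scheme.{u}} {h : A ⟶ B} {u : B ⟶ C} {v : A ⟶ D} {e : D ⟶ C} {f : C ⟶ E}

lemma postcomp_w {c : D ⟶ E} (w : h ≫ u = v ≫ e) (he : e ≫ f = c) : h ≫ u ≫ f = v ≫ c := by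
  rw [← Category.assoc, w, Category.assoc, he]

lemma comp_w {v : A ⟶ C} (w : h ≫ u = v) : h ≫ u ≫ f = v ≫ f := by
  rw [← Category.assoc, w]

lemma precomp_w {B' : Scheme.{u}} {l : B ⟶ B'} {u' : B' ⟶ E} {r : C ⟶ E} {c : D ⟶ E}
    (w : h ≫ u = v ≫ e) (w' : l ≫ u' = u ≫ r) (he : e ≫ r = c) : (h ≫ l) ≫ u' = v ≫ c := by
  rw [Category.assoc, w', postcomp_w w he]

end

section

variable {T X : Scheme.{u}} (j : T ⟶ X) [Etale j]

/-- A scheme étale over `T`, as a scheme étale over `X`. -/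
def shr (V : T.Etale) : X.Etale :=
  MorphismProperty.Over.mk ⊤ (V.hom ≫ j) (by
    have : Etale V.hom := V.prop
    exact inferInstanceAs (Etale (V.hom ≫ j)))

/-- The map on morphisms. -/
def shrMap {V U : T.Etale} (k : V ⟶ U) : shr j V ⟶ shr j U :=
  mkHom (V := shr j V) (U := shr j U) k.left (comp_w (left_w k))

namespace PrelogStructure

variable (L : PrelogStructure X)

/-- The restriction along an étale morphism. -/
def restrict : PrelogStructure T where
  M :=
    { obj := fun V => L.M.obj (op (shr j V.unop))
      map := fun k => L.M.map (shrMap j k.unop).op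
      map_id := fun V => L.M.map_id (op (shr j V.unop))
      map_comp := fun k l => L.M.map_comp (shrMap j k.unop).op (shrMap j l.unop).op }
  α :=
    { app := fun V => L.α.app (op (shr j V.unop))
      naturality := fun _ _ k => L.α.naturality (shrMap j k.unop).op }

/-- The canonical comorphism of a restriction. -/
def restrictCo : Comorphism j (L.restrict j) L where
  map {V _} h w := L.res (mkHom (V := shr j V) h w)
  map_comp_left k h w _ m := (L.res_res (shrMap j k) (mkHom (V := shr j _) h w) m).symm
  map_comp_right {V _ _} h k w _ m := (L.res_res (mkHom (V := shr j V) h w) k m).symm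
  val_map {V _} h w m := L.val_res (mkHom (V := shr j V) h w) m

variable {L}

lemma restrict_isLog (hL : L.IsLog) : (L.restrict j).IsLog := by
  have hg := hL.gluing
  refine Gluing.isLog ⟨?_, ?_⟩ fun U a ha => hL.existsUnique_val_eq (shr j U) a ha
  · intro U ι V k hk s t hst
    exact hg.ext (U := shr j U) (fun i => shrMap j (k i)) hk s t hst
  · intro U ι V k hk x hx
    refine hg.glue (U := shr j U) (fun i => shrMap j (k i)) hk x fun i i' W a b hab => ?_
    -- An object étale over `X` with a map to `V i` is étale over `T` through that map, so the
    -- compatibility of `x`, known only over `T`, covers it.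
    have hae : Etale (a.left ≫ (V i).hom) := by
      have h₁ : Etale a.left := etale_left a
      have h₂ : Etale (V i).hom := (V i).prop
      exact etale_comp _ _ h₁ h₂
    have hl : a.left ≫ (k i).left = b.left ≫ (k i').left :=
      congrArg (fun t : W ⟶ shr j U => t.left) hab
    let W' : T.Etale := MorphismProperty.Over.mk ⊤ (a.left ≫ (V i).hom) hae
    let a' : W' ⟶ V i := mkHom a.left rfl
    let b' : W' ⟶ V i' := mkHom b.left (by
      change _ = a.left ≫ (V i).hom
      rw [← left_w (k i), ← left_w (k i')]
      exact (Category.assoc _ _ _).symm.trans ((congrArg (· ≫ U.hom) hl.symm).trans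
        (Category.assoc _ _ _)))
    have := hx i i' W' a' b' (et_hom_ext hl)
    have hW : W.hom = (shr j W').hom := by
      rw [← left_w a]
      exact (Category.assoc _ _ _).symm
    let c : W ⟶ shr j W' := mkHom (𝟙 _) ((Category.id_comp _).trans hW.symm)
    have ea : a = c ≫ shrMap j a' := et_hom_ext (Category.id_comp _).symm
    have eb : b = c ≫ shrMap j b' := et_hom_ext (Category.id_comp _).symm
    rw [ea, eb]
    exact (L.res_res c (shrMap j a') (x i)).symm.trans
      ((congrArg (L.res c) this).trans (L.res_res c (shrMap j b') (x i')))

end PrelogStructure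

/-- A scheme étale over `T` is étale over `X`, and the restricted sections over it are literally
sections of `L`; the lift is `d` evaluated on these objects. -/
lemma restrictCo_isCart (L : PrelogStructure X) : (L.restrictCo j).IsCart := by
  intro S e g hg N hN d
  subst hg
  refine ⟨⟨fun {V W} h w => d.map (U := shr j W) h (postcomp_w w rfl), ?_, ?_, ?_⟩, ?_, ?_⟩
  · intro V' V U k h w w' m
    exact d.map_comp_left (U := shr j U) k h _ _ m
  · intro V U' U h k w w' m
    exact d.map_comp_right (U := shr j U) h (shrMap j k) _ _ m
  · intro V U h w m
    exact d.val_map (U := shr j U) h _ m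
  · constructor
    intro V W U h k w₁ w₂ w₃ m
    exact d.map_res (U' := shr j W) (mkHom (V := shr j W) k w₂) _ w₃ rfl m
  · intro d' hd'
    refine map_ext fun {V W} h w m => ?_
    have w₂ : 𝟙 W.left ≫ (shr j W).hom = W.hom ≫ j := Category.id_comp _
    have := hd'.eq (W := W) (U := shr j W) h (𝟙 W.left) w w₂ (precomp_w w w₂ rfl) m
    refine Eq.trans ?_ (this.trans (d.map_congr (U := shr j W) (Category.comp_id _) _ m))
    exact congrArg (d'.map h w) (L.res_id (shr j W) m).symm

end

/-! ### Cartesian comorphisms -/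

namespace Comorphism

variable {T X Y Z : Scheme.{u}} {e : T ⟶ X} {f : X ⟶ Y} {g : T ⟶ Y} {N : PrelogStructure T}
  {L : PrelogStructure X} {K : PrelogStructure Y}

lemma Factors.map_eq {a : Comorphism e N L} {b : Comorphism f L K} {c : Comorphism g N K}
    (H : Factors a b c) {V : T.Etale} {W : X.Etale} {U : Y.Etale} {h : V.left ⟶ W.left}
    {k : W.left ⟶ U.left} {l : V.left ⟶ U.left} (w₁ : h ≫ W.hom = V.hom ≫ e)
    (w₂ : k ≫ U.hom = W.hom ≫ f) (w₃ : l ≫ U.hom = V.hom ≫ g) (hl : h ≫ k = l) (m : K.sec U) :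
    a.map h w₁ (b.map k w₂ m) = c.map l w₃ m := by
  subst hl
  exact H.eq h k w₁ w₂ w₃ m

/-- It suffices to test a factorization on base changes. -/
lemma factors_of_pb {a : Comorphism e N L} {b : Comorphism f L K} {c : Comorphism g N K}
    (H : ∀ {V : T.Etale} {U : Y.Etale} (h : V.left ⟶ (pb f U).left)
      (w₁ : h ≫ (pb f U).hom = V.hom ≫ e) (w₃ : (h ≫ pbSnd f U) ≫ U.hom = V.hom ≫ g)
      (m : K.sec U), a.map h w₁ (b.map (pbSnd f U) (pbSnd_w f U) m) =
        c.map (h ≫ pbSnd f U) w₃ m) : Factors a b c := by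
  constructor
  intro V W U h k w₁ w₂ w₃ m
  have e₂ : (toPb f k w₂).left ≫ pbSnd f U = k := toPb_snd f k w₂
  have w₁' : (h ≫ (toPb f k w₂).left) ≫ (pb f U).hom = V.hom ≫ e := by
    rw [Category.assoc, left_w, w₁]
  have e₃ : (h ≫ (toPb f k w₂).left) ≫ pbSnd f U = h ≫ k := by rw [Category.assoc, e₂]
  rw [← b.res_map (toPb f k w₂) (pbSnd_w f U) w₂ e₂, a.map_res (toPb f k w₂) w₁ w₁' rfl,
    H _ _ (e₃ ▸ w₃)]
  exact c.map_congr e₃ _ _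

/-- Associativity, stated for the relation `Factors` because the base morphisms of composites agree
only up to a propositional equality. Each direction is checked on base changes. -/
lemma Factors.assoc {W : Scheme.{u}} {p : W ⟶ T} {q : W ⟶ X} {r : W ⟶ Y} {J : PrelogStructure W}
    {c₁ : Comorphism p J N} {c₂ : Comorphism e N L} {c₃ : Comorphism f L K}
    {c₁₂ : Comorphism q J L} {c₂₃ : Comorphism g N K} {c₁₂₃ : Comorphism r J K}
    (h₁₂ : Factors c₁ c₂ c₁₂) (h₂₃ : Factors c₂ c₃ c₂₃) (hq : p ≫ e = q) (hg : e ≫ f = g)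
    (hr : p ≫ g = r) : Factors c₁ c₂₃ c₁₂₃ ↔ Factors c₁₂ c₃ c₁₂₃ := by
  subst hq hg hr
  constructor
  · intro H
    refine factors_of_pb fun {V U} h w₁ w₃ m => ?_
    have w₁' : h ≫ (pb f U).hom = (V.hom ≫ p) ≫ e := by rw [w₁, Category.assoc]
    have hl : pbLift e (pb f U) (V.hom ≫ p) h w₁' ≫ pbSnd e (pb f U) = h :=
      pbLift_snd _ _ _ _ w₁'
    have w₄ : (pbSnd e (pb f U) ≫ pbSnd f U) ≫ U.hom = (pb e (pb f U)).hom ≫ e ≫ f :=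
      precomp_w (pbSnd_w _ _) (pbSnd_w _ _) rfl
    rw [← h₁₂.map_eq (pbLift_hom e (pb f U) (V.hom ≫ p) h w₁') (pbSnd_w _ _) w₁ hl,
      h₂₃.map_eq (pbSnd_w _ _) (pbSnd_w _ _) w₄ rfl]
    exact H.map_eq _ w₄ w₃ (by rw [← Category.assoc, hl]) m
  · intro H
    refine factors_of_pb fun {V U} h w₁ w₃ m => ?_
    have w₂ : pbSnd (e ≫ f) U ≫ U.hom = ((pb (e ≫ f) U).hom ≫ e) ≫ f := by
      rw [pbSnd_w, Category.assoc]
    have hl : pbLift f U ((pb (e ≫ f) U).hom ≫ e) (pbSnd (e ≫ f) U) w₂ ≫ pbSnd f U =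
      pbSnd (e ≫ f) U := pbLift_snd _ _ _ _ w₂
    have wl := pbLift_hom f U ((pb (e ≫ f) U).hom ≫ e) (pbSnd (e ≫ f) U) w₂
    rw [← h₂₃.map_eq wl (pbSnd_w f U) (pbSnd_w _ _) hl,
      h₁₂.map_eq w₁ wl (precomp_w w₁ wl rfl) rfl]
    exact H.map_eq _ (pbSnd_w f U) w₃ (by rw [Category.assoc, hl]) m

lemma IsCart.comp {a : Comorphism e N L} {b : Comorphism f L K} {c : Comorphism g N K}
    (ha : a.IsCart) (hb : b.IsCart) (H : Factors a b c) (hg : e ≫ f = g) :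
    c.IsCart := by
  intro S p q hq J hJ d
  obtain ⟨d₁, hd₁, hu₁⟩ := hb (e := p ≫ e) (by rw [Category.assoc, hg, hq]) hJ d
  obtain ⟨d₂, hd₂, hu₂⟩ := ha rfl hJ d₁
  refine ⟨d₂, (hd₂.assoc H rfl hg hq).2 hd₁, fun d₃ hd₃ => hu₂ _ ?_⟩
  have h₁ := factors_comp d₃ a
  rwa [hu₁ _ ((h₁.assoc H rfl hg hq).1 hd₃)] at h₁

/-- Cancellation for cartesian arrows: factoring through `a` is equivalent to factoring the
composite with `b` through `c`. -/
lemma IsCart.of_comp {a : Comorphism e N L} {b : Comorphism f L K} {c : Comorphism g N K}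
    (hb : b.IsCart) (hc : c.IsCart) (H : Factors a b c) (hg : e ≫ f = g) :
    a.IsCart := by
  intro S p q hq J hJ d
  have hq' : p ≫ g = q ≫ f := by rw [← hg, ← Category.assoc, hq]
  obtain ⟨d', hd', hu⟩ := hc hq' hJ (d.comp b)
  have key : ∀ d₁ : Comorphism p J N, Factors d₁ a d ↔ Factors d₁ c (d.comp b) := by
    intro d₁
    have h₁ := factors_comp d₁ a
    constructor
    · intro h
      exact (h.assoc H hq hg hq').2 (factors_comp d b)
    · intro h
      have h₂ := (h₁.assoc H rfl hg hq').1 h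
      subst hq
      rwa [(hb rfl hJ _).unique h₂ (factors_comp d b)] at h₁
  exact ⟨d', (key _).2 hd', fun d₁ hd₁ => hu _ ((key _).1 hd₁)⟩

/-! ### Charts -/

/-- The map on global sections. -/
def top (c : Comorphism f L K) : K.sec (topEt Y) →* L.sec (topEt X) :=
  c.map (V := topEt X) (U := topEt Y) f ((Category.comp_id _).trans (Category.id_comp _).symm)

lemma top_val (c : Comorphism f L K) (m : K.sec (topEt Y)) :
    L.val _ (c.top m) = f.appTop.hom (K.val _ m) :=
  c.val_map (V := topEt X) (U := topEt Y) f _ m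

lemma Factors.top_eq {a : Comorphism e N L} {b : Comorphism f L K} {c : Comorphism g N K}
    (H : Factors a b c) (hg : e ≫ f = g) (m : K.sec (topEt Y)) : a.top (b.top m) = c.top m :=
  H.map_eq (V := topEt T) (W := topEt X) (U := topEt Y) _ _ _ hg m

end Comorphism

/-- The universal property of a chart extends from log structures on `U` to log structures on any
`T` over `U`, by applying it to the direct image along `a`. -/
lemma PrelogStructure.IsChart.existsUnique {T U : Scheme.{u}} {L : PrelogStructure U} {Q : Type u}
    [CommMonoid Q] {β : Q →* L.sec (topEt U)} (hβ : L.IsChart β) (a : T ⟶ U)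
    {N : PrelogStructure T} (hN : N.IsLog) (γ : Q →* N.sec (topEt T))
    (hγ : ∀ q, N.val _ (γ q) = a.appTop.hom (L.val _ (β q))) :
    ∃! d : Comorphism a N L, ∀ q, d.top (β q) = γ q := by
  let pr : pb a (topEt U) ⟶ topEt T := mkHom (pb a (topEt U)).hom (Category.comp_id _)
  have hpr : pr.left ≫ a = pbSnd a (topEt U) :=
    (pbSnd_w a (topEt U)).symm.trans (Category.comp_id _)
  have wa : a ≫ (topEt U).hom = (topEt T).hom ≫ a :=
    (Category.comp_id _).trans (Category.id_comp _).symm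
  let sec : topEt T ⟶ pb a (topEt U) := toPb a (V := topEt T) a wa
  have hsec : sec ≫ pr = 𝟙 _ := et_hom_ext
    ((Category.comp_id _).symm.trans (left_w (sec ≫ pr)))
  let γ' : Q →* (push a N).sec (topEt U) :=
    { toFun := fun q => mkPush a N (N.res pr (γ q)) (L.val _ (β q)) (by
        rw [N.val_res, hγ, ← hpr]
        exact (appTop_comp_apply _ _ _).symm)
      map_one' := push_ext (map_one ((N.res pr).comp γ)) (map_one ((L.val (topEt U)).comp β))
      map_mul' := fun x y => push_ext (map_mul ((N.res pr).comp γ) x y)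
        (map_mul ((L.val (topEt U)).comp β) x y) }
  have hγ' : ∀ q, pushFst a N (γ' q) = N.res pr (γ q) := fun q => rfl
  obtain ⟨η, ⟨hη, hη'⟩, hu⟩ := hβ (push a N) (push_isLog a hN) γ' fun q => rfl
  refine ⟨ofPush η hη, fun q => ?_, fun d hd => ?_⟩
  · change N.res sec (pushFst a N ((η.app (op (topEt U))).hom (β q))) = _
    rw [hη', hγ', N.res_res, hsec, N.res_id]
  · rw [← ofPush_toPush d]
    have : d.toPush = η := hu _ ⟨d.toPush_α, fun q => push_ext (by
      rw [toPush_fst, hγ', ← hd]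
      exact (d.res_map pr wa (pbSnd_w a (topEt U)) hpr _).symm) rfl⟩
    subst this
    rfl

lemma PrelogStructure.isChart_of {U : Scheme.{u}} {L : PrelogStructure U} {Q : Type u}
    [CommMonoid Q] {β : Q →* L.sec (topEt U)}
    (h : ∀ (N : PrelogStructure U), N.IsLog → ∀ γ : Q →* N.sec (topEt U),
      (∀ q, N.val _ (γ q) = L.val _ (β q)) →
      ∃! d : Comorphism (𝟙 U) N L, ∀ q, d.top (β q) = γ q) : L.IsChart β := by
  intro N hN γ hγ
  obtain ⟨d, hd, hu⟩ := h N hN γ hγ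
  refine ⟨d.toHom, ⟨d.toHom_α, hd⟩, fun η ⟨hη, hη'⟩ => ?_⟩
  rw [← hu (ofHom η hη) fun q => ?_, toHom_ofHom]
  rw [← hη']
  exact congrArg (η.app (op (topEt U))).hom (L.res_id (topEt U) (β q))

end LogGeom
end

noncomputable section

namespace LogGeom

open PrelogStructure Comorphism

/-! ### Sections of the sheaf of pointed monoids -/

section

variable {X : Scheme.{u}} {U V W W' : X.Etale}

/-- The factorization of a morphism through an open subscheme. -/
def liftOpen {A B : Scheme.{u}} (k : A ⟶ B) (D : B.Opens) (hk : ∀ x, k x ∈ D) : A ⟶ D :=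
  IsOpenImmersion.lift D.ι k (by
    rw [Scheme.Opens.range_ι]
    rintro _ ⟨x, rfl⟩
    exact hk x)

lemma liftOpen_ι {A B : Scheme.{u}} (k : A ⟶ B) (D : B.Opens) (hk : ∀ x, k x ∈ D) :
    liftOpen k D hk ≫ D.ι = k := IsOpenImmersion.lift_fac _ _ _

/-- The factorization of a morphism of the étale site through an open subscheme. -/
def toRestr (k : W ⟶ U) (D : U.left.Opens) (hk : ∀ x, k.left x ∈ D) : W ⟶ restr U D :=
  mkHom (V := W) (U := restr U D) (liftOpen k.left D hk)
    ((Category.assoc _ _ _).symm.trans ((congrArg (· ≫ U.hom) (liftOpen_ι k.left D hk)).trans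
      (left_w k)))

lemma toRestr_ι (k : W ⟶ U) (D : U.left.Opens) (hk : ∀ x, k.left x ∈ D) :
    toRestr k D hk ≫ restrι U D = k :=
  et_hom_ext (liftOpen_ι k.left D hk)

lemma toRestr_eq {k : W ⟶ U} {D : U.left.Opens} {hk : ∀ x, k.left x ∈ D} {l : W ⟶ restr U D}
    (h : l ≫ restrι U D = k) : toRestr k D hk = l :=
  restr_hom_ext ((toRestr_ι k D hk).trans h.symm)

lemma comp_left_apply (l : W ⟶ V) (k : V ⟶ U) (x : W.left) : (l ≫ k).left x = k.left (l.left x) :=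
  Scheme.Hom.comp_apply l.left k.left x

lemma restrι_mem (D : U.left.Opens) (x : (restr U D).left) : (restrι U D).left x ∈ D := x.2

lemma restrι_injective (D : U.left.Opens) : Function.Injective (restrι U D).left :=
  fun _ _ h => Subtype.ext h

namespace PrelogStructure.PSec

variable {L : PrelogStructure X}

/-- The value of a section of `M ∪ {∞}` on a scheme lying over the locus where it is finite. -/
def eval (s : L.PSec U) (k : W ⟶ U) (hk : ∀ x, k.left x ∈ s.D) : L.sec W :=
  L.res (toRestr k s.D hk) s.m

lemma eval_congr {s : L.PSec U} {k k' : W ⟶ U} (h : k = k') (hk : ∀ x, k.left x ∈ s.D) :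
    s.eval k hk = s.eval k' (h ▸ hk) := by
  subst h; rfl

lemma eval_congr' {s t : L.PSec U} (h : s = t) {k : W ⟶ U} (hk : ∀ x, k.left x ∈ s.D) :
    s.eval k hk = t.eval k (h ▸ hk) := by
  subst h; rfl

lemma res_eval (s : L.PSec U) (k : W ⟶ U) (hk : ∀ x, k.left x ∈ s.D) (l : W' ⟶ W) :
    L.res l (s.eval k hk) = s.eval (l ≫ k) (fun x => by
      rw [comp_left_apply]; exact hk _) := by
  rw [eval, L.res_res]
  refine congrArg (fun t => L.res t s.m) (toRestr_eq ?_).symm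
  rw [Category.assoc, toRestr_ι]

lemma eval_restrι (s : L.PSec U) : s.eval (restrι U s.D) (restrι_mem _) = s.m := by
  rw [eval, toRestr_eq (Category.id_comp _), L.res_id]

lemma eval_eq (s : L.PSec U) (k : W ⟶ U) (hk : ∀ x, k.left x ∈ s.D) (l : W ⟶ restr U s.D)
    (hl : l ≫ restrι U s.D = k) : s.eval k hk = L.res l s.m := by
  rw [eval, toRestr_eq hl]

lemma ext_eval {s t : L.PSec U} (h : s.D = t.D)
    (hm : s.eval (restrι U s.D) (restrι_mem _) = t.eval (restrι U s.D) (h ▸ restrι_mem s.D)) :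
    s = t := by
  obtain ⟨D, hD, m⟩ := s
  obtain ⟨D', hD', m'⟩ := t
  dsimp only at h
  subst h
  rw [eval_restrι] at hm
  have := eval_restrι (⟨D, hD', m'⟩ : L.PSec U)
  dsimp only at hm this
  rw [this] at hm
  rw [hm]

lemma eval_res (k : V ⟶ U) (s : L.PSec U) (l : W ⟶ V) (hl : ∀ x, l.left x ∈ (res k s).D) :
    (res k s).eval l hl = s.eval (l ≫ k) (fun x => by
      rw [comp_left_apply]; exact hl x) := by
  refine (L.res_res _ _ s.m).trans ?_
  refine congrArg (fun t => L.res t s.m) (toRestr_eq ?_).symm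
  refine (Category.assoc _ _ _).trans ((congrArg (_ ≫ ·) (restrHom_ι _ _ _ _)).trans ?_)
  exact (Category.assoc _ _ _).symm.trans (congrArg (· ≫ k) (toRestr_ι l (res k s).D hl))

lemma eval_mul (s t : L.PSec U) (k : W ⟶ U) (hk : ∀ x, k.left x ∈ (s * t).D) :
    (s * t).eval k hk = s.eval k (fun x => (hk x).1) * t.eval k (fun x => (hk x).2) := by
  rw [eval, mul_m, map_mul, L.res_res, L.res_res]
  congr 1
  · exact congrArg (fun r => L.res r s.m) (toRestr_eq (by
      rw [Category.assoc, restrLE_ι]; exact toRestr_ι _ _ _)).symm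
  · exact congrArg (fun r => L.res r t.m) (toRestr_eq (by
      rw [Category.assoc, restrLE_ι]; exact toRestr_ι _ _ _)).symm

lemma eval_ofSec (m : L.sec U) (k : W ⟶ U) (hk : ∀ x, k.left x ∈ (ofSec m).D) :
    (ofSec m).eval k hk = L.res k m := by
  refine (L.res_res _ _ m).trans ?_
  exact congrArg (fun r => L.res r m) (toRestr_ι _ _ _)

lemma eq_ofSec {s : L.PSec U} (h : ∀ x, (𝟙 U : U ⟶ U).left x ∈ s.D) :
    s = ofSec (s.eval (𝟙 U) h) := by
  have hD : s.D = ⊤ := top_unique fun x _ => h x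
  refine ext_eval hD ?_
  rw [eval_ofSec, res_eval]
  exact eval_congr (Category.comp_id _).symm _

lemma res_ofSec (k : V ⟶ U) (m : L.sec U) : res k (ofSec m) = ofSec (L.res k m) := by
  refine ext_eval rfl ?_
  rw [eval_res, eval_ofSec, eval_ofSec, L.res_res]

lemma res_restrι (s : L.PSec U) : res (restrι U s.D) s = ofSec s.m := by
  have hD : (res (restrι U s.D) s).D = ⊤ := top_unique fun x _ => restrι_mem _ x
  refine ext_eval hD ?_
  rw [eval_res, eval_ofSec]
  exact eval_eq _ _ _ _ rfl

lemma res_infty (k : V ⟶ U) : res k (infty U : L.PSec U) = infty V := by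
  refine ext_eval rfl ?_
  rw [eval_res]
  exact (map_one (L.res _)).trans (map_one (L.res _)).symm

/-- Two sections over the empty scheme agree, provided `M` is a sheaf. -/
lemma sec_subsingleton (hL : L.Gluing) (h : IsEmpty U.left) (m m' : L.sec U) : m = m' :=
  hL.ext (ι := PEmpty) (V := fun i => i.elim) (fun i => i.elim) (fun x => h.elim x) _ _
    fun i => i.elim

lemma eq_infty (hL : L.Gluing) {s : L.PSec U} (h : ∀ x, x ∉ s.D) : s = infty U := by
  have hD : s.D = ⊥ := bot_unique fun x hx => h x hx
  exact ext_eval hD (sec_subsingleton hL ⟨fun x => h _ (restrι_mem _ x)⟩ _ _)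

lemma infty_mul (hL : L.Gluing) (s : L.PSec U) : infty U * s = infty U :=
  eq_infty hL fun _ hx => hx.1

lemma mul_infty (hL : L.Gluing) (s : L.PSec U) : s * infty U = infty U :=
  eq_infty hL fun _ hx => hx.2

lemma ofSec_mul (m m' : L.sec U) : ofSec (m * m') = ofSec m * ofSec m' := by
  refine ext_eval (top_inf_eq ⊤).symm ?_
  rw [eval_mul, eval_ofSec, eval_ofSec, eval_ofSec, map_mul]

lemma ofSec_one : ofSec (1 : L.sec U) = 1 := by
  refine ext_eval rfl ?_
  rw [eval_ofSec]
  exact (map_one (L.res _)).trans (map_one (L.res _)).symm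

lemma ofSec_injective {m m' : L.sec U} (h : ofSec m = ofSec m') : m = m' := by
  have h₁ := eval_ofSec m (𝟙 U) (fun _ => trivial)
  have h₂ := eval_ofSec m' (𝟙 U) (fun _ => trivial)
  rw [L.res_id] at h₁ h₂
  rw [← h₁, ← h₂]
  exact eval_congr' h _

lemma val_eval (s : L.PSec U) (k : W ⟶ U) (hk : ∀ x, k.left x ∈ s.D) :
    L.val W (s.eval k hk) = k.left.appTop.hom (val U s) := by
  rw [eval, L.val_res]
  have h₁ : (restrι U s.D).left.appTop.hom (val U s) = L.val _ s.m := extendZero_self _ _ _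
  rw [← h₁, ← appTop_comp_apply, ← comp_left, toRestr_ι]

lemma val_ofSec (m : L.sec U) : val U (ofSec m) = L.val U m := by
  have h₁ := val_eval (ofSec m) (𝟙 U) (fun _ => trivial)
  have h₂ := congrArg (L.val U) ((eval_ofSec m (𝟙 U) (fun _ => trivial)).trans (L.res_id U m))
  refine Eq.trans ?_ (h₁.symm.trans h₂)
  exact (congrArg (fun t => t.hom (val U (ofSec m))) ((structureMon X).map_id (op U))).symm

lemma val_infty : val U (infty U : L.PSec U) = 0 := by
  have h := extendZero_compl (⊥ : U.left.Opens) isClosed_empty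
    (L.val (restr U ⊥) 1)
  refine glue_unique (⊥ : U.left.Opens) isClosed_empty ?_ (h.trans (map_zero _).symm)
  have : IsEmpty ((⊥ : U.left.Opens) : Scheme.{u}) := ⟨fun x => x.2⟩
  exact Subsingleton.elim _ _

end PrelogStructure.PSec

end

/-! ### The sheaf of pointed monoids is a log structure -/

lemma isEmpty_of_zero_eq_one {A : Scheme.{u}} (h : (0 : Γ(A, ⊤)) = 1) : IsEmpty A := by
  have h₁ := Scheme.basicOpen_of_isUnit A (f := (1 : Γ(A, ⊤))) isUnit_one
  rw [← h, Scheme.basicOpen_zero] at h₁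
  exact ⟨fun x => (h₁ ▸ trivial : x ∈ (⊥ : A.Opens))⟩

lemma isOpenMap_left {X : Scheme.{u}} {U V : X.Etale} (k : V ⟶ U) : IsOpenMap k.left := by
  have := etale_left k
  exact k.left.isOpenMap

namespace PrelogStructure

variable {X : Scheme.{u}} {L : PrelogStructure X}

open PSec

/-- Finite loci glue because étale morphisms are open: compatibility makes the union of the images
of the loci and the union of the images of their complements complementary, and both are open. On
the resulting open and closed set the sections of `M` glue. -/
lemma pointed_gluing (hL : L.Gluing) : L.pointed.Gluing := by
  constructor
  · intro U ι V k hk (s : L.PSec U) (t : L.PSec U) (hst : ∀ i, PSec.res (k i) s = PSec.res (k i) t)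
    have hD : s.D = t.D := by
      ext x
      obtain ⟨i, y, rfl⟩ := hk x
      have := congrArg (fun r : L.PSec (V i) => y ∈ r.D) (hst i)
      exact Iff.of_eq this
    refine ext_eval hD (hL.ext (fun i => prodFst (restrι U s.D) (k i)) ?_ _ _ fun i => ?_)
    · intro x
      obtain ⟨i, y, hy⟩ := hk ((restrι U s.D).left x)
      obtain ⟨z, hz, -⟩ := exists_prod_point (restrι U s.D) (k i) x y hy.symm
      exact ⟨i, z, hz⟩
    · have hm : ∀ x, (prodSnd (restrι U s.D) (k i)).left x ∈ (PSec.res (k i) s).D := fun x => by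
        change (k i).left _ ∈ s.D
        rw [← comp_left_apply, ← prod_condition, comp_left_apply]
        exact restrι_mem _ _
      rw [res_eval, res_eval, eval_congr (prod_condition _ _), eval_congr (prod_condition _ _),
        ← eval_res _ _ _ hm, eval_congr' (hst i), eval_res]
  · intro U ι V k hk (x : ∀ i, L.PSec (V i)) (hx : ∀ (i j : ι) (W : X.Etale) (a : W ⟶ V i)
      (b : W ⟶ V j), a ≫ k i = b ≫ k j → PSec.res a (x i) = PSec.res b (x j))
    have key : ∀ i j (y : (V i).left) (z : (V j).left), (k i).left y = (k j).left z →
        (y ∈ (x i).D ↔ z ∈ (x j).D) := by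
      intro i j y z hyz
      obtain ⟨p, rfl, rfl⟩ := exists_prod_point (k i) (k j) y z hyz
      have := hx i j _ _ _ (prod_condition (k i) (k j))
      exact Iff.of_eq (congrArg (fun r : L.PSec (prodEt (k i) (k j)) => p ∈ r.D) this)
    have hmem : ∀ i (y : (V i).left),
        (k i).left y ∈ (⋃ i, (k i).left '' ((x i).D : Set (V i).left)) ↔ y ∈ (x i).D := by
      intro i y
      constructor
      · intro h
        obtain ⟨j, z, hz, hzy⟩ := Set.mem_iUnion.1 h
        exact (key j i z y hzy).1 hz
      · intro h
        exact Set.mem_iUnion.2 ⟨i, y, h, rfl⟩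
    let D : U.left.Opens := ⟨⋃ i, (k i).left '' ((x i).D : Set (V i).left),
      isOpen_iUnion fun i => isOpenMap_left (k i) _ (x i).D.isOpen⟩
    have hD : IsClosed (D : Set U.left) := by
      rw [← isOpen_compl_iff]
      have : (D : Set U.left)ᶜ = ⋃ i, (k i).left '' ((x i).D : Set (V i).left)ᶜ := by
        ext u
        obtain ⟨i, y, rfl⟩ := hk u
        constructor
        · intro h
          exact Set.mem_iUnion.2 ⟨i, y, fun hy => h ((hmem i y).2 hy), rfl⟩
        · intro h h'
          obtain ⟨j, z, hz, hzy⟩ := Set.mem_iUnion.1 h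
          exact hz ((key i j y z hzy.symm).1 ((hmem i y).1 h'))
      rw [this]
      exact isOpen_iUnion fun i => isOpenMap_left (k i) _ (x i).isClosed.isOpen_compl
    have hDi : ∀ i, (x i).D = (k i).left ⁻¹ᵁ D := fun i => by
      ext y
      exact (hmem i y).symm
    let r : ∀ i, restr (V i) (x i).D ⟶ restr U D := fun i => restrHom (k i) D _ (hDi i).le
    obtain ⟨m, hm⟩ := hL.glue r (by
      intro u
      obtain ⟨i, y, hy⟩ := hk ((restrι U D).left u)
      have hyD : y ∈ (x i).D := by
        rw [hDi]
        change (k i).left y ∈ D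
        rw [hy]
        exact restrι_mem _ _
      refine ⟨i, (⟨y, hyD⟩ : ((x i).D : Scheme.{u})), ?_⟩
      apply restrι_injective D
      refine (comp_left_apply (r i) (restrι U D) _).symm.trans ((congrArg (fun t :
        restr (V i) (x i).D ⟶ U => t.left (⟨y, hyD⟩ : ((x i).D : Scheme.{u})))
        (restrHom_ι (k i) D (x i).D (hDi i).le)).trans ?_)
      exact (comp_left_apply (restrι (V i) (x i).D) (k i) _).trans hy) (fun i => (x i).m) (by
      intro i j W a b hab
      have h₁ : (a ≫ restrι _ _) ≫ k i = (b ≫ restrι _ _) ≫ k j := by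
        have := congrArg (· ≫ restrι U D) hab
        simp only [r, Category.assoc, restrHom_ι] at this
        rw [Category.assoc, this, Category.assoc]
      have h₂ := hx i j W _ _ h₁
      have m₁ : ∀ p, (a ≫ restrι _ _).left p ∈ (x i).D := fun p => by
        rw [comp_left_apply]; exact restrι_mem _ _
      have m₂ : ∀ p, (b ≫ restrι _ _).left p ∈ (x j).D := fun p => by
        rw [comp_left_apply]; exact restrι_mem _ _
      rw [← eval_eq (x i) _ m₁ a rfl, ← eval_eq (x j) _ m₂ b rfl]
      have h₃ : ∀ p, (𝟙 W : W ⟶ W).left p ∈ (PSec.res (a ≫ restrι _ _) (x i)).D := m₁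
      have e₁ := eval_res _ _ _ h₃
      rw [eval_congr' h₂, eval_res] at e₁
      rw [eval_congr (Category.id_comp _).symm, ← e₁]
      exact eval_congr (Category.id_comp _) _)
    refine ⟨(⟨D, hD, m⟩ : L.PSec U), fun i => ?_⟩
    exact PSec.res_eq (hDi i) (hm i).symm

/-- On the complement of the finite locus the value is `0`; if it is also a unit there, that
complement is empty. -/
lemma eq_top_of_isUnit_val {U : X.Etale} {s : L.PSec U} (h : IsUnit (PSec.val U s)) :
    s.D = ⊤ := by
  have h₁ := extendZero_compl s.D s.isClosed (L.val _ s.m)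
  have h₂ : IsUnit ((clopenCompl s.D s.isClosed).ι.appTop.hom (PSec.val U s)) := h.map _
  have h₃ : (clopenCompl s.D s.isClosed).ι.appTop.hom (PSec.val U s) = 0 := h₁
  rw [h₃, isUnit_zero_iff] at h₂
  have h₅ : IsEmpty (clopenCompl s.D s.isClosed : Scheme.{u}) := isEmpty_of_zero_eq_one h₂
  refine top_unique fun x _ => ?_
  by_contra hx
  exact h₅.elim ⟨x, hx⟩

/-- A section with invertible value is finite everywhere, so adjoining `∞` adds no lift of a unit.
This makes `M ∪ {∞}` an admissible target in the universal properties of charts and pullbacks. -/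
lemma pointed_isLog (hL : L.IsLog) : L.pointed.IsLog := by
  refine (pointed_gluing hL.gluing).isLog fun U a ha => ?_
  obtain ⟨m, hm, hu⟩ := hL.existsUnique_val_eq U a ha
  refine ⟨(ofSec m : L.PSec U), (val_ofSec m).trans hm, fun (s : L.PSec U) hs => ?_⟩
  have hs' : PSec.val U s = a := hs
  have hD : s.D = ⊤ := eq_top_of_isUnit_val (hs' ▸ ha)
  have hk : ∀ x, (𝟙 U : U ⟶ U).left x ∈ s.D := fun x => hD ▸ trivial
  rw [eq_ofSec hk]
  congr 1
  refine hu _ ?_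
  dsimp only
  rw [val_eval, hs']
  exact congrArg (fun t => t.hom a) ((structureMon X).map_id (op U))

end PrelogStructure

end LogGeom
end

noncomputable section

namespace LogGeom

open PrelogStructure Comorphism

/-! ### Existence of pullbacks of log structures -/

/-- The objects of a small cofinal part of the étale site. -/
@[irreducible]
def affEt {X : Scheme.{u}} (c : SmallModel.{u} X.AffineEtale) : X.Etale :=
  (Scheme.AffineEtale.Spec X).obj ((equivSmallModel X.AffineEtale).inverse.obj c)

/-- Affine étale schemes are dense in the étale site and essentially small. The small model supplies
test objects indexed by `Type u`, which bounds the size of pullback log structures. -/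
lemma exists_affEt {X : Scheme.{u}} (W : X.Etale) (y : W.left) :
    ∃ (c : SmallModel.{u} X.AffineEtale) (l : affEt c ⟶ W) (z : (affEt c).left), l.left z = y := by
  have h := (Functor.IsCoverDense.is_cover (G := Scheme.AffineEtale.Spec X)
    (K := X.smallEtaleTopology) W)
  obtain ⟨V, k, ⟨⟨A, a, b, hab⟩⟩, z, hz⟩ := exists_of_mem h y
  let e := (Scheme.AffineEtale.Spec X).mapIso ((equivSmallModel X.AffineEtale).unitIso.app A)
  refine ⟨(equivSmallModel X.AffineEtale).functor.obj A, ?_⟩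
  unfold affEt
  refine ⟨e.inv ≫ b, e.hom.left (a.left z), ?_⟩
  rw [← comp_left_apply, Iso.hom_inv_id_assoc, ← comp_left_apply, hab, hz]

namespace PrelogStructure

variable {X : Scheme.{u}} {N : PrelogStructure X}

/-- The section of a log structure given by an invertible function. -/
def IsLog.unit (hN : N.IsLog) {V : X.Etale} (a : Γ(V.left, ⊤)ˣ) : N.sec V :=
  (hN.existsUnique_val_eq V a a.isUnit).choose

lemma IsLog.val_unit (hN : N.IsLog) {V : X.Etale} (a : Γ(V.left, ⊤)ˣ) :
    N.val V (hN.unit a) = a := (hN.existsUnique_val_eq V a a.isUnit).choose_spec.1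

lemma IsLog.eq_unit (hN : N.IsLog) {V : X.Etale} {a : Γ(V.left, ⊤)ˣ} {n : N.sec V}
    (h : N.val V n = a) : n = hN.unit a :=
  (hN.existsUnique_val_eq V a a.isUnit).unique h (hN.val_unit a)

lemma IsLog.unit_one (hN : N.IsLog) {V : X.Etale} : hN.unit (1 : Γ(V.left, ⊤)ˣ) = 1 :=
  (hN.eq_unit (map_one _)).symm

lemma IsLog.unit_mul (hN : N.IsLog) {V : X.Etale} (a b : Γ(V.left, ⊤)ˣ) :
    hN.unit (a * b) = hN.unit a * hN.unit b :=
  (hN.eq_unit (by rw [map_mul, hN.val_unit, hN.val_unit, Units.val_mul])).symm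

/-- The restriction of invertible functions. -/
def unitRes {V' V : X.Etale} (k : V' ⟶ V) : Γ(V.left, ⊤)ˣ →* Γ(V'.left, ⊤)ˣ :=
  Units.map (k.left.appTop.hom : _ →* _)

lemma IsLog.res_unit (hN : N.IsLog) {V' V : X.Etale} (k : V' ⟶ V) (a : Γ(V.left, ⊤)ˣ) :
    N.res k (hN.unit a) = hN.unit (unitRes k a) :=
  hN.eq_unit (by rw [N.val_res, hN.val_unit]; rfl)

/-- The structure sheaf as a log structure. -/
def ofStructure (X : Scheme.{u}) : PrelogStructure X := ⟨structureMon X, 𝟙 _⟩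

lemma ofStructure_isLog (X : Scheme.{u}) : (ofStructure X).IsLog :=
  Gluing.isLog ⟨fun _ hk _ _ h => hk.ext_fun h, fun _ hk x hx => hk.glue_fun x hx⟩
    fun _ a _ => ⟨a, rfl, fun _ h => h⟩

end PrelogStructure

/-! ### The pullback as families inside the product of all targets -/

section

variable {X Y : Scheme.{u}}

/-- The canonical comorphism to the structure sheaf. -/
def toStructure (f : X ⟶ Y) (K : PrelogStructure Y) : Comorphism f (ofStructure X) K where
  map {V U} h _ := (h.appTop.hom : Γ(U.left, ⊤) →* Γ(V.left, ⊤)).comp (K.val U)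
  map_comp_left k h _ _ _ := appTop_comp_apply k.left h _
  map_comp_right h k _ _ m := (appTop_comp_apply h k.left _).trans
    (congrArg h.appTop.hom (K.val_res k m).symm)
  val_map {_ _} _ _ _ := rfl

/-- A log structure which receives a comorphism. -/
structure PullbackTarget (f : X ⟶ Y) (K : PrelogStructure Y) where
  N : PrelogStructure X
  isLog : N.IsLog
  co : Comorphism f N K

namespace PullbackTarget

variable (f : X ⟶ Y) (K : PrelogStructure Y)

variable {f K} in
/-- A family of sections given by a section of `K` and an invertible function. -/
def elem {V : X.Etale} {U : Y.Etale} (h : V.left ⟶ U.left) (w : h ≫ U.hom = V.hom ≫ f)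
    (m : K.sec U) (a : Γ(V.left, ⊤)ˣ) (t : PullbackTarget f K) : t.N.sec V :=
  t.co.map h w m * t.isLog.unit a

variable {f K} in
lemma res_elem {V' V : X.Etale} {U : Y.Etale} (k : V' ⟶ V) (h : V.left ⟶ U.left)
    (w : h ≫ U.hom = V.hom ≫ f) {h' : V'.left ⟶ U.left} (w' : h' ≫ U.hom = V'.hom ≫ f)
    (e : k.left ≫ h = h') (m : K.sec U) (a : Γ(V.left, ⊤)ˣ) (t : PullbackTarget f K) :
    t.N.res k (elem h w m a t) = elem h' w' m (unitRes k a) t := by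
  rw [elem, map_mul, t.isLog.res_unit, t.co.res_map k w w' e]
  rfl

variable {f K} in
lemma elem_res {V : X.Etale} {U' U : Y.Etale} (h : V.left ⟶ U'.left) (k : U' ⟶ U)
    (w : h ≫ U'.hom = V.hom ≫ f) {h' : V.left ⟶ U.left} (w' : h' ≫ U.hom = V.hom ≫ f)
    (e : h ≫ k.left = h') (m : K.sec U) (a : Γ(V.left, ⊤)ˣ) (t : PullbackTarget f K) :
    elem h w (K.res k m) a t = elem h' w' m a t := by
  rw [elem, t.co.map_res k w w' e]
  rfl

variable {f K} in
/-- Families which are locally given by sections of `K` and invertible functions. -/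
def IsLocal {V : X.Etale} (s : ∀ t : PullbackTarget f K, t.N.sec V) : Prop :=
  ∀ x : V.left, ∃ (W : X.Etale) (k : W ⟶ V) (y : W.left) (U : Y.Etale) (h : W.left ⟶ U.left)
    (w : h ≫ U.hom = W.hom ≫ f) (m : K.sec U) (a : Γ(W.left, ⊤)ˣ), k.left y = x ∧
      ∀ t : PullbackTarget f K, t.N.res k (s t) = elem h w m a t

variable {f K} in
lemma isLocal_elem {V : X.Etale} {U : Y.Etale} (h : V.left ⟶ U.left)
    (w : h ≫ U.hom = V.hom ≫ f) (m : K.sec U) (a : Γ(V.left, ⊤)ˣ) : IsLocal (elem h w m a) :=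
  fun x => ⟨V, 𝟙 V, x, U, h, w, m, a, rfl, fun t => t.N.res_id _ _⟩

/-- The structure morphism, as a morphism to the final object. -/
def topHom (f : X ⟶ Y) (V : X.Etale) : V.left ⟶ (topEt Y).left := V.hom ≫ f

variable {f} in
lemma topHom_w (V : X.Etale) : topHom f V ≫ (topEt Y).hom = V.hom ≫ f := Category.comp_id _

variable {f K} in
lemma IsLocal.res {V' V : X.Etale} (k : V' ⟶ V) {s : ∀ t : PullbackTarget f K, t.N.sec V}
    (hs : IsLocal s) : IsLocal fun t => t.N.res k (s t) := by
  intro x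
  obtain ⟨W, l, y, U, h, w, m, a, hy, H⟩ := hs (k.left x)
  obtain ⟨z, hz, -⟩ := exists_prod_point k l x y hy.symm
  have w' : ((prodSnd k l).left ≫ h) ≫ U.hom = (prodEt k l).hom ≫ f := by
    rw [← left_w (prodSnd k l), Category.assoc, w, Category.assoc]
  refine ⟨_, prodFst k l, z, U, (prodSnd k l).left ≫ h, w', m, unitRes (prodSnd k l) a, hz,
    fun t => ?_⟩
  rw [t.N.res_res, prod_condition, ← t.N.res_res, H]
  exact res_elem _ _ _ _ rfl _ _ _

variable {f K} in
lemma IsLocal.of_cover {V : X.Etale} {s : ∀ t : PullbackTarget f K, t.N.sec V} {ι : Type u}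
    {W : ι → X.Etale} {k : ∀ i, W i ⟶ V} (hk : JointlySurj k)
    (hs : ∀ i, IsLocal fun t => t.N.res (k i) (s t)) : IsLocal s := by
  intro x
  obtain ⟨i, y, rfl⟩ := hk x
  obtain ⟨W', l, z, U, h, w, m, a, rfl, H⟩ := hs i y
  refine ⟨W', l ≫ k i, z, U, h, w, m, a, comp_left_apply _ _ _, fun t => ?_⟩
  rw [← t.N.res_res, H]

/-- The submonoid of local families. -/
def localFam (V : X.Etale) : Submonoid (∀ t : PullbackTarget f K, t.N.sec V) where
  carrier := {s | IsLocal s}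
  one_mem' := by
    have := isLocal_elem (K := K) (topHom f V) (topHom_w V) 1 1
    have h : elem (K := K) (topHom f V) (topHom_w V) 1 1 = 1 := by
      funext t
      rw [elem, map_one, t.isLog.unit_one, mul_one]
      rfl
    rwa [h] at this
  mul_mem' := by
    intro s s' hs hs' x
    obtain ⟨W, k, y, U, h, w, m, a, hy, H⟩ := hs x
    obtain ⟨W', k', y', U', h', w', m', a', hy', H'⟩ := hs' x
    obtain ⟨z, hz, -⟩ := exists_prod_point k k' y y' (hy.trans hy'.symm)
    have e₁ : ((prodFst k k').left ≫ h) ≫ U.hom = (prodEt k k').hom ≫ f := by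
      rw [← left_w (prodFst k k'), Category.assoc, w, Category.assoc]
    have e₂ : ((prodSnd k k').left ≫ h') ≫ U'.hom = (prodEt k k').hom ≫ f := by
      rw [← left_w (prodSnd k k'), Category.assoc, w', Category.assoc]
    -- The two generators come from different `U` and `U'`; their product is a generator over `U ×_Y
    -- U'`.
    let pU : U ⟶ topEt Y := mkHom U.hom (Category.comp_id _)
    let pU' : U' ⟶ topEt Y := mkHom U'.hom (Category.comp_id _)
    let l : (prodEt k k').left ⟶ (prodEt pU pU').left :=
      Limits.pullback.lift ((prodFst k k').left ≫ h) ((prodSnd k k').left ≫ h') (e₁.trans e₂.symm)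
    have l₁ : l ≫ (prodFst pU pU').left = (prodFst k k').left ≫ h := Limits.pullback.lift_fst _ _ _
    have l₂ : l ≫ (prodSnd pU pU').left = (prodSnd k k').left ≫ h' := Limits.pullback.lift_snd _ _ _
    have wl : l ≫ (prodEt pU pU').hom = (prodEt k k').hom ≫ f := by
      rw [← left_w (prodFst pU pU'), ← Category.assoc, l₁, e₁]
    refine ⟨_, prodFst k k' ≫ k, z, prodEt pU pU', l, wl,
      K.res (prodFst _ _) m * K.res (prodSnd _ _) m',
      unitRes (prodFst k k') a * unitRes (prodSnd k k') a', ?_, fun t => ?_⟩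
    · rw [comp_left_apply, hz, hy]
    · have h₁ : t.N.res (prodFst k k' ≫ k) (s t) = elem l wl (K.res (prodFst _ _) m)
          (unitRes (prodFst k k') a) t := by
        rw [← t.N.res_res, H, res_elem _ _ _ e₁ rfl, elem_res _ _ _ e₁ l₁]
      have h₂ : t.N.res (prodFst k k' ≫ k) (s' t) = elem l wl (K.res (prodSnd _ _) m')
          (unitRes (prodSnd k k') a') t := by
        rw [prod_condition, ← t.N.res_res, H', res_elem _ _ _ e₂ rfl, elem_res _ _ _ e₂ l₂]
      rw [Pi.mul_apply, map_mul, h₁, h₂, elem, elem, elem, map_mul, t.isLog.unit_mul]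
      exact mul_mul_mul_comm _ _ _ _

/-- The local data describing a local family. -/
structure LocalData (V : X.Etale) : Type u where
  c : SmallModel.{u} X.AffineEtale
  b : SmallModel.{u} Y.AffineEtale
  k : affEt c ⟶ V
  h : (affEt c).left ⟶ (affEt b).left
  m : K.sec (affEt b)
  a : Γ((affEt c).left, ⊤)ˣ

variable {f K} in
/-- A local family is described by given data. -/
def Describes {V : X.Etale} (s : ∀ t : PullbackTarget f K, t.N.sec V) (p : LocalData K V) : Prop :=
  ∃ w : p.h ≫ (affEt p.b).hom = (affEt p.c).hom ≫ f, ∀ t,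
    t.N.res p.k (s t) = elem p.h w p.m p.a t

variable {f K} in
-- Both members of a local description can be taken from the small families: refine `U` near the
-- image point, base change `W` accordingly, then refine the result.
lemma IsLocal.exists_describes {V : X.Etale} {s : ∀ t : PullbackTarget f K, t.N.sec V}
    (hs : IsLocal s) (x : V.left) :
    ∃ p : LocalData K V, Describes s p ∧ ∃ y, p.k.left y = x := by
  obtain ⟨W, k, y, U, h, w, m, a, hy, H⟩ := hs x
  obtain ⟨b, lb, zb, hzb⟩ := exists_affEt U (h y)
  have : Etale lb.left := etale_left lb
  obtain ⟨z, hz, hz'⟩ := Scheme.Pullback.exists_preimage_pullback (f := h) (g := lb.left) y zb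
    hzb.symm
  let W' : X.Etale := MorphismProperty.Over.mk ⊤ (Limits.pullback.fst h lb.left ≫ W.hom)
    (etale_comp _ _ inferInstance W.prop)
  let k' : W' ⟶ W := mkHom (V := W') (Limits.pullback.fst h lb.left) rfl
  let h' : W'.left ⟶ (affEt b).left := Limits.pullback.snd h lb.left
  have e' : k'.left ≫ h = h' ≫ lb.left := Limits.pullback.condition
  obtain ⟨c, l, z', hz''⟩ := exists_affEt W' z
  have w₁ : (l.left ≫ h') ≫ (affEt b).hom = (affEt c).hom ≫ f := by
    rw [← left_w lb, Category.assoc, ← Category.assoc h', ← e', Category.assoc, w,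
      ← left_w l, ← left_w k', Category.assoc, Category.assoc]
  have e₁ : (l ≫ k').left ≫ h = (l.left ≫ h') ≫ lb.left := by
    rw [comp_left, Category.assoc, e', Category.assoc]
  have w₂ : ((l.left ≫ h') ≫ lb.left) ≫ U.hom = (affEt c).hom ≫ f := by
    rw [Category.assoc, left_w, w₁]
  refine ⟨⟨c, b, (l ≫ k') ≫ k, l.left ≫ h', K.res lb m, unitRes (l ≫ k') a⟩, ⟨w₁, fun t => ?_⟩,
    z', ?_⟩
  · dsimp only
    rw [← t.N.res_res, H, res_elem (l ≫ k') h w w₂ e₁, elem_res _ lb w₁ w₂ rfl]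
  · refine (comp_left_apply _ _ _).trans ((congrArg k.left (comp_left_apply _ _ _)).trans ?_)
    refine Eq.trans (congrArg (fun v => k.left (k'.left v)) hz'') ?_
    exact (congrArg k.left hz).trans hy

/-- A family has components in a large collection of targets, but by the sheaf condition it is
determined by the set of `LocalData` describing it, and those data live in `Type u`. -/
instance (V : X.Etale) : Small.{u} (localFam f K V) := by
  refine small_of_injective (β := Set (LocalData K V))
    (f := fun s => {p | Describes (f := f) s.1 p}) fun s s' hss => ?_
  refine Subtype.ext (funext fun t => ?_)
  choose p hp y hy using fun x => IsLocal.exists_describes s.2 x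
  refine t.isLog.gluing.ext (fun x : V.left => (p x).k) (fun x => ⟨x, y x, hy x⟩) _ _
    fun x => ?_
  obtain ⟨w, H⟩ := hp x
  obtain ⟨w', H'⟩ : Describes s'.1 (p x) := (Set.ext_iff.1 hss (p x)).1 (hp x)
  rw [H, H']

/-- Restriction of local families. -/
def localFamRes {V' V : X.Etale} (k : V' ⟶ V) : localFam f K V →* localFam f K V' where
  toFun s := ⟨fun t => t.N.res k (s.1 t), IsLocal.res k s.2⟩
  map_one' := Subtype.ext (funext fun _ => map_one _)
  map_mul' _ _ := Subtype.ext (funext fun _ => map_mul _ _ _)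

/-- The structure sheaf as a target. -/
def structureTarget : PullbackTarget f K := ⟨ofStructure X, ofStructure_isLog X, toStructure f K⟩

/-- The value of a local family. -/
def localFamVal (V : X.Etale) : localFam f K V →* Γ(V.left, ⊤) where
  toFun s := s.1 (structureTarget f K)
  map_one' := rfl
  map_mul' _ _ := rfl

/-- The universe-small version of the monoid of local families. -/
def famEquiv (V : X.Etale) : Shrink.{u} (localFam f K V) ≃* localFam f K V := Shrink.mulEquiv

/-- Restriction. -/
def smallRes {V' V : X.Etale} (k : V' ⟶ V) :
    Shrink.{u} (localFam f K V) →* Shrink.{u} (localFam f K V') :=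
  ((famEquiv f K V').symm.toMonoidHom.comp (localFamRes f K k)).comp (famEquiv f K V).toMonoidHom

variable {f K} in
lemma famEquiv_smallRes {V' V : X.Etale} (k : V' ⟶ V) (s : Shrink.{u} (localFam f K V)) :
    famEquiv f K V' (smallRes f K k s) = localFamRes f K k (famEquiv f K V s) :=
  (famEquiv f K V').apply_symm_apply _

end PullbackTarget

open PullbackTarget

variable (f : X ⟶ Y) (K : PrelogStructure Y)

/-- The pullback of a log structure. -/
def pullbackLog : PrelogStructure X where
  M :=
    { obj := fun V => CommMonCat.of (Shrink.{u} (localFam f K V.unop))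
      map := fun k => CommMonCat.ofHom (smallRes f K k.unop)
      map_id := fun V => CommMonCat.hom_ext (MonoidHom.ext fun s => (famEquiv f K _).injective
        ((famEquiv_smallRes _ _).trans (Subtype.ext (funext fun t => t.N.res_id _ _))))
      map_comp := fun {U V W} k l => CommMonCat.hom_ext (MonoidHom.ext fun s =>
        (famEquiv f K _).injective (by
          change famEquiv f K W.unop (smallRes f K _ s) =
            famEquiv f K W.unop (smallRes f K l.unop (smallRes f K k.unop s))
          rw [famEquiv_smallRes, famEquiv_smallRes, famEquiv_smallRes]
          exact Subtype.ext (funext fun t => (t.N.res_res l.unop k.unop _).symm))) }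
  α :=
    { app := fun V => CommMonCat.ofHom ((localFamVal f K V.unop).comp
        (famEquiv f K V.unop).toMonoidHom)
      naturality := fun U V k => CommMonCat.hom_ext (MonoidHom.ext fun s =>
        congrArg (localFamVal f K V.unop) (famEquiv_smallRes k.unop s)) }

namespace PullbackTarget

/-- Sections of the pullback as local families. -/
def fam (V : X.Etale) : (pullbackLog f K).sec V ≃* localFam f K V := famEquiv f K V

variable {f K}

lemma fam_res {V' V : X.Etale} (k : V' ⟶ V) (s : (pullbackLog f K).sec V)
    (t : PullbackTarget f K) :
    (fam f K V' ((pullbackLog f K).res k s)).1 t = t.N.res k ((fam f K V s).1 t) :=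
  congrArg (fun r : localFam f K _ => r.1 t) (famEquiv_smallRes k s)

lemma fam_ext {V : X.Etale} {s s' : (pullbackLog f K).sec V}
    (h : ∀ t, (fam f K V s).1 t = (fam f K V s').1 t) : s = s' :=
  (fam f K V).injective (Subtype.ext (funext h))

/-- Locally a family is an image of a section of `K` times a unit, and the value of such a product
is the same in every target. -/
lemma fam_val {V : X.Etale} (s : (pullbackLog f K).sec V) (t : PullbackTarget f K) :
    t.N.val V ((fam f K V s).1 t) = (pullbackLog f K).val V s := by
  change _ = (fam f K V s).1 (structureTarget f K)
  choose W k y U h w m a hy H using (fam f K V s).2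
  refine JointlySurj.ext_fun (k := k) (fun x => ⟨x, y x, hy x⟩) fun x => ?_
  refine (t.N.val_res _ _).symm.trans ?_
  refine Eq.trans ?_ (H x (structureTarget f K)).symm
  rw [H, elem, elem, map_mul, t.isLog.val_unit, t.co.val_map]
  exact congrArg (_ * ·) ((structureTarget f K).isLog.val_unit (a x)).symm

end PullbackTarget

/-- Families glue target by target, and being locally generated is a local condition. Over a unit
the only family is the one of its lifts in all targets. -/
lemma pullbackLog_isLog : (pullbackLog f K).IsLog := by
  refine Gluing.isLog ⟨?_, ?_⟩ ?_
  · intro V ι W k hk s s' h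
    refine fam_ext fun t => t.isLog.gluing.ext k hk _ _ fun i => ?_
    rw [← fam_res, h, fam_res]
  · intro V ι W k hk x hx
    choose s hs using fun t : PullbackTarget f K => t.isLog.gluing.glue k hk
      (fun i => (fam f K _ (x i)).1 t) fun i j W' a b hab => by
        rw [← fam_res, hx i j W' a b hab, fam_res]
    have hl : IsLocal s := IsLocal.of_cover hk fun i => by
      rw [show (fun t => t.N.res (k i) (s t)) = (fam f K _ (x i)).1 from funext fun t => hs t i]
      exact (fam f K _ (x i)).2
    refine ⟨(fam f K V).symm ⟨s, hl⟩, fun i => fam_ext fun t => ?_⟩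
    rw [fam_res, MulEquiv.apply_symm_apply, hs]
  · rintro V _ ⟨a, rfl⟩
    have hl := isLocal_elem (K := K) (topHom f V) (topHom_w V) 1 a
    have he : ∀ t, elem (K := K) (topHom f V) (topHom_w V) 1 a t = t.isLog.unit a := fun t => by
      rw [elem, map_one, one_mul]
    refine ⟨(fam f K V).symm ⟨_, hl⟩, ?_, fun s hs => fam_ext fun t => ?_⟩
    · dsimp only
      rw [← fam_val _ (structureTarget f K), MulEquiv.apply_symm_apply]
      dsimp only
      rw [he]
      exact (structureTarget f K).isLog.val_unit a
    · rw [MulEquiv.apply_symm_apply]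
      dsimp only
      rw [he]
      exact t.isLog.eq_unit ((fam_val s t).trans hs)

/-- The canonical comorphism of the pullback. -/
def pullbackCo : Comorphism f (pullbackLog f K) K where
  map {V U} h w :=
    { toFun := fun m => (fam f K V).symm ⟨elem h w m 1, isLocal_elem h w m 1⟩
      map_one' := fam_ext fun t => by
        rw [MulEquiv.apply_symm_apply, map_one]
        dsimp only
        rw [elem, map_one, t.isLog.unit_one, mul_one]
        rfl
      map_mul' := fun m m' => fam_ext fun t => by
        rw [MulEquiv.apply_symm_apply, map_mul, MulEquiv.apply_symm_apply,
          MulEquiv.apply_symm_apply]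
        change elem h w (m * m') 1 t = elem h w m 1 t * elem h w m' 1 t
        rw [elem, elem, elem, map_mul, t.isLog.unit_one, mul_one, mul_one, mul_one] }
  map_comp_left {V' V U} k h w w' m := fam_ext fun t => by
    rw [fam_res]
    change ((fam f K V') ((fam f K V').symm _)).1 t = t.N.res k (((fam f K V)
        ((fam f K V).symm _)).1 t)
    rw [MulEquiv.apply_symm_apply, MulEquiv.apply_symm_apply]
    dsimp only
    rw [res_elem k h w w' rfl, map_one]
  map_comp_right {V U' U} h k w w' m := fam_ext fun t => by
    change ((fam f K V) ((fam f K V).symm _)).1 t = ((fam f K V) ((fam f K V).symm _)).1 t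
    rw [MulEquiv.apply_symm_apply, MulEquiv.apply_symm_apply]
    exact (elem_res h k w w' rfl m 1 t).symm
  val_map {V U} h w m := by
    rw [← fam_val _ (structureTarget f K)]
    change (structureTarget f K).N.val V (((fam f K V) ((fam f K V).symm _)).1 _) = _
    rw [MulEquiv.apply_symm_apply]
    dsimp only
    rw [elem, PrelogStructure.IsLog.unit_one, mul_one, Comorphism.val_map]

variable {f K} in
lemma PullbackTarget.fam_pullbackCo {V : X.Etale} {U : Y.Etale} (h : V.left ⟶ U.left)
    (w : h ≫ U.hom = V.hom ≫ f) (m : K.sec U) (t : PullbackTarget f K) :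
    (fam f K V ((pullbackCo f K).map h w m)).1 t = t.co.map h w m := by
  change ((fam f K V) ((fam f K V).symm _)).1 t = _
  rw [MulEquiv.apply_symm_apply]
  dsimp only
  rw [elem, t.isLog.unit_one, mul_one]

/-- The pair `(N, d)` is itself one of the targets, and projecting to this coordinate is the
required morphism. It is unique since sections are locally an image from `K` times a unit, and units
have unique lifts. -/
lemma pullbackCo_isStrict : (pullbackCo f K).IsStrict := by
  intro N hN d
  let t : PullbackTarget f K := ⟨N, hN, d⟩
  refine ⟨{ app := fun V => CommMonCat.ofHom
              { toFun := fun s => (fam f K V.unop s).1 t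
                map_one' := congrArg (fun r : localFam f K V.unop => r.1 t)
                  (map_one (fam f K V.unop))
                map_mul' := fun s s' => congrArg (fun r : localFam f K V.unop => r.1 t)
                  (map_mul (fam f K V.unop) s s') }
            naturality := fun V V' k => CommMonCat.hom_ext (MonoidHom.ext fun s =>
              fam_res k.unop s t) }, ⟨?_, fun h w m => fam_pullbackCo h w m t⟩, ?_⟩
  · ext V s
    exact fam_val s t
  · rintro η ⟨hη, hη'⟩
    ext V s
    change (pullbackLog f K).sec V.unop at s
    change (η.app (op V.unop)).hom s = (fam f K V.unop s).1 t
    choose W k y U h w m a hy H using (fam f K V.unop s).2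
    refine hN.gluing.ext k (fun x => ⟨x, y x, hy x⟩) _ _ fun x => ?_
    have hL := pullbackLog_isLog f K
    have e : (pullbackLog f K).res (k x) s =
        (pullbackCo f K).map (h x) (w x) (m x) * hL.unit (a x) := fam_ext fun t => by
      rw [fam_res, H, map_mul]
      change _ = (fam f K (W x) ((pullbackCo f K).map (h x) (w x) (m x))).1 t *
        (fam f K (W x) (hL.unit (a x))).1 t
      rw [fam_pullbackCo, elem]
      exact congrArg (_ * ·) (t.isLog.eq_unit ((fam_val _ t).trans (hL.val_unit _))).symm
    rw [← app_res, e, map_mul, hη']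
    refine Eq.trans ?_ (H x t).symm
    exact congrArg (_ * ·) (hN.eq_unit ((val_app hη _).trans (hL.val_unit _)))

end

end LogGeom
end

noncomputable section

namespace LogGeom

open PrelogStructure Comorphism

/-! ### Indicator functions of open and closed subsets -/

section

variable {U V : Scheme.{u}}

/-- The indicator function of an open and closed subset. -/
def ind (D : U.Opens) (hD : IsClosed (D : Set U)) : Γ(U, ⊤) := extendZero D hD 1

lemma ind_self (D : U.Opens) (hD : IsClosed (D : Set U)) : D.ι.appTop.hom (ind D hD) = 1 :=
  extendZero_self D hD 1

lemma ind_compl (D : U.Opens) (hD : IsClosed (D : Set U)) :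
    (clopenCompl D hD).ι.appTop.hom (ind D hD) = 0 := extendZero_compl D hD 1

lemma ind_mul_self (D : U.Opens) (hD : IsClosed (D : Set U)) : ind D hD * ind D hD = ind D hD :=
  glue_unique D hD (by rw [map_mul, ind_self, one_mul]) (by rw [map_mul, ind_compl, zero_mul])

lemma ind_mul_extendZero (D : U.Opens) (hD : IsClosed (D : Set U)) (a : Γ((D : Scheme.{u}), ⊤)) :
    ind D hD * extendZero D hD a = extendZero D hD a :=
  glue_unique D hD (by rw [map_mul, ind_self, one_mul])
    (by rw [map_mul, ind_compl, zero_mul, extendZero_compl])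

lemma ind_inf (D E : U.Opens) (hD : IsClosed (D : Set U)) (hE : IsClosed (E : Set U))
    (h : IsClosed ((D ⊓ E : U.Opens) : Set U)) : ind (D ⊓ E) h = ind D hD * ind E hE := by
  rw [ind, ind, ind, ← extendZero_mul D E hD hE h, map_one, map_one, one_mul]

lemma ind_top (h) : ind (⊤ : U.Opens) h = 1 := by
  refine glue_unique ⊤ h (by rw [ind_self, map_one]) ?_
  have : IsEmpty (clopenCompl (⊤ : U.Opens) h : Scheme.{u}) := ⟨fun x => x.2 trivial⟩
  exact Subsingleton.elim _ _

lemma ind_preimage (h : V ⟶ U) (D : U.Opens) (hD : IsClosed (D : Set U))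
    (hD' : IsClosed ((h ⁻¹ᵁ D : V.Opens) : Set V)) :
    ind (h ⁻¹ᵁ D) hD' = h.appTop.hom (ind D hD) := by
  rw [ind, ind, ← extendZero_pullback h D hD hD', map_one]

lemma mem_basicOpen_iff_of_ι (D : U.Opens) (a : Γ(U, ⊤)) (x : (D : Scheme.{u})) :
    D.ι x ∈ U.basicOpen a ↔ x ∈ (D : Scheme.{u}).basicOpen (D.ι.appTop.hom a) := by
  rw [← Scheme.preimage_basicOpen_top]
  rfl

lemma basicOpen_ind (D : U.Opens) (hD : IsClosed (D : Set U)) : U.basicOpen (ind D hD) = D := by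
  ext x
  constructor
  · intro hx
    by_contra hx'
    have := (mem_basicOpen_iff_of_ι (clopenCompl D hD) _ ⟨x, hx'⟩).1 hx
    rw [ind_compl, Scheme.basicOpen_zero] at this
    exact this
  · intro hx
    refine (mem_basicOpen_iff_of_ι D _ ⟨x, hx⟩).2 ?_
    rw [ind_self, Scheme.basicOpen_of_isUnit _ isUnit_one]
    trivial

/-- In each local ring one of `e` and `1 - e` is a unit, and not both, since their product is `0`.
-/
lemma basicOpen_compl_of_idem {e : Γ(U, ⊤)} (he : e * e = e) :
    ((U.basicOpen e : U.Opens) : Set U)ᶜ = U.basicOpen (1 - e) := by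
  ext x
  have h₁ : U.basicOpen e ⊓ U.basicOpen (1 - e) = ⊥ := by
    rw [← Scheme.basicOpen_mul, mul_sub, mul_one, he, sub_self, Scheme.basicOpen_zero]
  constructor
  · intro hx
    rw [Set.mem_compl_iff, SetLike.mem_coe, Scheme.mem_basicOpen_top] at hx
    rw [SetLike.mem_coe, Scheme.mem_basicOpen_top, map_sub, map_one]
    exact (IsLocalRing.isUnit_or_isUnit_one_sub_self _).resolve_left hx
  · intro hx hx'
    have : x ∈ U.basicOpen e ⊓ U.basicOpen (1 - e) := ⟨hx', hx⟩
    rw [h₁] at this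
    exact this

lemma isClosed_basicOpen_of_idem {e : Γ(U, ⊤)} (he : e * e = e) :
    IsClosed ((U.basicOpen e : U.Opens) : Set U) := by
  rw [← isOpen_compl_iff, basicOpen_compl_of_idem he]
  exact (U.basicOpen _).isOpen

lemma isUnit_of_basicOpen_ι (D : U.Opens) {a : Γ(U, ⊤)} (h : D ≤ U.basicOpen a) :
    IsUnit (D.ι.appTop.hom a) := by
  refine (D : Scheme.{u}).toRingedSpace.isUnit_of_isUnit_germ ⊤ _ fun x hx => ?_
  exact (Scheme.mem_basicOpen_top _ _ x).1 ((mem_basicOpen_iff_of_ι D a x).1 (h x.2))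

lemma ind_basicOpen {e : Γ(U, ⊤)} (he : e * e = e) (h) : ind (U.basicOpen e) h = e := by
  refine glue_unique _ h ?_ ?_
  · rw [ind_self]
    have h₁ := isUnit_of_basicOpen_ι (U.basicOpen e) (a := e) le_rfl
    exact (h₁.mul_eq_right.1 ((map_mul _ _ _).symm.trans (congrArg _ he))).symm
  · rw [ind_compl]
    have h₁ := isUnit_of_basicOpen_ι (clopenCompl (U.basicOpen e) h) (a := 1 - e)
      (fun x hx => by
        have : x ∈ ((U.basicOpen e : U.Opens) : Set U)ᶜ := hx
        rwa [basicOpen_compl_of_idem he] at this)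
    refine (h₁.mul_right_eq_zero.1 ?_).symm
    rw [← map_mul, sub_mul, one_mul, he, sub_self, map_zero]

end

/-! ### Gluing along an open and closed subset -/

section

variable {X : Scheme.{u}} {V : X.Etale} (D : V.left.Opens) (hD : IsClosed (D : Set V.left))

/-- The two members of a partition into open and closed subsets. -/
def clopenPart (b : ULift.{u} Bool) : V.left.Opens := cond b.down D (clopenCompl D hD)

lemma jointlySurj_clopen : JointlySurj fun b => restrι V (clopenPart D hD b) := by
  intro x
  by_cases hx : x ∈ D
  · exact ⟨⟨true⟩, ⟨x, hx⟩, rfl⟩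
  · exact ⟨⟨false⟩, ⟨x, hx⟩, rfl⟩

variable {D} {B : PrelogStructure X}

namespace PrelogStructure

lemma Gluing.clopen_ext (hB : B.Gluing) (hD : IsClosed (D : Set V.left)) {s t : B.sec V}
    (h₁ : ∀ (W : X.Etale) (k : W ⟶ V), (∀ x, k.left x ∈ D) → B.res k s = B.res k t)
    (h₂ : ∀ (W : X.Etale) (k : W ⟶ V), (∀ x, k.left x ∉ D) → B.res k s = B.res k t) : s = t := by
  refine hB.ext _ (jointlySurj_clopen D hD) _ _ ?_
  rintro ⟨_ | _⟩
  · exact h₂ _ _ (restrι_mem (clopenCompl D hD))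
  · exact h₁ _ _ (restrι_mem D)

lemma Gluing.clopen_glue (hB : B.Gluing) (hD : IsClosed (D : Set V.left)) (s : B.sec (restr V D))
    (t : B.sec (restr V (clopenCompl D hD))) :
    ∃ r : B.sec V, B.res (restrι V D) r = s ∧ B.res (restrι V (clopenCompl D hD)) r = t := by
  obtain ⟨r, hr⟩ := hB.glue _ (jointlySurj_clopen D hD)
    (fun b => match b with
      | ⟨true⟩ => s
      | ⟨false⟩ => t) (by
    have key : ∀ (W : X.Etale) (a : W ⟶ restr V D) (b : W ⟶ restr V (clopenCompl D hD)),
        a ≫ restrι V D = b ≫ restrι V _ → IsEmpty W.left := fun W a b hab => ⟨fun x => by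
      have h₁ := restrι_mem D (a.left x)
      have h₂ := restrι_mem (clopenCompl D hD) (b.left x)
      rw [← comp_left_apply] at h₁ h₂
      rw [hab] at h₁
      exact h₂ h₁⟩
    rintro ⟨_ | _⟩ ⟨_ | _⟩ W a b hab
    · exact congrArg (fun k => B.res k t) (restr_hom_ext hab)
    · exact PSec.sec_subsingleton hB (key W b a hab.symm) _ _
    · exact PSec.sec_subsingleton hB (key W a b hab) _ _
    · exact congrArg (fun k => B.res k s) (restr_hom_ext hab))
  exact ⟨r, hr ⟨true⟩, hr ⟨false⟩⟩

end PrelogStructure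

end

/-! ### The support of a section of `M ∪ {∞}` -/

namespace PrelogStructure

variable {X : Scheme.{u}} (L : PrelogStructure X)

/-- The indicator function of the finite locus together with the value. -/
def PSec.toSupp {L : PrelogStructure X} (U : X.Etale) : L.PSec U →* supported Γ(U.left, ⊤) where
  toFun s := ⟨(ind s.D s.isClosed, PSec.val U s), ind_mul_self _ _, ind_mul_extendZero _ _ _⟩
  map_one' := Subtype.ext (Prod.ext (ind_top _) (map_one (PSec.val U)))
  map_mul' s t := Subtype.ext (Prod.ext (ind_inf s.D t.D _ _ _) (map_mul (PSec.val U) s t))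

/-- The morphism from the sheaf of pointed monoids. -/
def toSupp : L.pointed.M ⟶ (supp X).M where
  app U := CommMonCat.ofHom (PSec.toSupp U.unop)
  naturality U V k := CommMonCat.hom_ext (MonoidHom.ext fun (s : L.PSec U.unop) =>
    Subtype.ext (Prod.ext (ind_preimage k.unop.left s.D s.isClosed _) (PSec.val_res k.unop s)))

lemma toSupp_α : L.toSupp ≫ (supp X).α = L.pointed.α := rfl

end PrelogStructure

/-! ### Extension of comorphisms to `∞` -/

namespace Comorphism

variable {X Y : Scheme.{u}} {f : X ⟶ Y} {L : PrelogStructure X} {K : PrelogStructure Y}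

lemma lift_w {V W : X.Etale} {U : Y.Etale} {D : U.left.Opens} {k : W ⟶ V} {h : V.left ⟶ U.left}
    (w : h ≫ U.hom = V.hom ≫ f) {l : W.left ⟶ (restr U D).left} (hl : l ≫ ιl U D = k.left ≫ h) :
    l ≫ (restr U D).hom = W.hom ≫ f := by
  rw [← ιl_hom, ← Category.assoc, hl, Category.assoc, w, ← Category.assoc, left_w]

lemma exists_lift {V W : X.Etale} {U : Y.Etale} {D : U.left.Opens} (k : W ⟶ V)
    (h : V.left ⟶ U.left) (hk : ∀ x, h (k.left x) ∈ D) :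
    ∃ l : W.left ⟶ (restr U D).left, l ≫ ιl U D = k.left ≫ h :=
  ⟨liftOpen (k.left ≫ h) D fun x => by rw [Scheme.Hom.comp_apply]; exact hk x, liftOpen_ι _ _ _⟩

/-- The finite part of a comorphism of pointed structures. -/
def onSec (c : Comorphism f L.pointed K.pointed) : Comorphism f L.pointed K where
  map {V U} h w :=
    { toFun := fun m => c.map h w (PSec.ofSec m : K.PSec U)
      map_one' := (congrArg (c.map h w) PSec.ofSec_one).trans (map_one (c.map h w))
      map_mul' := fun m m' => (congrArg (c.map h w) (PSec.ofSec_mul m m')).trans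
        (map_mul (c.map h w) _ _) }
  map_comp_left k h w w' m := c.map_comp_left k h w w' _
  map_comp_right {V U' U} h k w w' m := (c.map_comp_right h k w w' _).trans
    (congrArg (c.map h w) (PSec.res_ofSec k m))
  val_map {V U} h w m := (c.val_map h w _).trans (congrArg h.appTop.hom (PSec.val_ofSec m))

lemma onSec_map (c : Comorphism f L.pointed K.pointed) {V : X.Etale} {U : Y.Etale}
    (h : V.left ⟶ U.left) (w : h ≫ U.hom = V.hom ≫ f) (m : K.sec U) :
    c.onSec.map h w m = c.map h w (PSec.ofSec m : K.PSec U) := rfl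

/-- The comorphism preserves `∞`. -/
def PreservesInfty (c : Comorphism f L.pointed K.pointed) : Prop :=
  ∀ {V : X.Etale} {U : Y.Etale} (h : V.left ⟶ U.left) (w : h ≫ U.hom = V.hom ≫ f),
    c.map h w (PSec.infty U) = PSec.infty V

lemma res_map_of_mem (c : Comorphism f L.pointed K.pointed) {V W : X.Etale} {U : Y.Etale}
    {h : V.left ⟶ U.left} (w : h ≫ U.hom = V.hom ≫ f) (s : K.PSec U) (k : W ⟶ V)
    (l : W.left ⟶ (restr U s.D).left) (hl : l ≫ ιl U s.D = k.left ≫ h) :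
    PSec.res k (c.map h w s) = c.onSec.map l (lift_w w hl) s.m := by
  have w' : (k.left ≫ h) ≫ U.hom = W.hom ≫ f := by rw [Category.assoc, w, ← Category.assoc, left_w]
  refine (c.res_map k w w' rfl s).trans ?_
  rw [onSec_map, ← PSec.res_restrι]
  exact (c.map_res (restrι U s.D) (lift_w w hl) w' hl s).symm

lemma PreservesInfty.res_map_of_notMem {c : Comorphism f L.pointed K.pointed}
    (hc : c.PreservesInfty) (hK : K.Gluing) {V W : X.Etale} {U : Y.Etale}
    {h : V.left ⟶ U.left} (w : h ≫ U.hom = V.hom ≫ f) (s : K.PSec U) (k : W ⟶ V)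
    (hk : ∀ x, h (k.left x) ∉ s.D) : PSec.res k (c.map h w s) = PSec.infty W := by
  have w' : (k.left ≫ h) ≫ U.hom = W.hom ≫ f := by rw [Category.assoc, w, ← Category.assoc, left_w]
  obtain ⟨l, hl⟩ := exists_lift (D := clopenCompl s.D s.isClosed) k h hk
  refine (c.res_map k w w' rfl s).trans ?_
  refine (c.map_res (restrι U (clopenCompl s.D s.isClosed)) (lift_w w hl) w' hl s).symm.trans ?_
  rw [← hc l (lift_w w hl)]
  exact congrArg (c.map l (lift_w w hl)) (PSec.eq_infty hK fun x => restrι_mem _ x)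

/-- Over the preimage of the finite locus of `s` the image is that of a section of `K`; over its
complement it is `∞`. So the finite part determines everything. -/
lemma PreservesInfty.ext {c c' : Comorphism f L.pointed K.pointed} (hc : c.PreservesInfty)
    (hc' : c'.PreservesInfty) (hL : L.Gluing) (hK : K.Gluing) (h : c.onSec = c'.onSec) :
    c = c' := by
  refine map_ext fun {V U} a w (s : K.PSec U) => ?_
  have hD : IsClosed ((a ⁻¹ᵁ s.D : V.left.Opens) : Set V.left) := s.isClosed.preimage a.continuous
  refine (pointed_gluing hL).clopen_ext hD (fun W k hk => ?_) fun W k hk => ?_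
  · obtain ⟨l, hl⟩ := exists_lift k a hk
    exact (c.res_map_of_mem w s k l hl).trans ((congrArg (fun d : Comorphism f L.pointed K =>
      d.map l (lift_w w hl) s.m) h).trans (c'.res_map_of_mem w s k l hl).symm)
  · exact (hc.res_map_of_notMem hK w s k hk).trans (hc'.res_map_of_notMem hK w s k hk).symm

section

variable (hL : L.Gluing) (c : Comorphism f L.pointed K)

include hL in
-- The prescribed values on the preimage of the finite locus of `s` and on its complement glue, as
-- these form an open and closed partition.
lemma exists_extend {V : X.Etale} {U : Y.Etale} (h : V.left ⟶ U.left)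
    (w : h ≫ U.hom = V.hom ≫ f) (s : K.PSec U) :
    ∃ r : L.PSec V, (∀ (W : X.Etale) (k : W ⟶ V) (l : W.left ⟶ (restr U s.D).left)
      (hl : l ≫ ιl U s.D = k.left ≫ h), PSec.res k r = c.map l (lift_w w hl) s.m) ∧
      ∀ (W : X.Etale) (k : W ⟶ V), (∀ x, h (k.left x) ∉ s.D) → PSec.res k r = PSec.infty W := by
  have hD : IsClosed ((h ⁻¹ᵁ s.D : V.left.Opens) : Set V.left) := s.isClosed.preimage h.continuous
  obtain ⟨r, h₁, h₂⟩ := (pointed_gluing hL).clopen_glue hD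
    (c.map (resOver h s.D _ le_rfl) (resOver_w h w _ _ _) s.m) (PSec.infty _ : L.PSec _)
  refine ⟨r, fun W k l hl => ?_, fun W k hk => ?_⟩
  · have hk : ∀ x, k.left x ∈ h ⁻¹ᵁ s.D := fun x => by
      change h (k.left x) ∈ s.D
      rw [← Scheme.Hom.comp_apply, ← hl, Scheme.Hom.comp_apply]
      exact (l x).2
    have e := toRestr_ι k _ hk
    have h₃ : L.pointed.res k r = L.pointed.res (toRestr k _ hk) (L.pointed.res (restrι V _) r) :=
        by
      rw [L.pointed.res_res, e]
    refine h₃.trans ?_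
    rw [h₁]
    refine c.res_map _ _ _ (restr_left_ext ?_) s.m
    rw [Category.assoc, resOver_ιl, hl, ← Category.assoc]
    exact congrArg (· ≫ h) (congrArg (fun t : W ⟶ V => t.left) e)
  · have hk : ∀ x, k.left x ∈ clopenCompl (h ⁻¹ᵁ s.D) hD := hk
    have e := toRestr_ι k _ hk
    have h₃ : L.pointed.res k r = L.pointed.res (toRestr k _ hk) (L.pointed.res (restrι V _) r) :=
        by
      rw [L.pointed.res_res, e]
    refine h₃.trans ?_
    rw [h₂]
    exact PSec.res_infty _

/-- The extension of a comorphism by `∞ ↦ ∞`, on sections. -/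
def extendMap {V : X.Etale} {U : Y.Etale} (h : V.left ⟶ U.left)
    (w : h ≫ U.hom = V.hom ≫ f) (s : K.PSec U) : L.PSec V :=
  (exists_extend hL c h w s).choose

lemma res_extendMap {V W : X.Etale} {U : Y.Etale} {h : V.left ⟶ U.left}
    (w : h ≫ U.hom = V.hom ≫ f) (s : K.PSec U) (k : W ⟶ V) (l : W.left ⟶ (restr U s.D).left)
    (hl : l ≫ ιl U s.D = k.left ≫ h) :
    PSec.res k (extendMap hL c h w s) = c.map l (lift_w w hl) s.m :=
  (exists_extend hL c h w s).choose_spec.1 W k l hl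

lemma res_extendMap' {V W : X.Etale} {U : Y.Etale} {h : V.left ⟶ U.left}
    (w : h ≫ U.hom = V.hom ≫ f) (s : K.PSec U) (k : W ⟶ V) (hk : ∀ x, h (k.left x) ∉ s.D) :
    PSec.res k (extendMap hL c h w s) = PSec.infty W :=
  (exists_extend hL c h w s).choose_spec.2 W k hk

lemma eq_extendMap {V : X.Etale} {U : Y.Etale} {h : V.left ⟶ U.left}
    (w : h ≫ U.hom = V.hom ≫ f) (s : K.PSec U) {r : L.PSec V}
    (h₁ : ∀ (W : X.Etale) (k : W ⟶ V) (l : W.left ⟶ (restr U s.D).left)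
      (hl : l ≫ ιl U s.D = k.left ≫ h), PSec.res k r = c.map l (lift_w w hl) s.m)
    (h₂ : ∀ (W : X.Etale) (k : W ⟶ V), (∀ x, h (k.left x) ∉ s.D) →
      PSec.res k r = PSec.infty W) : r = extendMap hL c h w s := by
  have hD : IsClosed ((h ⁻¹ᵁ s.D : V.left.Opens) : Set V.left) := s.isClosed.preimage h.continuous
  refine (pointed_gluing hL).clopen_ext hD (fun W k hk => ?_) fun W k hk => ?_
  · obtain ⟨l, hl⟩ := exists_lift k h hk
    exact (h₁ W k l hl).trans (res_extendMap hL c w s k l hl).symm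
  · exact (h₂ W k hk).trans (res_extendMap' hL c w s k hk).symm

lemma extendMap_ofSec {V : X.Etale} {U : Y.Etale} (h : V.left ⟶ U.left)
    (w : h ≫ U.hom = V.hom ≫ f) (m : K.sec U) :
    extendMap hL c h w (PSec.ofSec m) = c.map h w m := by
  refine (eq_extendMap hL c w (PSec.ofSec m) (fun W k l hl => ?_) fun W k hk => ?_).symm
  · have w' : (k.left ≫ h) ≫ U.hom = W.hom ≫ f := by
      rw [Category.assoc, w, ← Category.assoc, left_w]
    exact (c.res_map k w w' rfl m).trans (c.map_res (restrι U ⊤) (lift_w w hl) w' hl m).symm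
  · exact PSec.eq_infty hL fun x _ => hk x trivial

lemma extendMap_infty {V : X.Etale} {U : Y.Etale} (h : V.left ⟶ U.left)
    (w : h ≫ U.hom = V.hom ≫ f) : extendMap hL c h w (PSec.infty U) = PSec.infty V := by
  refine (eq_extendMap hL c w (PSec.infty U) (fun W k l hl => ?_) fun W k hk => ?_).symm
  · have : IsEmpty W.left := ⟨fun x => (l x).2⟩
    exact PSec.sec_subsingleton (pointed_gluing hL) this _ _
  · exact PSec.res_infty k

lemma extendMap_mul {V : X.Etale} {U : Y.Etale} (h : V.left ⟶ U.left)
    (w : h ≫ U.hom = V.hom ≫ f) (s t : K.PSec U) :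
    extendMap hL c h w (s * t) = extendMap hL c h w s * extendMap hL c h w t := by
  refine (eq_extendMap hL c w (s * t) (fun W k l hl => ?_) fun W k hk => ?_).symm
  · rw [map_mul]
    have hs : (l ≫ (restrLE U inf_le_left).left) ≫ ιl U s.D = k.left ≫ h := by
      rw [Category.assoc, restrLE_ιl]; exact hl
    have ht : (l ≫ (restrLE U inf_le_right).left) ≫ ιl U t.D = k.left ≫ h := by
      rw [Category.assoc, restrLE_ιl]; exact hl
    rw [res_extendMap hL c w s k _ hs, res_extendMap hL c w t k _ ht]
    refine Eq.trans ?_ (map_mul (c.map l (lift_w w hl)) _ _).symm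
    exact congrArg₂ (· * ·) (c.map_res _ (lift_w w hl) _ rfl s.m).symm
      (c.map_res _ (lift_w w hl) _ rfl t.m).symm
  · have hD : IsClosed ((k.left ⁻¹ᵁ h ⁻¹ᵁ s.D : W.left.Opens) : Set W.left) :=
      (s.isClosed.preimage h.continuous).preimage k.left.continuous
    refine (pointed_gluing hL).clopen_ext hD (fun W' k' hk' => ?_) fun W' k' hk' => ?_
    · change PSec.res k' (PSec.res k _) = PSec.res k' (PSec.infty W)
      rw [PSec.res_infty, ← PSec.res_comp, map_mul]
      have : PSec.res (k' ≫ k) (extendMap hL c h w t) = PSec.infty W' :=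
        res_extendMap' hL c w t _ fun x hx => by
          rw [comp_left_apply] at hx
          exact hk _ ⟨hk' x, hx⟩
      rw [this, PSec.mul_infty hL]
    · change PSec.res k' (PSec.res k _) = PSec.res k' (PSec.infty W)
      rw [PSec.res_infty, ← PSec.res_comp, map_mul]
      have : PSec.res (k' ≫ k) (extendMap hL c h w s) = PSec.infty W' :=
        res_extendMap' hL c w s _ fun x hx => by
          rw [comp_left_apply] at hx
          exact hk' x hx
      rw [this, PSec.infty_mul hL]

/-- The extension of a comorphism by `∞ ↦ ∞`. -/
def extend : Comorphism f L.pointed K.pointed where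
  map {V U} h w :=
    { toFun := fun s => extendMap hL c h w s
      map_one' := (congrArg (extendMap hL c h w) PSec.ofSec_one.symm).trans
        ((extendMap_ofSec hL c h w 1).trans (map_one (c.map h w)))
      map_mul' := fun s t => extendMap_mul hL c h w s t }
  map_comp_left {V' V U} k h w w' (s : K.PSec U) :=
    (eq_extendMap hL c w' s (r := PSec.res k (extendMap hL c h w s))
      (fun W k' l hl => by
        rw [← PSec.res_comp]
        exact res_extendMap hL c w s _ l (by rw [hl, comp_left, Category.assoc]))
      (fun W k' hk => by
        rw [← PSec.res_comp]
        refine res_extendMap' hL c w s _ fun x hx => ?_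
        rw [comp_left_apply] at hx
        refine hk x ?_
        rwa [Scheme.Hom.comp_apply])).symm
  map_comp_right {V U' U} h k w w' (s : K.PSec U) :=
    eq_extendMap hL c w (PSec.res k s) (r := extendMap hL c (h ≫ k.left) w' s)
      (fun W k' l hl => by
        have hl' : (l ≫ (restrHom k s.D _ le_rfl).left) ≫ ιl U s.D = k'.left ≫ h ≫ k.left := by
          refine (Category.assoc _ _ _).trans ((congrArg (l ≫ ·) (restrHom_ιl k s.D _
            le_rfl)).trans ?_)
          exact (Category.assoc _ _ _).symm.trans ((congrArg (· ≫ k.left) hl).trans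
            (Category.assoc _ _ _))
        rw [res_extendMap hL c w' s k' _ hl']
        exact (c.map_res _ (lift_w w hl) _ rfl s.m).symm)
      (fun W k' hk => res_extendMap' hL c w' s k' fun x hx => hk x (by
        rwa [Scheme.Hom.comp_apply] at hx))
  val_map {V U} h w (s : K.PSec U) := by
    have hD : IsClosed ((h ⁻¹ᵁ s.D : V.left.Opens) : Set V.left) :=
      s.isClosed.preimage h.continuous
    refine (ofStructure_isLog X).gluing.clopen_ext hD (fun W k hk => ?_) fun W k hk => ?_
    · obtain ⟨l, hl⟩ := exists_lift k h hk
      refine (PSec.val_res k (extendMap hL c h w s)).symm.trans ?_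
      rw [res_extendMap hL c w s k l hl]
      refine (c.val_map l (lift_w w hl) s.m).trans ?_
      have h₁ : (ιl U s.D).appTop.hom (PSec.val U s) = K.val _ s.m := extendZero_self _ _ _
      rw [← h₁, ← appTop_comp_apply, hl]
      exact appTop_comp_apply _ _ _
    · refine (PSec.val_res k (extendMap hL c h w s)).symm.trans ?_
      rw [res_extendMap' hL c w s k hk, PSec.val_infty]
      obtain ⟨l, hl⟩ := exists_lift (D := clopenCompl s.D s.isClosed) k h hk
      have h₁ : (ιl U (clopenCompl s.D s.isClosed)).appTop.hom (PSec.val U s) = 0 :=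
        extendZero_compl _ _ _
      have h₂ := appTop_comp_apply k.left h (PSec.val U s)
      rw [← hl, appTop_comp_apply, h₁, map_zero] at h₂
      exact h₂

lemma extend_preservesInfty : (extend hL c).PreservesInfty := fun h w => extendMap_infty hL c h w

/-- With `PreservesInfty.ext`, this identifies pointed morphisms with comorphisms from `K` to `M ∪
{∞}`. The latter form has no condition at `∞` and is the one to which charts and pullbacks apply. -/
lemma extend_onSec : (extend hL c).onSec = c := map_ext fun h w m => extendMap_ofSec hL c h w m

end

end Comorphism

end LogGeom
end

noncomputable section

namespace LogGeom

open PrelogStructure Comorphism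

/-! ### The finite part of a log structure -/

namespace PrelogStructure

variable {X : Scheme.{u}} {P : PrelogStructure X} (ε : P.M ⟶ (supp X).M)

/-- The indicator function of the finite locus of a section. -/
def fin {U : X.Etale} (s : P.sec U) : Γ(U.left, ⊤) :=
  ((ε.app (op U)).hom s : supported Γ(U.left, ⊤)).1.1

lemma fin_one {U : X.Etale} : fin ε (1 : P.sec U) = 1 :=
  congrArg (fun t : supported Γ(U.left, ⊤) => t.1.1) (map_one (ε.app (op U)).hom)

lemma fin_mul {U : X.Etale} (s t : P.sec U) : fin ε (s * t) = fin ε s * fin ε t :=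
  congrArg (fun t : supported Γ(U.left, ⊤) => t.1.1) (map_mul (ε.app (op U)).hom s t)

lemma fin_res {V U : X.Etale} (k : V ⟶ U) (s : P.sec U) :
    fin ε (P.res k s) = k.left.appTop.hom (fin ε s) :=
  congrArg (fun t : supported Γ(V.left, ⊤) => t.1.1) (app_res (N := supp X) ε k s)

lemma fin_idem {U : X.Etale} (s : P.sec U) : fin ε s * fin ε s = fin ε s :=
  ((ε.app (op U)).hom s : supported Γ(U.left, ⊤)).2.1

/-- The submonoid of everywhere finite sections. -/
def finSec (U : X.Etale) : Submonoid (P.sec U) where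
  carrier := {s | fin ε s = 1}
  one_mem' := fin_one ε
  mul_mem' {s t} hs ht := (fin_mul ε s t).trans (by
    rw [show fin ε s = 1 from hs, show fin ε t = 1 from ht, one_mul])

/-- Restriction. -/
def finRes {V U : X.Etale} (k : V ⟶ U) : finSec ε U →* finSec ε V where
  toFun s := ⟨P.res k s.1, (fin_res ε k s.1).trans (by
    rw [show fin ε s.1 = 1 from s.2, map_one])⟩
  map_one' := Subtype.ext (map_one _)
  map_mul' _ _ := Subtype.ext (map_mul _ _ _)

/-- The log structure of finite sections. -/
def finitePart : PrelogStructure X where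
  M :=
    { obj := fun U => CommMonCat.of (finSec ε U.unop)
      map := fun k => CommMonCat.ofHom (finRes ε k.unop)
      map_id := fun U => CommMonCat.hom_ext (MonoidHom.ext fun s => Subtype.ext (P.res_id _ s.1))
      map_comp := fun k l => CommMonCat.hom_ext (MonoidHom.ext fun s =>
        Subtype.ext (P.res_res l.unop k.unop s.1).symm) }
  α :=
    { app := fun U => CommMonCat.ofHom ((P.val U.unop).comp (finSec ε U.unop).subtype)
      naturality := fun _ _ k => CommMonCat.hom_ext (MonoidHom.ext fun s => P.val_res k.unop s.1) }

/-- The underlying section. -/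
def ofFinite {U : X.Etale} : (finitePart ε).sec U →* P.sec U := (finSec ε U).subtype

lemma fin_ofFinite {U : X.Etale} (s : (finitePart ε).sec U) : fin ε (ofFinite ε s) = 1 := s.2

/-- A finite section. -/
def mkFinite {U : X.Etale} (s : P.sec U) (h : fin ε s = 1) : (finitePart ε).sec U := ⟨s, h⟩

lemma finitePart_ext {U : X.Etale} {s t : (finitePart ε).sec U}
    (h : ofFinite ε s = ofFinite ε t) : s = t := Subtype.ext h

lemma ofFinite_res {V U : X.Etale} (k : V ⟶ U) (s : (finitePart ε).sec U) :
    ofFinite ε ((finitePart ε).res k s) = P.res k (ofFinite ε s) := rfl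

variable {ε}

lemma fin_eq_one_of_isUnit (hε : ε ≫ (supp X).α = P.α) {U : X.Etale} {s : P.sec U}
    (h : IsUnit (P.val U s)) : fin ε s = 1 := by
  have h₁ : fin ε s * P.val U s = P.val U s := by
    rw [← val_app hε]
    exact ((ε.app (op U)).hom s : supported Γ(U.left, ⊤)).2.2
  exact h.mul_eq_right.1 h₁

/-- Being finite everywhere is a local condition, and sections with invertible value satisfy it, so
the unique lifts of units remain available. -/
lemma finitePart_isLog (hP : P.IsLog) (hε : ε ≫ (supp X).α = P.α) : (finitePart ε).IsLog := by
  refine Gluing.isLog ⟨?_, ?_⟩ ?_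
  · intro U ι V k hk s t h
    refine finitePart_ext ε (hP.gluing.ext k hk _ _ fun i => ?_)
    rw [← ofFinite_res, h, ofFinite_res]
  · intro U ι V k hk x hx
    obtain ⟨s, hs⟩ := hP.gluing.glue k hk (fun i => ofFinite ε (x i)) fun i j W a b hab => by
      rw [← ofFinite_res, hx i j W a b hab, ofFinite_res]
    refine ⟨mkFinite ε s (hk.ext_fun fun i => ?_), fun i => finitePart_ext ε (hs i)⟩
    rw [← fin_res, hs, fin_ofFinite, map_one]
  · intro U a ha
    obtain ⟨m, rfl, hm⟩ := hP.existsUnique_val_eq U a ha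
    exact ⟨mkFinite ε m (fin_eq_one_of_isUnit hε ha), rfl, fun s hs =>
      finitePart_ext ε (hm _ hs)⟩

lemma res_fin_basicOpen {U : X.Etale} (s : P.sec U) :
    fin ε (P.res (restrι U (U.left.basicOpen (fin ε s))) s) = 1 := by
  have h₁ : (U.left.basicOpen (fin ε s)).ι.appTop.hom (fin ε s) = 1 := by
    have h₁ := isUnit_of_basicOpen_ι (U.left.basicOpen (fin ε s)) (a := fin ε s) le_rfl
    exact h₁.mul_eq_right.1 ((map_mul _ _ _).symm.trans (congrArg _ (fin_idem ε s)))
  exact (fin_res ε _ s).trans h₁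

variable (ε) in
/-- A section as a section of `M ∪ {∞}`, where `M` is the finite part. -/
def splitSec {U : X.Etale} (s : P.sec U) : (finitePart ε).PSec U :=
  ⟨U.left.basicOpen (fin ε s), isClosed_basicOpen_of_idem (fin_idem ε s),
    mkFinite ε (P.res (restrι U _) s) (res_fin_basicOpen s)⟩

lemma eq_splitSec {U : X.Etale} {s : P.sec U} {t : (finitePart ε).PSec U}
    (hD : t.D = U.left.basicOpen (fin ε s)) (hm : ofFinite ε t.m = P.res (restrι U t.D) s) :
    splitSec ε s = t := by
  obtain ⟨D, hDc, m⟩ := t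
  dsimp only at hD hm
  subst hD
  exact congrArg (PSec.mk _ _) (finitePart_ext ε hm.symm)

lemma basicOpen_fin_eq_top {U : X.Etale} {s : P.sec U} (h : fin ε s = 1) :
    U.left.basicOpen (fin ε s) = ⊤ := by
  rw [h]
  exact Scheme.basicOpen_of_isUnit _ isUnit_one

lemma splitSec_ofFinite {U : X.Etale} (s : (finitePart ε).sec U) :
    splitSec ε (ofFinite ε s) = PSec.ofSec s :=
  eq_splitSec (basicOpen_fin_eq_top (fin_ofFinite ε s)).symm rfl

lemma splitSec_mul {U : X.Etale} (s t : P.sec U) :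
    splitSec ε (s * t) = splitSec ε s * splitSec ε t := by
  refine eq_splitSec ?_ ?_
  · rw [fin_mul, Scheme.basicOpen_mul]
    rfl
  · rw [PSec.mul_m, map_mul, ofFinite_res, ofFinite_res, map_mul]
    exact congrArg₂ (· * ·) ((P.res_res _ _ _).trans (congrArg (P.res · s) (restrLE_ι U _)))
      ((P.res_res _ _ _).trans (congrArg (P.res · t) (restrLE_ι U _)))

lemma splitSec_res {V U : X.Etale} (k : V ⟶ U) (s : P.sec U) :
    splitSec ε (P.res k s) = PSec.res k (splitSec ε s) := by
  refine eq_splitSec ?_ ?_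
  · rw [fin_res, ← Scheme.preimage_basicOpen_top]
    rfl
  · exact (P.res_res _ _ _).trans ((congrArg (P.res · s) (restrHom_ι k _ _ le_rfl)).trans
      (P.res_res _ _ _).symm)

/-- Setting the section to `∞` off its finite locus does not change its value: `fin ε s` annihilates
nothing of `P.val U s`, so that value already vanishes there. -/
lemma splitSec_val (hε : ε ≫ (supp X).α = P.α) {U : X.Etale} (s : P.sec U) :
    PSec.val U (splitSec ε s) = P.val U s := by
  refine glue_unique (U.left.basicOpen (fin ε s)) (isClosed_basicOpen_of_idem (fin_idem ε s))
    ((extendZero_self _ _ _).trans (P.val_res _ s)) ((extendZero_compl _ _ _).trans ?_)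
  have h₁ : fin ε s * P.val U s = P.val U s := by
    rw [← val_app hε]
    exact ((ε.app (op U)).hom s : supported Γ(U.left, ⊤)).2.2
  have h₂ := ind_compl _ (isClosed_basicOpen_of_idem (fin_idem ε s))
  rw [ind_basicOpen (fin_idem ε s)] at h₂
  rw [← h₁, map_mul, h₂, zero_mul]

variable (ε) in
/-- The morphism to the pointed finite part. -/
def split : P.M ⟶ (finitePart ε).pointed.M where
  app U := CommMonCat.ofHom
    { toFun := fun s => splitSec ε s
      map_one' := (congrArg (splitSec ε) (map_one (ofFinite ε)).symm).trans
        ((splitSec_ofFinite 1).trans PSec.ofSec_one)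
      map_mul' := fun s t => splitSec_mul s t }
  naturality _ _ k := CommMonCat.hom_ext (MonoidHom.ext fun s => splitSec_res k.unop s)

lemma split_α (hε : ε ≫ (supp X).α = P.α) : split ε ≫ (finitePart ε).pointed.α = P.α := by
  ext U s
  exact splitSec_val hε s

end PrelogStructure

/-! ### The universal log structure over a point of the functor of supports -/

namespace Comorphism

section

variable {X Y : Scheme.{u}} {f : X ⟶ Y} {L L' : PrelogStructure X} {K K' : PrelogStructure Y}

/-- Precomposition of a comorphism with a morphism over the structure sheaf. -/
def pre (c : Comorphism f L K') (η : K.M ⟶ K'.M) (hη : η ≫ K'.α = K.α) : Comorphism f L K where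
  map {V U} h w := (c.map h w).comp (η.app (op U)).hom
  map_comp_left k h w w' m := c.map_comp_left k h w w' _
  map_comp_right {V U' U} h k w w' m := (c.map_comp_right h k w w' _).trans
    (congrArg (c.map h w) (app_res η k m).symm)
  val_map {V U} h w m := (c.val_map h w _).trans (congrArg h.appTop.hom (val_app hη m))

/-- The functoriality of the log structure of supports. -/
def suppCo (f : X ⟶ Y) : Comorphism f (supp X) (supp Y) where
  map {V U} h w := supportedMap h.appTop.hom
  map_comp_left k h w w' m := Subtype.ext (Prod.ext (appTop_comp_apply k.left h _)
    (appTop_comp_apply k.left h _))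
  map_comp_right h k w w' m := Subtype.ext (Prod.ext (appTop_comp_apply h k.left _)
    (appTop_comp_apply h k.left _))
  val_map h w m := rfl

/-- The support of a comorphism of pointed structures. -/
def support (c : Comorphism f L.pointed K) : Comorphism f (supp X) K := c.post L.toSupp L.toSupp_α

lemma pointed_ofSec (c : Comorphism f L K) {V : X.Etale} {U : Y.Etale} (h : V.left ⟶ U.left)
    (w : h ≫ U.hom = V.hom ≫ f) (m : K.sec U) :
    c.pointed.map h w (PSec.ofSec m) = PSec.ofSec (c.map h w m) := by
  refine c.pmap_eq (w := w) rfl ?_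
  have w' : (restrι V ⊤).left ≫ h ≫ U.hom = (restr V ⊤).hom ≫ f := by
    rw [w, ← Category.assoc, left_w]
  refine (c.res_map (restrι V ⊤) w (h' := (restrι V ⊤).left ≫ h) ((Category.assoc _ _ _).trans w')
    rfl m).trans ?_
  exact (c.map_res (restrι U ⊤) (resOver_w h w _ _ _) _ (resOver_ιl h _ _ _) m).symm

end

variable {E T Y : Scheme.{u}} {φ : E ⟶ Y} {K : PrelogStructure Y}
  (ξ : Comorphism φ (supp E) K)

lemma exists_pullback_supp : ∃ ε : (pullbackLog φ K).M ⟶ (supp E).M,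
    ε ≫ (supp E).α = (pullbackLog φ K).α ∧
      ∀ {V : E.Etale} {U : Y.Etale} (h : V.left ⟶ U.left) (w : h ≫ U.hom = V.hom ≫ φ)
        (m : K.sec U), (ε.app (op V)).hom ((pullbackCo φ K).map h w m) = ξ.map h w m :=
  (pullbackCo_isStrict φ K (supp E) (supp_isLog E) ξ).exists

/-- The morphism from the pullback of `K` corresponding to `ξ`. -/
def toSuppHom : (pullbackLog φ K).M ⟶ (supp E).M := (exists_pullback_supp ξ).choose

lemma toSuppHom_α : ξ.toSuppHom ≫ (supp E).α = (pullbackLog φ K).α :=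
  (exists_pullback_supp ξ).choose_spec.1

lemma toSuppHom_map {V : E.Etale} {U : Y.Etale} (h : V.left ⟶ U.left)
    (w : h ≫ U.hom = V.hom ≫ φ) (m : K.sec U) :
    (ξ.toSuppHom.app (op V)).hom ((pullbackCo φ K).map h w m) = ξ.map h w m :=
  (exists_pullback_supp ξ).choose_spec.2 h w m

/-- The universal log structure: the finite part of the pullback. -/
def univLog : PrelogStructure E := finitePart ξ.toSuppHom

lemma univLog_isLog : ξ.univLog.IsLog := finitePart_isLog (pullbackLog_isLog φ K) ξ.toSuppHom_α

/-- The universal comorphism. -/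
def univCo : Comorphism φ ξ.univLog.pointed K :=
  (pullbackCo φ K).post (split ξ.toSuppHom) (split_α ξ.toSuppHom_α)

/-- The first coordinate is read off from the finite locus of `splitSec`; the second is forced, as
both comorphisms lie over the structure sheaf. -/
lemma univCo_support : ξ.univCo.support = ξ := by
  refine map_ext fun {V U} h w m => ?_
  refine Subtype.ext (Prod.ext ?_ ?_)
  · have h₁ : (ξ.univCo.map h w m : ξ.univLog.PSec V) =
      splitSec ξ.toSuppHom ((pullbackCo φ K).map h w m) := rfl
    have h₂ : fin ξ.toSuppHom ((pullbackCo φ K).map h w m) =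
      (ξ.map h w m : supported Γ(V.left, ⊤)).1.1 :=
      congrArg (fun t : supported Γ(V.left, ⊤) => t.1.1) (ξ.toSuppHom_map h w m)
    exact (ind_basicOpen (fin_idem _ _) _).trans h₂
  · exact (ξ.univCo.support.val_map h w m).trans (ξ.val_map h w m).symm

lemma Factors.post {e : T ⟶ E} {g : T ⟶ Y} {N N' : PrelogStructure T} {L : PrelogStructure E}
    {a : Comorphism e N L} {b : Comorphism φ L K} {c : Comorphism g N K} (H : Factors a b c)
    (η : N.M ⟶ N'.M) (hη : η ≫ N'.α = N.α) : Factors (a.post η hη) b (c.post η hη) :=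
  ⟨fun {V W U} h k w₁ w₂ w₃ m => congrArg (η.app (op V)).hom (H.eq h k w₁ w₂ w₃ m)⟩

variable {ξ} in
-- Since the pullback of `K` is cartesian, `c` factors through a comorphism `d'` from it to `N ∪
-- {∞}`. Agreement of supports says that the finite locus of `d' s` is the preimage of that of `s`;
-- hence finite sections land in `N`, and this restriction is the lift.
theorem existsUnique_lift {h : T ⟶ E} {g : T ⟶ Y} (hg : h ≫ φ = g) {N : PrelogStructure T}
    (hN : N.IsLog) (c : Comorphism g N.pointed K) (H : Factors (suppCo h) ξ c.support) :
    ∃! d : Comorphism h N ξ.univLog, Factors d.pointed ξ.univCo c := by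
  have hcart : (pullbackCo φ K).IsCart := (pullbackCo_isStrict φ K).isCart
  obtain ⟨d', hd', hu⟩ := hcart hg (pointed_isLog hN) c
  -- Two comorphisms out of the pullback agree as soon as they agree on sections coming from `K`;
  -- there the claim is the hypothesis `H`.
  have key : d'.support = (suppCo h).pre ξ.toSuppHom ξ.toSuppHom_α := by
    refine (hcart hg (supp_isLog T) c.support).unique (hd'.post _ _) ⟨?_⟩
    intro V W U a k w₁ w₂ w₃ m
    refine Eq.trans ?_ (H.eq a k w₁ w₂ w₃ m)
    exact congrArg ((suppCo h).map a w₁) (ξ.toSuppHom_map k w₂ m)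
  have hfin : ∀ {V : T.Etale} {W : E.Etale} (a : V.left ⟶ W.left) (w : a ≫ W.hom = V.hom ≫ h)
      (s : (pullbackLog φ K).sec W), (d'.map a w s : N.PSec V).D =
        a ⁻¹ᵁ (W.left.basicOpen (fin ξ.toSuppHom s)) := by
    intro V W a w s
    have h₁ : ind (d'.map a w s : N.PSec V).D (d'.map a w s : N.PSec V).isClosed =
        a.appTop.hom (fin ξ.toSuppHom s) :=
      congrArg (fun c : Comorphism h (supp T) (pullbackLog φ K) =>
        (c.map a w s : supported Γ(V.left, ⊤)).1.1) key
    rw [← basicOpen_ind _ (d'.map a w s : N.PSec V).isClosed, h₁, Scheme.preimage_basicOpen_top]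
  have hex : ∀ {V : T.Etale} {W : E.Etale} (a : V.left ⟶ W.left) (w : a ≫ W.hom = V.hom ≫ h)
      (s : ξ.univLog.sec W), ∃ n : N.sec V,
        PSec.ofSec n = d'.map a w (ofFinite ξ.toSuppHom s) := by
    intro V W a w s
    refine ⟨_, (PSec.eq_ofSec fun x => ?_).symm⟩
    have h₂ := basicOpen_fin_eq_top (fin_ofFinite ξ.toSuppHom s)
    rw [hfin, h₂]
    trivial
  choose dm hdm using @hex
  let d : Comorphism h N ξ.univLog :=
    { map := fun {V W} a w =>
        { toFun := dm a w
          map_one' := PSec.ofSec_injective ((hdm a w 1).trans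
            ((map_one ((d'.map a w).comp (ofFinite ξ.toSuppHom))).trans PSec.ofSec_one.symm))
          map_mul' := fun s t => PSec.ofSec_injective ((hdm a w _).trans
            ((map_mul ((d'.map a w).comp (ofFinite ξ.toSuppHom)) s t).trans
              ((congrArg₂ (· * ·) (hdm a w s).symm (hdm a w t).symm).trans
                (PSec.ofSec_mul _ _).symm))) }
      map_comp_left := fun {V' V W} k a w w' s => PSec.ofSec_injective ((hdm _ w' s).trans
        ((d'.map_comp_left k a w w' _).trans ((congrArg (PSec.res k) (hdm a w s).symm).trans
          (PSec.res_ofSec k _))))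
      map_comp_right := fun {V W' W} a k w w' s => PSec.ofSec_injective ((hdm _ w' s).trans
        ((d'.map_comp_right a k w w' _).trans (hdm a w (ξ.univLog.res k s)).symm))
      val_map := fun {V W} a w s => (PSec.val_ofSec _).symm.trans
        ((congrArg (PSec.val V) (hdm a w s)).trans (d'.val_map a w _)) }
  have hd : ∀ {V : T.Etale} {W : E.Etale} (a : V.left ⟶ W.left) (w : a ≫ W.hom = V.hom ≫ h)
      (s : ξ.univLog.sec W), PSec.ofSec (d.map a w s) = d'.map a w (ofFinite ξ.toSuppHom s) :=
    fun a w s => hdm a w s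
  have hsplit : ∀ {V : T.Etale} {W : E.Etale} (a : V.left ⟶ W.left)
      (w : a ≫ W.hom = V.hom ≫ h) (s : (pullbackLog φ K).sec W),
      d.pointed.map a w (splitSec ξ.toSuppHom s) = d'.map a w s := by
    intro V W a w s
    refine d.pmap_eq (w := w) (hfin a w s) (PSec.ofSec_injective ?_)
    rw [hd]
    refine (PSec.res_restrι _).symm.trans ?_
    have w' : ((restrι V (d'.map a w s : N.PSec V).D).left ≫ a) ≫ W.hom =
        (restr V (d'.map a w s : N.PSec V).D).hom ≫ h := by
      rw [Category.assoc, w, ← Category.assoc, left_w]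
    refine (d'.res_map (restrι V _) w w' rfl s).trans ?_
    exact (d'.map_res (restrι W _) (resOver_w a w _ _ _) w' (resOver_ιl a _ _ _) s).symm
  refine ⟨d, ⟨fun {V W U} a k w₁ w₂ w₃ m => ?_⟩, fun d₂ hd₂ => ?_⟩
  · exact (hsplit a w₁ _).trans (hd'.eq a k w₁ w₂ w₃ m)
  -- Any solution becomes `d'` after composition with the splitting, and the splitting fixes finite
  -- sections, so the solution is `d` on them.
  · have h₂ : d₂.pointed.pre (split ξ.toSuppHom) (split_α ξ.toSuppHom_α) = d' :=
      hu _ ⟨fun {V W U} a k w₁ w₂ w₃ m => hd₂.eq a k w₁ w₂ w₃ m⟩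
    refine map_ext fun {V W} a w s => PSec.ofSec_injective ?_
    rw [hd, ← pointed_ofSec, ← h₂]
    exact congrArg (d₂.pointed.map a w) (splitSec_ofFinite s).symm

end Comorphism

end LogGeom
end

noncomputable section

namespace LogGeom

/-! ### Functors over a scheme and their representability -/

/-- A functor over the scheme `Y` which is a sheaf for the étale topology. -/
structure PointFunctor (Y : Scheme.{u}) where
  pt : Scheme.{u} → Type (u + 1)
  base : ∀ {T : Scheme.{u}}, pt T → (T ⟶ Y)
  pull : ∀ {T' T : Scheme.{u}}, (T' ⟶ T) → pt T → pt T'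
  base_pull : ∀ {T' T : Scheme.{u}} (k : T' ⟶ T) (x : pt T), base (pull k x) = k ≫ base x
  pull_id : ∀ {T : Scheme.{u}} (x : pt T), pull (𝟙 T) x = x
  pull_comp : ∀ {T'' T' T : Scheme.{u}} (l : T'' ⟶ T') (k : T' ⟶ T) (x : pt T),
    pull (l ≫ k) x = pull l (pull k x)
  glue : ∀ {T : Scheme.{u}} {ι : Type u} {V : ι → Scheme.{u}} (k : ∀ i, V i ⟶ T)
    [∀ i, Etale (k i)], (∀ x : T, ∃ (i : ι) (y : V i), k i y = x) → ∀ x : ∀ i, pt (V i),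
    (∀ i j, pull (Limits.pullback.fst (k i) (k j)) (x i) =
      pull (Limits.pullback.snd (k i) (k j)) (x j)) → ∃! r, ∀ i, pull (k i) r = x i

namespace PointFunctor

variable {Y : Scheme.{u}} (G : PointFunctor Y)

/-- `A` represents the base change of `G` along `b`. -/
structure IsRep {B A : Scheme.{u}} (b : B ⟶ Y) (a : A ⟶ B) (x : G.pt A) : Prop where
  base : G.base x = a ≫ b
  univ : ∀ {T : Scheme.{u}} (t : T ⟶ B) (x' : G.pt T), G.base x' = t ≫ b →
    ∃! g : T ⟶ A, g ≫ a = t ∧ G.pull g x = x'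

variable {G}

lemma IsRep.hom_ext {B A T : Scheme.{u}} {b : B ⟶ Y} {a : A ⟶ B} {x : G.pt A} (h : G.IsRep b a x)
    {g g' : T ⟶ A} (h₁ : g ≫ a = g' ≫ a) (h₂ : G.pull g x = G.pull g' x) : g = g' :=
  (h.univ (g' ≫ a) (G.pull g' x) (by rw [G.base_pull, h.base, Category.assoc])).unique
    ⟨h₁, h₂⟩ ⟨rfl, rfl⟩

lemma IsRep.baseChange {B A B' A' : Scheme.{u}} {b : B ⟶ Y} {a : A ⟶ B} {x : G.pt A}
    (h : G.IsRep b a x) {p : A' ⟶ A} {a' : A' ⟶ B'} {c : B' ⟶ B} (hp : IsPullback p a' a c)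
    {b' : B' ⟶ Y} (hb : c ≫ b = b') : G.IsRep b' a' (G.pull p x) := by
  subst hb
  refine ⟨by rw [G.base_pull, h.base, ← Category.assoc, hp.w, Category.assoc], fun
      {T} t x' hx => ?_⟩
  obtain ⟨g, ⟨hg, hg'⟩, hu⟩ := h.univ (t ≫ c) x' (by rw [hx, Category.assoc])
  refine ⟨hp.lift g t hg, ⟨hp.lift_snd _ _ _, ?_⟩, fun k ⟨hk, hk'⟩ => hp.hom_ext ?_ ?_⟩
  · rw [← G.pull_comp, hp.lift_fst, hg']
  · rw [hp.lift_fst]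
    exact hu _ ⟨by rw [Category.assoc, hp.w, ← Category.assoc, hk], by rw [G.pull_comp, hk']⟩
  · rw [hp.lift_snd, hk]

/-- A morphism between representing objects over a morphism of bases. -/
lemma IsRep.isPullback {B A B' A' : Scheme.{u}} {b : B ⟶ Y} {a : A ⟶ B} {x : G.pt A}
    (h : G.IsRep b a x) {b' : B' ⟶ Y} {a' : A' ⟶ B'} {x' : G.pt A'} (h' : G.IsRep b' a' x')
    {p : A' ⟶ A} {c : B' ⟶ B} (hb : c ≫ b = b') (hw : p ≫ a = a' ≫ c)
    (hx : G.pull p x = x') : IsPullback p a' a c := by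
  refine ⟨⟨hw⟩, ⟨Limits.PullbackCone.IsLimit.mk hw
    (fun s => (h'.univ s.snd (G.pull s.fst x) ?_).choose) (fun s => ?_) (fun s => ?_)
    (fun s m h₁ h₂ => ?_)⟩⟩
  · rw [G.base_pull, h.base, ← Category.assoc, s.condition, Category.assoc, hb]
  · obtain ⟨h₁, h₂⟩ := (h'.univ s.snd (G.pull s.fst x) (by
      rw [G.base_pull, h.base, ← Category.assoc, s.condition, Category.assoc, hb])).choose_spec.1
    refine h.hom_ext ?_ ?_
    · rw [Category.assoc, hw, ← Category.assoc, h₁, s.condition]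
    · rw [G.pull_comp, hx, h₂]
  · exact (h'.univ s.snd (G.pull s.fst x) (by
      rw [G.base_pull, h.base, ← Category.assoc, s.condition, Category.assoc, hb])).choose_spec.1.1
  · refine (h'.univ s.snd (G.pull s.fst x) (by
      rw [G.base_pull, h.base, ← Category.assoc, s.condition, Category.assoc, hb])).choose_spec.2 _
        ⟨h₂, ?_⟩
    rw [← hx, ← G.pull_comp, h₁]

lemma exists_pullback_opens {B A : Scheme.{u}} {b : B ⟶ Y} {a : A ⟶ B} {x : G.pt A}
    (h : G.IsRep b a x) {B' : Scheme.{u}} (c : B' ⟶ B) :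
    ∃ (A' : Scheme.{u}) (a' : A' ⟶ B') (x' : G.pt A'), G.IsRep (c ≫ b) a' x' :=
  ⟨_, _, _, h.baseChange (IsPullback.of_hasPullback a c) rfl⟩

/-! ### Zariski gluing of representing objects -/

variable (G) in
/-- An open subset over which the functor is representable. -/
def Good (V : Y.Opens) : Prop := ∃ (A : Scheme.{u}) (a : A ⟶ V) (x : G.pt A), G.IsRep V.ι a x

lemma Good.mono {V W : Y.Opens} (hW : G.Good W) (h : V ≤ W) : G.Good V := by
  obtain ⟨A, a, x, hx⟩ := hW
  have := exists_pullback_opens hx (Y.homOfLE h)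
  rwa [Scheme.homOfLE_ι] at this

variable (G) in
/-- The type of good open subsets. -/
structure GoodOpens : Type u where
  opens : Y.Opens
  good : G.Good opens

instance : Preorder G.GoodOpens := Preorder.lift GoodOpens.opens

lemma GoodOpens.opens_le {V W : G.GoodOpens} (h : V ≤ W) : V.opens ≤ W.opens := h

namespace GoodOpens

/-- The representing object. -/
def obj (V : G.GoodOpens) : Scheme.{u} := V.good.choose

/-- Its structure morphism. -/
def str (V : G.GoodOpens) : V.obj ⟶ V.opens := V.good.choose_spec.choose

/-- Its universal element. -/
def el (V : G.GoodOpens) : G.pt V.obj := V.good.choose_spec.choose_spec.choose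

lemma isRep (V : G.GoodOpens) : G.IsRep V.opens.ι V.str V.el :=
  V.good.choose_spec.choose_spec.choose_spec

lemma exists_trans {V W : G.GoodOpens} (h : V.opens ≤ W.opens) : ∃ g : V.obj ⟶ W.obj,
    g ≫ W.str = V.str ≫ Y.homOfLE h ∧ G.pull g W.el = V.el :=
  (W.isRep.univ (V.str ≫ Y.homOfLE h) V.el (by
    rw [V.isRep.base, Category.assoc, Scheme.homOfLE_ι])).exists

/-- The transition morphisms. -/
def trans {V W : G.GoodOpens} (h : V.opens ≤ W.opens) : V.obj ⟶ W.obj := (exists_trans h).choose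

lemma trans_str {V W : G.GoodOpens} (h : V.opens ≤ W.opens) :
    trans h ≫ W.str = V.str ≫ Y.homOfLE h := (exists_trans h).choose_spec.1

lemma trans_el {V W : G.GoodOpens} (h : V.opens ≤ W.opens) : G.pull (trans h) W.el = V.el :=
  (exists_trans h).choose_spec.2

variable (hG : ∀ y : Y, ∃ V : Y.Opens, y ∈ V ∧ G.Good V)

/-- The open cover by good open subsets. -/
def openCover : Y.OpenCover where
  I₀ := G.GoodOpens
  X V := V.opens
  f V := V.opens.ι
  mem₀ := by
    rw [Scheme.ofArrows_mem_precoverage_iff]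
    refine ⟨fun y => ?_, fun V => inferInstance⟩
    obtain ⟨V, hy, hV⟩ := hG y
    exact ⟨⟨V, hV⟩, ⟨y, hy⟩, rfl⟩

instance : Preorder (openCover hG).I₀ := inferInstanceAs (Preorder G.GoodOpens)

/-- Every open subset of a good one is good, so good opens form a basis once they cover. -/
instance : (openCover hG).LocallyDirected :=
  Scheme.Cover.LocallyDirected.ofIsBasisOpensRange (𝒰 := openCover hG)
    (by
      intro V W
      change V ≤ W ↔ V.opens.ι.opensRange ≤ W.opens.ι.opensRange
      rw [Scheme.Opens.opensRange_ι, Scheme.Opens.opensRange_ι]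
      rfl)
    (by
      rw [TopologicalSpace.Opens.isBasis_iff_nbhd]
      intro U y hy
      obtain ⟨V, hyV, hV⟩ := hG y
      refine ⟨U ⊓ V, ⟨⟨U ⊓ V, hV.mono inf_le_right⟩, ?_⟩, ⟨hy, hyV⟩, inf_le_left⟩
      exact Scheme.Opens.opensRange_ι _)

lemma openCover_trans {V W : G.GoodOpens} (h : V ≤ W) :
    (openCover hG).trans (i := V) (j := W) (homOfLE h) = Y.homOfLE (opens_le h) :=
  (cancel_mono W.opens.ι).1 (((openCover hG).trans_map (i := V) (j := W) (homOfLE h)).trans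
    (Scheme.homOfLE_ι _ (opens_le h)).symm)

/-- The gluing datum. -/
def gluingData : (openCover hG).RelativeGluingData where
  functor :=
    { obj := fun V : G.GoodOpens => V.obj
      map := fun {V W : G.GoodOpens} h => trans (opens_le (leOfHom h))
      map_id := fun V : G.GoodOpens => V.isRep.hom_ext (by
        rw [trans_str, Category.id_comp, Scheme.homOfLE_rfl, Category.comp_id]) (by
        rw [trans_el, G.pull_id])
      map_comp := fun {V W Z : G.GoodOpens} h k => Z.isRep.hom_ext (by
        rw [trans_str, Category.assoc, trans_str, ← Category.assoc, trans_str, Category.assoc,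
          Scheme.homOfLE_homOfLE]) (by
        rw [trans_el, G.pull_comp, trans_el, trans_el]) }
  natTrans :=
    { app := fun V : G.GoodOpens => V.str
      naturality := fun V W h => by
        refine (trans_str (opens_le (leOfHom h))).trans ?_
        rw [← openCover_trans hG (leOfHom h)]
        rfl }
  equifibered := fun V W h => by
    have := IsRep.isPullback W.isRep V.isRep (c := Y.homOfLE (opens_le (leOfHom h)))
        (Scheme.homOfLE_ι _ _)
      (trans_str (opens_le (leOfHom h))) (trans_el (opens_le (leOfHom h)))
    rw [← openCover_trans hG (leOfHom h)] at this
    exact this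

end GoodOpens

open GoodOpens

/-- The representing objects over good opens are base changes of one another, hence a relative
gluing datum. Their universal elements agree on overlaps and glue to the universal element of the
glued scheme; its universal property is checked over good opens. -/
theorem exists_isRep_id (hG : ∀ y : Y, ∃ V : Y.Opens, y ∈ V ∧ G.Good V) :
    ∃ (A : Scheme.{u}) (a : A ⟶ Y) (x : G.pt A), G.IsRep (𝟙 Y) a x := by
  let d := gluingData hG
  have : Small.{u} (openCover hG).I₀ := inferInstanceAs (Small.{u} G.GoodOpens)
  have : Quiver.IsThin (openCover hG).I₀ := inferInstanceAs (Quiver.IsThin G.GoodOpens)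
  let i : ∀ V : G.GoodOpens, V.obj ⟶ d.glued := fun V => Limits.colimit.ι d.functor V
  have hi : ∀ {V W : G.GoodOpens} (h : V.opens ≤ W.opens), trans h ≫ i W = i V :=
    fun {V W} h => Limits.colimit.w d.functor (show (show
        (openCover hG).I₀ from V) ⟶ W from homOfLE (show V ≤ W from h))
  have hio : ∀ V, IsOpenImmersion (i V) := fun V => d.cover.map_prop V
  have hpb : ∀ V : G.GoodOpens, IsPullback V.str (i V) V.opens.ι d.toBase := fun V =>
    d.isPullback_natTrans_ι_toBase V
  have hj : ∀ z : d.glued, ∃ (V : G.GoodOpens) (y : V.obj), i V y = z := fun z =>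
    ⟨d.cover.idx z, d.cover.covers z⟩
  have inf : ∀ V W : G.GoodOpens, ∃ Z : G.GoodOpens, Z.opens = V.opens ⊓ W.opens := fun V W =>
    ⟨⟨V.opens ⊓ W.opens, V.good.mono inf_le_left⟩, rfl⟩
  have key : ∀ V W : G.GoodOpens, G.pull (Limits.pullback.fst (i V) (i W)) V.el =
      G.pull (Limits.pullback.snd (i V) (i W)) W.el := by
    intro V W
    obtain ⟨Z, hZ⟩ := inf V W
    have hV : Z.opens ≤ V.opens := by rw [hZ]; exact inf_le_left
    have hW : Z.opens ≤ W.opens := by rw [hZ]; exact inf_le_right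
    set p := Limits.pullback.fst (i V) (i W)
    set q := Limits.pullback.snd (i V) (i W)
    have hpq : p ≫ i V = q ≫ i W := Limits.pullback.condition
    have h₁ : p ≫ V.str ≫ V.opens.ι = q ≫ W.str ≫ W.opens.ι := by
      rw [(hpb V).w, (hpb W).w, ← Category.assoc, hpq, Category.assoc]
    let t : Limits.pullback (i V) (i W) ⟶ Z.opens := liftOpen
        (p ≫ V.str ≫ V.opens.ι) Z.opens fun y => by
      rw [hZ]
      refine ⟨?_, ?_⟩
      · rw [← Category.assoc, Scheme.Hom.comp_apply]
        exact ((p ≫ V.str) y).2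
      · rw [h₁, ← Category.assoc, Scheme.Hom.comp_apply]
        exact ((q ≫ W.str) y).2
    have ht : t ≫ Z.opens.ι = p ≫ V.str ≫ V.opens.ι := liftOpen_ι _ _ _
    obtain ⟨g, ⟨hg, hg'⟩, -⟩ := Z.isRep.univ t (G.pull p V.el) (by
      rw [G.base_pull, V.isRep.base, ht])
    obtain ⟨g', ⟨hk, hk'⟩, -⟩ := Z.isRep.univ t (G.pull q W.el) (by
      rw [G.base_pull, W.isRep.base, ht, h₁])
    have e₁ : g ≫ trans hV = p := V.isRep.hom_ext (by
      rw [Category.assoc, trans_str, ← Category.assoc, hg, ← cancel_mono V.opens.ι, Category.assoc,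
        Scheme.homOfLE_ι, ht, Category.assoc]) (by rw [G.pull_comp, trans_el, hg'])
    have e₂ : g' ≫ trans hW = q := W.isRep.hom_ext (by
      rw [Category.assoc, trans_str, ← Category.assoc, hk, ← cancel_mono W.opens.ι, Category.assoc,
        Scheme.homOfLE_ι, ht, h₁, Category.assoc]) (by rw [G.pull_comp, trans_el, hk'])
    -- The morphisms `g` and `g'` classify the two pullbacks of universal elements over the
    -- intersection. They have the same composite with the monomorphism `i Z`, so they coincide, and
    -- with them the elements.
    have e₃ : g = g' := by
      rw [← cancel_mono (i Z), ← hi hV, ← Category.assoc, e₁, hpq, ← e₂, Category.assoc, hi hW,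
        hi hV]
    rw [← hg', e₃, hk']
  obtain ⟨x, hx, hxu⟩ := G.glue i hj (fun V => V.el) key
  have hbase : G.base x = d.toBase ≫ 𝟙 Y := by
    rw [Category.comp_id]
    refine (existsUnique_glue i hj (fun V => i V ≫ d.toBase) fun V W => ?_).unique (fun V => ?_)
      fun V => rfl
    · rw [← Category.assoc, Limits.pullback.condition, Category.assoc]
    · rw [← G.base_pull, hx, V.isRep.base, (hpb V).w]
  have hc : ∀ {T : Scheme.{u}} (t : T ⟶ Y) (z : T), ∃ (V : G.GoodOpens) (y : (t ⁻¹ᵁ V.opens :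
      T.Opens)),
      (t ⁻¹ᵁ V.opens).ι y = z := by
    intro T t z
    obtain ⟨V, hy, hV⟩ := hG (t z)
    exact ⟨⟨V, hV⟩, ⟨z, hy⟩, rfl⟩
  -- Over the preimage of a good open `V` both morphisms land in `V.obj`, where the universal
  -- property of that object compares them.
  have hext : ∀ {T : Scheme.{u}} (g g' : T ⟶ d.glued), g ≫ d.toBase = g' ≫ d.toBase →
      G.pull g x = G.pull g' x → g = g' := by
    intro T g g' h₁ h₂
    refine (existsUnique_glue (fun V : G.GoodOpens => ((g ≫ d.toBase) ⁻¹ᵁ V.opens).ι) (hc _)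
      (fun V => ((g ≫ d.toBase) ⁻¹ᵁ V.opens).ι ≫ g') fun V W => ?_).unique
          (fun V => ?_) fun V => rfl
    · rw [← Category.assoc, Limits.pullback.condition, Category.assoc]
    · have hl := Scheme.Hom.resLE_comp_ι (g ≫ d.toBase) (U := V.opens) le_rfl
      set l := (g ≫ d.toBase).resLE V.opens ((g ≫ d.toBase) ⁻¹ᵁ V.opens) le_rfl
      set c := ((g ≫ d.toBase) ⁻¹ᵁ V.opens).ι
      have w₁ : l ≫ V.opens.ι = (c ≫ g) ≫ d.toBase := by rw [hl, Category.assoc]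
      have w₂ : l ≫ V.opens.ι = (c ≫ g') ≫ d.toBase :=
        w₁.trans ((Category.assoc _ _ _).trans ((congrArg (c ≫ ·) h₁).trans
          (Category.assoc _ _ _).symm))
      have e₁ := (hpb V).lift_snd l (c ≫ g) w₁
      have e₂ := (hpb V).lift_snd l (c ≫ g') w₂
      rw [← e₁, ← e₂]
      congr 1
      refine V.isRep.hom_ext (by rw [IsPullback.lift_fst, IsPullback.lift_fst]) ?_
      rw [← hx V, ← G.pull_comp, ← G.pull_comp, e₁, e₂, G.pull_comp, h₂, G.pull_comp]
  refine ⟨d.glued, d.toBase, x, hbase, fun {T} t x' hx' => ?_⟩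
  rw [Category.comp_id] at hx'
  have hex : ∀ V : G.GoodOpens, ∃ g : (t ⁻¹ᵁ V.opens : T.Opens).toScheme ⟶ d.glued,
      g ≫ d.toBase = (t ⁻¹ᵁ V.opens).ι ≫ t ∧ G.pull g x = G.pull (t ⁻¹ᵁ V.opens).ι x' := by
    intro V
    have hl := Scheme.Hom.resLE_comp_ι t (U := V.opens) (V := t ⁻¹ᵁ V.opens) le_rfl
    obtain ⟨g, ⟨hg, hg'⟩, -⟩ := V.isRep.univ _ (G.pull (t ⁻¹ᵁ V.opens).ι x') (by
      rw [G.base_pull, hx', hl])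
    refine ⟨g ≫ i V, ?_, ?_⟩
    · rw [Category.assoc, ← (hpb V).w, ← Category.assoc, hg, hl]
    · rw [G.pull_comp, hx, hg']
  choose g hg hg' using hex
  obtain ⟨r, hr, -⟩ := existsUnique_glue (fun V : G.GoodOpens => (t ⁻¹ᵁ V.opens).ι) (hc t) g
    fun V W => hext _ _ (by
      rw [Category.assoc, hg, Category.assoc, hg, ← Category.assoc, Limits.pullback.condition,
        Category.assoc]) (by
      rw [G.pull_comp, hg', G.pull_comp, hg', ← G.pull_comp, ← G.pull_comp,
        Limits.pullback.condition])
  have hrt : r ≫ d.toBase = t := by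
    refine (existsUnique_glue (fun V : G.GoodOpens => (t ⁻¹ᵁ V.opens).ι) (hc t)
      (fun V => (t ⁻¹ᵁ V.opens).ι ≫ t) fun V W => ?_).unique (fun V => ?_) fun V => rfl
    · rw [← Category.assoc, Limits.pullback.condition, Category.assoc]
    · rw [← Category.assoc, hr, hg]
  have hrx : G.pull r x = x' := by
    refine (G.glue (fun V : G.GoodOpens => (t ⁻¹ᵁ V.opens).ι) (hc t)
      (fun V => G.pull (t ⁻¹ᵁ V.opens).ι x') fun V W => ?_).unique (fun V => ?_) fun V => rfl
    · rw [← G.pull_comp, ← G.pull_comp, Limits.pullback.condition]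
    · rw [← G.pull_comp, hr, hg']
  exact ⟨r, ⟨hrt, hrx⟩, fun r' ⟨h₁, h₂⟩ => hext _ _ (h₁.trans hrt.symm) (h₂.trans hrx.symm)⟩

end PointFunctor

end LogGeom
end

noncomputable section

namespace LogGeom

open PrelogStructure Comorphism

/-! ### Affine étale descent of representing objects -/

section

open TensorProduct

variable {R S C : Type u} [CommRing R] [CommRing S] [CommRing C] [Algebra R S] [Algebra R C]
  [Algebra S C] [IsScalarTower R S C]

/-- The invariants of a coaction. -/
def coinvariants (ρ : C →ₐ[S] S ⊗[R] C) : Subalgebra R C :=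
  AlgHom.equalizer (ρ.restrictScalars R) (Algebra.TensorProduct.includeRight (R := R) (A := S))

/-- The multiplication. -/
def actMul (R S C : Type u) [CommRing R] [CommRing S] [CommRing C] [Algebra R S] [Algebra R C]
    [Algebra S C] [IsScalarTower R S C] : S ⊗[R] C →ₐ[S] C :=
  Algebra.TensorProduct.lift (Algebra.ofId S C) (AlgHom.id R C) fun _ _ => Commute.all _ _

lemma actMul_tmul (s : S) (c : C) : actMul R S C (s ⊗ₜ c) = algebraMap S C s * c := by
  simp [actMul, Algebra.ofId_apply]

/-- Collapse the two factors `S` by the action. The image of `z` under the coaction becomes `ρ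
(actMul R S C z)` and its image under the inclusion becomes `z`. -/
lemma eq_coaction_of_mem (ρ : C →ₐ[S] S ⊗[R] C) (z : S ⊗[R] C)
    (hz : Algebra.TensorProduct.map (AlgHom.id S S) (ρ.restrictScalars R) z =
      Algebra.TensorProduct.map (AlgHom.id S S)
        (Algebra.TensorProduct.includeRight (R := R) (A := S) (B := C)) z) :
    ρ (actMul R S C z) = z := by
  let m : S ⊗[R] (S ⊗[R] C) →ₐ[S] S ⊗[R] C := actMul R S (S ⊗[R] C)
  have h₁ : ∀ z, m (Algebra.TensorProduct.map (AlgHom.id S S) (ρ.restrictScalars R) z) =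
      ρ (actMul R S C z) := by
    intro z
    induction z with
    | zero => simp
    | tmul s c =>
      rw [Algebra.TensorProduct.map_tmul, actMul_tmul, actMul_tmul, map_mul, AlgHom.commutes]
      rfl
    | add x y hx hy => simp only [map_add, hx, hy]
  have h₂ : ∀ z, m (Algebra.TensorProduct.map (AlgHom.id S S)
        (Algebra.TensorProduct.includeRight (R := R) (A := S) (B := C)) z) = z := by
    intro z
    induction z with
    | zero => simp
    | tmul s c =>
      rw [Algebra.TensorProduct.map_tmul, actMul_tmul]
      simp
    | add x y hx hy => simp only [map_add, hx, hy]
  rw [← h₁, hz, h₂]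

/-- Flatness lets `S ⊗ -` commute with the equalizer defining the coinvariants. The resulting
equalizer inside `S ⊗ C` is identified with `C` by `ρ` and `actMul`, which are inverse there by the
counit law and `eq_coaction_of_mem`. -/
lemma isPushout_coinvariants [Module.Flat R S] (ρ : C →ₐ[S] S ⊗[R] C)
    (h₁ : ∀ c, actMul R S C (ρ c) = c)
    (h₂ : ∀ c, Algebra.TensorProduct.map (AlgHom.id S S) (ρ.restrictScalars R) (ρ c) =
      Algebra.TensorProduct.map (AlgHom.id S S)
        (Algebra.TensorProduct.includeRight (R := R) (A := S) (B := C)) (ρ c)) :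
    Algebra.IsPushout R S (coinvariants ρ) C := by
  let E := AlgHom.equalizer (Algebra.TensorProduct.map (AlgHom.id S S) (ρ.restrictScalars R))
      (Algebra.TensorProduct.map (AlgHom.id S S)
        (Algebra.TensorProduct.includeRight (R := R) (A := S) (B := C)))
  let e₁ : S ⊗[R] coinvariants ρ ≃ₐ[S] E := AlgHom.tensorEqualizerEquiv S S _ _
  let e₂ : E ≃ₐ[S] C := AlgEquiv.ofAlgHom ((actMul R S C).comp E.val) (ρ.codRestrict E h₂)
    (AlgHom.ext h₁) (AlgHom.ext fun z => Subtype.ext (eq_coaction_of_mem ρ z.1 z.2))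
  refine ⟨IsBaseChange.of_equiv (e₁.trans e₂).toLinearEquiv fun c => ?_⟩
  change actMul R S C (e₁ (1 ⊗ₜ c) : S ⊗[R] C) = _
  have : (e₁ (1 ⊗ₜ c) : S ⊗[R] C) = 1 ⊗ₜ (c : C) := rfl
  rw [this, actMul_tmul, map_one, one_mul]
  rfl

end

/-! ### Étale descent of representing objects -/

namespace PointFunctor

variable {Y : Scheme.{u}} {G : PointFunctor Y}

/-- Descent of a representing object along an étale surjective morphism. -/
lemma IsRep.descend {B' B A A₀ : Scheme.{u}} {b : B ⟶ Y} {p : B' ⟶ B} [Etale p] [Surjective p]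
    {a : A ⟶ B'} {x : G.pt A} (hx : G.IsRep (p ≫ b) a x) {q : A ⟶ A₀} {a₀ : A₀ ⟶ B}
    (hp : IsPullback q a a₀ p)
    (key : ∀ {T : Scheme.{u}} (v w : T ⟶ A), v ≫ a ≫ p = w ≫ a ≫ p →
      (G.pull v x = G.pull w x ↔ v ≫ q = w ≫ q)) :
    ∃ x₀ : G.pt A₀, G.IsRep b a₀ x₀ := by
  have hq : Etale q := MorphismProperty.of_isPullback hp.flip ‹Etale p›
  have hqs : Surjective q := MorphismProperty.of_isPullback hp.flip ‹Surjective p›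
  have surj : ∀ {V W : Scheme.{u}} (k : V ⟶ W) [Surjective k],
      ∀ w : W, ∃ (i : PUnit.{u + 1}) (y : V), k y = w := fun k _ w =>
    ⟨⟨⟩, k.surjective w⟩
  have ext_hom : ∀ {V W Z : Scheme.{u}} (k : V ⟶ W) [Etale k] [Surjective k] {g g' : W ⟶ Z},
      k ≫ g = k ≫ g' → g = g' := fun {V W Z} k _ _ {g g'} h =>
    (existsUnique_glue (fun _ : PUnit.{u + 1} => k) (surj k) (fun _ => k ≫ g) fun _ _ => by
      rw [← Category.assoc, Limits.pullback.condition, Category.assoc]).unique (fun _ => rfl)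
        fun _ => h.symm
  have ext_pt : ∀ {V W : Scheme.{u}} (k : V ⟶ W) [Etale k] [Surjective k] {y y' : G.pt W},
      G.pull k y = G.pull k y' → y = y' := fun {V W} k _ _ {y y'} h =>
    (G.glue (fun _ : PUnit.{u + 1} => k) (surj k) (fun _ => G.pull k y) fun _ _ => by
      rw [← G.pull_comp, Limits.pullback.condition, G.pull_comp]).unique (fun _ => rfl)
        fun _ => h.symm
  -- By `key`, the pullbacks of `x` along the two projections of `A ×_{A₀} A` agree, so `x` descends
  -- along the étale surjection `q`.
  obtain ⟨x₀, hx₀, -⟩ := G.glue (fun _ : PUnit.{u + 1} => q) (surj q) (fun _ => x) fun _ _ =>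
    (key _ _ (by
      rw [← hp.w, ← Category.assoc, Limits.pullback.condition, Category.assoc])).2
        Limits.pullback.condition
  have hx₀' : G.pull q x₀ = x := hx₀ ⟨⟩
  have hb : G.base x₀ = a₀ ≫ b := ext_hom q (by
    rw [← G.base_pull, hx₀', hx.base, ← Category.assoc, ← Category.assoc, hp.w])
  refine ⟨x₀, hb, fun {T} t x' hx' => ?_⟩
  let e : Limits.pullback t p ⟶ T := Limits.pullback.fst t p
  let s : Limits.pullback t p ⟶ B' := Limits.pullback.snd t p
  have hes : e ≫ t = s ≫ p := Limits.pullback.condition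
  obtain ⟨g, ⟨hg, hg'⟩, -⟩ := hx.univ s (G.pull e x') (by
    rw [G.base_pull, hx', ← Category.assoc, hes, Category.assoc])
  -- After base change to `B'` the element is classified by `g`, and `key` in the other direction
  -- makes `g ≫ q` descend to `T`.
  obtain ⟨r, hr, -⟩ := existsUnique_glue (fun _ : PUnit.{u + 1} => e) (surj e)
    (fun _ => g ≫ q) fun _ _ => by
      rw [← Category.assoc, ← Category.assoc]
      refine (key _ _ ?_).1 ?_
      · simp only [Category.assoc]
        rw [← Category.assoc g, hg, ← hes, ← Category.assoc, Limits.pullback.condition,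
          Category.assoc]
      · rw [G.pull_comp, hg', G.pull_comp, hg', ← G.pull_comp, Limits.pullback.condition,
          G.pull_comp]
  have hr' : e ≫ r = g ≫ q := hr ⟨⟩
  refine ⟨r, ⟨ext_hom e ?_, ext_pt e ?_⟩, fun r' ⟨h₁, h₂⟩ => ext_hom e ?_⟩
  · rw [← Category.assoc, hr', Category.assoc, hp.w, ← Category.assoc, hg, hes]
  · rw [← G.pull_comp, hr', G.pull_comp, hx₀', hg']
  · have w : (e ≫ r') ≫ a₀ = s ≫ p := by rw [Category.assoc, h₁, hes]
    have : hp.lift (e ≫ r') s w = g := hx.hom_ext (by rw [hp.lift_snd, hg]) (by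
      rw [hg', ← hx₀', ← G.pull_comp, hp.lift_fst, G.pull_comp, h₂])
    rw [hr', ← this, hp.lift_fst]

open TensorProduct in
-- The descent datum is obtained for free from representability: it is a coaction of `S` on `C`, its
-- laws follow from uniqueness of classifying morphisms, and the object over `R` is the spectrum of
-- its coinvariants.
lemma IsRep.affine_descend {R S C : Type u} [CommRing R] [CommRing S] [CommRing C] [Algebra R S]
    [Algebra S C] {b : Spec (.of R) ⟶ Y}
    [Etale (Spec.map (CommRingCat.ofHom (algebraMap R S)))]
    [Surjective (Spec.map (CommRingCat.ofHom (algebraMap R S)))]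
    {x : G.pt (Spec (.of C))}
    (hx : G.IsRep (Spec.map (CommRingCat.ofHom (algebraMap R S)) ≫ b)
      (Spec.map (CommRingCat.ofHom (algebraMap S C))) x) :
    ∃ (A₀ : Scheme.{u}) (a₀ : A₀ ⟶ Spec (.of R)) (x₀ : G.pt A₀), G.IsRep b a₀ x₀ := by
  let _ : Algebra R C := Algebra.compHom C (algebraMap R S)
  have : IsScalarTower R S C := .of_algebraMap_eq fun _ => rfl
  have hflat : Module.Flat R S := by
    have : Flat (Spec.map (CommRingCat.ofHom (algebraMap R S))) := inferInstance
    rw [Flat.SpecMap_iff] at this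
    exact RingHom.flat_algebraMap_iff.1 this
  set p := Spec.map (CommRingCat.ofHom (algebraMap R S))
  set a := Spec.map (CommRingCat.ofHom (algebraMap S C))
  let i₁ : S →+* S ⊗[R] C := Algebra.TensorProduct.includeLeftRingHom
  let i₂ : C →+* S ⊗[R] C := (Algebra.TensorProduct.includeRight (R := R) (A := S)).toRingHom
  let p₁ : Spec (.of (S ⊗[R] C)) ⟶ Spec (.of S) := Spec.map (CommRingCat.ofHom i₁)
  let p₂ : Spec (.of (S ⊗[R] C)) ⟶ Spec (.of C) := Spec.map (CommRingCat.ofHom i₂)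
  have hpb : IsPullback p₁ p₂ p (a ≫ p) := by
    have h := isPullback_SpecMap_of_isPushout _ _ _ _ (CommRingCat.isPushout_tensorProduct R S C)
    have e : Spec.map (CommRingCat.ofHom (algebraMap R C)) = a ≫ p := by
      rw [← Spec.map_comp, ← CommRingCat.ofHom_comp, ← IsScalarTower.algebraMap_eq]
    rw [e] at h
    exact h
  -- `r` classifies the universal element of the second factor, regarded as an element over the
  -- first factor `S`; on rings it is the coaction `ρ`.
  obtain ⟨r, ⟨hr, hr'⟩, -⟩ := hx.univ p₁ (G.pull p₂ x) (by
    rw [G.base_pull, hx.base, ← Category.assoc, ← Category.assoc, ← Category.assoc,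
        Category.assoc p₂,
      ← hpb.w])
  obtain ⟨ρ', rfl⟩ := Spec.map_surjective r
  let ρ : C →ₐ[S] S ⊗[R] C :=
    { ρ'.hom with
      commutes' := fun s => by
        rw [← Spec.map_comp] at hr
        exact congrArg (fun f => f.hom s) (Spec.map_injective hr) }
  have hρ : CommRingCat.ofHom ρ.toRingHom = ρ' := rfl
  rw [← hρ] at hr hr'
  -- Counit law: along `Spec` of `actMul` the element classified by `r` becomes `x` itself, so `r`
  -- becomes the identity.
  have h₁ : ∀ c, actMul R S C (ρ c) = c := by
    have hl : Spec.map (CommRingCat.ofHom (actMul R S C).toRingHom) ≫ p₂ = 𝟙 _ := by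
      rw [← Spec.map_comp, ← Spec.map_id]
      congr 1
      ext c
      exact (actMul_tmul (R := R) (1 : S) c).trans (by rw [map_one, one_mul]; rfl)
    have hl' : Spec.map (CommRingCat.ofHom (actMul R S C).toRingHom) ≫ p₁ = a := by
      rw [← Spec.map_comp]
      congr 1
      ext s
      exact (actMul_tmul (R := R) s (1 : C)).trans (by rw [mul_one]; rfl)
    have : Spec.map (CommRingCat.ofHom (actMul R S C).toRingHom) ≫
        Spec.map (CommRingCat.ofHom ρ.toRingHom) = 𝟙 _ := hx.hom_ext (by
      rw [Category.assoc, hr, hl', Category.id_comp]) (by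
      rw [G.pull_comp, hr', ← G.pull_comp, hl])
    rw [← Spec.map_comp, ← Spec.map_id] at this
    intro c
    exact congrArg (fun f => f.hom c) (Spec.map_injective this)
  -- Coassociativity: both composites with `r` classify the same element over the same morphism to
  -- `Spec S`.
  have h₂ : ∀ c, Algebra.TensorProduct.map (AlgHom.id S S) (ρ.restrictScalars R) (ρ c) =
      Algebra.TensorProduct.map (AlgHom.id S S)
        (Algebra.TensorProduct.includeRight (R := R) (A := S) (B := C)) (ρ c) := by
    let j₁ : S →+* S ⊗[R] (S ⊗[R] C) := Algebra.TensorProduct.includeLeftRingHom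
    let j₂ : S ⊗[R] C →+* S ⊗[R] (S ⊗[R] C) :=
      (Algebra.TensorProduct.includeRight (R := R) (A := S)).toRingHom
    have e₁ : ∀ f : C →ₐ[R] S ⊗[R] C,
        Spec.map (CommRingCat.ofHom (Algebra.TensorProduct.map (AlgHom.id S S) f).toRingHom) ≫ p₁ =
          Spec.map (CommRingCat.ofHom j₁) := by
      intro f
      rw [← Spec.map_comp]
      congr 1
      ext s
      exact (Algebra.TensorProduct.map_tmul _ _ _ _).trans (by rw [map_one]; rfl)
    have e₂ : ∀ f : C →ₐ[R] S ⊗[R] C,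
        Spec.map (CommRingCat.ofHom (Algebra.TensorProduct.map (AlgHom.id S S) f).toRingHom) ≫ p₂ =
          Spec.map (CommRingCat.ofHom j₂) ≫ Spec.map (CommRingCat.ofHom f.toRingHom) := by
      intro f
      rw [← Spec.map_comp, ← Spec.map_comp]
      congr 1
    have : Spec.map (CommRingCat.ofHom (Algebra.TensorProduct.map (AlgHom.id S S)
          (ρ.restrictScalars R)).toRingHom) ≫ Spec.map (CommRingCat.ofHom ρ.toRingHom) =
        Spec.map (CommRingCat.ofHom (Algebra.TensorProduct.map (AlgHom.id S S)
          (Algebra.TensorProduct.includeRight (R := R) (A := S) (B := C))).toRingHom) ≫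
          Spec.map (CommRingCat.ofHom ρ.toRingHom) := hx.hom_ext (by
      rw [Category.assoc, Category.assoc, hr, e₁, e₁]) (by
      rw [G.pull_comp, G.pull_comp, hr', ← G.pull_comp, ← G.pull_comp, e₂, e₂, G.pull_comp,
        G.pull_comp]
      exact congrArg _ hr')
    rw [← Spec.map_comp, ← Spec.map_comp] at this
    intro c
    exact congrArg (fun f => f.hom c) (Spec.map_injective this)
  have hpo := isPushout_coinvariants ρ h₁ h₂
  let q : Spec (.of C) ⟶ Spec (.of (coinvariants ρ)) :=
    Spec.map (CommRingCat.ofHom (coinvariants ρ).val.toRingHom)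
  let a₀ : Spec (.of (coinvariants ρ)) ⟶ Spec (.of R) :=
    Spec.map (CommRingCat.ofHom (algebraMap R (coinvariants ρ)))
  have hsq : IsPullback q a a₀ p :=
    (isPullback_SpecMap_of_isPushout _ _ _ _
      (CommRingCat.isPushout_of_isPushout R S (coinvariants ρ) C)).flip
  have hρq : Spec.map (CommRingCat.ofHom ρ.toRingHom) ≫ q = p₂ ≫ q := by
    rw [← Spec.map_comp, ← Spec.map_comp]
    congr 1
    ext c
    exact c.2
  -- For `v` and `w` with equal image over `R`, the pair `(w ≫ a, v)` followed by `r` classifies the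
  -- pullback of `x` along `v`. It equals `w` exactly when the two pullbacks of `x` agree,
  -- equivalently when `v` and `w` agree after `q`, since `r` and `p₂` have the same composite with
  -- `q`.
  obtain ⟨x₀, hx₀⟩ := hx.descend hsq fun {T} v w hvw => by
    have wl : (w ≫ a) ≫ p = v ≫ a ≫ p := by rw [hvw, Category.assoc]
    let l := hpb.lift (w ≫ a) v wl
    have hl₁ : l ≫ p₁ = w ≫ a := hpb.lift_fst _ _ wl
    have hl₂ : l ≫ p₂ = v := hpb.lift_snd _ _ wl
    constructor
    · intro h
      have : l ≫ Spec.map (CommRingCat.ofHom ρ.toRingHom) = w := hx.hom_ext (by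
        rw [Category.assoc, hr, hl₁]) (by rw [G.pull_comp, hr', ← G.pull_comp, hl₂, h])
      rw [← this, Category.assoc, hρq, ← Category.assoc, hl₂]
    · intro h
      have : l ≫ Spec.map (CommRingCat.ofHom ρ.toRingHom) = w := hsq.hom_ext (by
        rw [Category.assoc, hρq, ← Category.assoc, hl₂, h]) (by
        rw [Category.assoc, hr, hl₁])
      rw [← this, G.pull_comp, hr', ← G.pull_comp, hl₂]
  exact ⟨_, a₀, x₀, hx₀⟩

end PointFunctor

end LogGeom
end

set_option linter.unusedSectionVars false

noncomputable section

namespace LogGeom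

open PrelogStructure Comorphism

/-! ### The functor of supports of pointed morphisms -/

variable {Y : Scheme.{u}}

/-- A morphism to `Y` with a comorphism to the log structure of supports. -/
structure SuppPoint (K : PrelogStructure Y) (T : Scheme.{u}) where
  base : T ⟶ Y
  co : Comorphism base (supp T) K

namespace SuppPoint

variable {K : PrelogStructure Y} {T T' : Scheme.{u}}

lemma ext_map {x y : SuppPoint K T} (hb : x.base = y.base)
    (h : ∀ {V : T.Etale} {U : Y.Etale} (h : V.left ⟶ U.left) (w : h ≫ U.hom = V.hom ≫ x.base)
      (w' : h ≫ U.hom = V.hom ≫ y.base) (m : K.sec U), x.co.map h w m = y.co.map h w' m) :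
    x = y := by
  obtain ⟨t, c⟩ := x
  obtain ⟨t', c'⟩ := y
  obtain rfl : t = t' := hb
  congr 1
  exact map_ext fun a w m => h a w w m

lemma map_eq_of_eq {x y : SuppPoint K T} (hxy : x = y) {V : T.Etale} {U : Y.Etale}
    (h : V.left ⟶ U.left) (w : h ≫ U.hom = V.hom ≫ x.base)
    (w' : h ≫ U.hom = V.hom ≫ y.base) (m : K.sec U) : x.co.map h w m = y.co.map h w' m := by
  subst hxy; rfl

/-- The pullback of a point. -/
def pull (k : T' ⟶ T) (x : SuppPoint K T) : SuppPoint K T' := ⟨k ≫ x.base, (suppCo k).comp x.co⟩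

lemma factors_pull (k : T' ⟶ T) (x : SuppPoint K T) :
    Factors (suppCo k) x.co (x.pull k).co := factors_comp _ _

lemma eq_of_factors {k : T' ⟶ T} {x : SuppPoint K T} {y : SuppPoint K T'} (hb : k ≫ x.base = y.base)
    (h : Factors (suppCo k) x.co y.co) : x.pull k = y := by
  obtain ⟨t, c⟩ := y
  obtain rfl : k ≫ x.base = t := hb
  unfold pull
  congr 1
  exact Factors.unique rfl (factors_comp _ _) h

lemma _root_.LogGeom.suppCo_factors {T'' : Scheme.{u}} (l : T'' ⟶ T') (k : T' ⟶ T) :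
    Factors (suppCo l) (suppCo k) (suppCo (l ≫ k)) := ⟨fun h h' w₁ w₂ w₃ m =>
  Subtype.ext (Prod.ext (appTop_comp_apply h h' _).symm (appTop_comp_apply h h' _).symm)⟩

lemma pull_id (x : SuppPoint K T) : x.pull (𝟙 T) = x :=
  eq_of_factors (Category.id_comp _) ⟨fun {V W U} h k w₁ w₂ w₃ m =>
    (x.co.map_comp_left (mkHom h (w₁.trans (Category.comp_id _))) k w₂ w₃ m).symm⟩

lemma pull_comp {T'' : Scheme.{u}} (l : T'' ⟶ T') (k : T' ⟶ T) (x : SuppPoint K T) :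
    x.pull (l ≫ k) = (x.pull k).pull l :=
  eq_of_factors (Category.assoc _ _ _)
    (((suppCo_factors l k).assoc (factors_pull k x) rfl rfl rfl).1 (factors_pull l (x.pull k)))

lemma pull_map (k : T' ⟶ T) [Etale k] (x : SuppPoint K T) {V : T'.Etale} {U : Y.Etale}
    (h : V.left ⟶ U.left) (w : h ≫ U.hom = V.hom ≫ k ≫ x.base)
    (w' : h ≫ U.hom = (shr k V).hom ≫ x.base) (m : K.sec U) :
    (x.pull k).co.map h w m = x.co.map (V := shr k V) h w' m := by
  have := (factors_pull k x).map_eq (V := V) (W := shr k V) (h := 𝟙 V.left) (k := h)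
    (l := h) (Category.id_comp _) w' w (Category.id_comp _) m
  exact this.symm.trans ((supp T).res_id (shr k V) (x.co.map (V := shr k V) h w' m))

lemma etale_lift {A B C : Scheme.{u}} (f : A ⟶ B) (g : B ⟶ C) (h : A ⟶ C) (_ : Etale g)
    (_ : Etale h) (w : f ≫ g = h) : Etale f := by
  subst w
  exact MorphismProperty.of_postcomp (W := @Etale) (W' := @Etale) f g ‹_› ‹_›

lemma whisker_w {A B C D F : Scheme.{u}} {p : B ⟶ C} {q : C ⟶ F} {r : B ⟶ D} {s : D ⟶ F}
    (a : A ⟶ B) (w : p ≫ q = r ≫ s) : (a ≫ p) ≫ q = (a ≫ r) ≫ s := by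
  rw [Category.assoc, w, Category.assoc]

lemma comp_comp_congr {A B B' C D : Scheme.{u}} {a : A ⟶ B} {b : B ⟶ C} {a' : A ⟶ B'} {b' : B' ⟶ C}
    (w : a ≫ b = a' ≫ b') (c : C ⟶ D) : a ≫ b ≫ c = a' ≫ b' ≫ c := by
  rw [← Category.assoc, w, Category.assoc]

lemma comp_comp_eq {A B D : Scheme.{u}} {a : A ⟶ B} {b : B ⟶ A}
    (w : a ≫ b = 𝟙 A) (c : A ⟶ D) : a ≫ b ≫ c = c := by
  rw [← Category.assoc, w, Category.id_comp]

section

variable {ι : Type u} {V : ι → Scheme.{u}} (k : ∀ i, V i ⟶ T) [∀ i, Etale (k i)]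

/-- The pieces of a covering of an object of the étale site. -/
def piece (W : T.Etale) (i : ι) : T.Etale := shr (k i) (pb (k i) W)

/-- The inclusion of a piece. -/
def pieceHom (W : T.Etale) (i : ι) : piece k W i ⟶ W := mkHom (pbSnd (k i) W) (pbSnd_w (k i) W)

variable {k}

lemma jointlySurj_pieceHom (hk : ∀ x : T, ∃ (i : ι) (y : V i), k i y = x) (W : T.Etale) :
    JointlySurj (pieceHom k W) := by
  intro z
  obtain ⟨i, y, hy⟩ := hk (W.hom z)
  obtain ⟨p, -, hp⟩ := Scheme.Pullback.exists_preimage_pullback (f := k i) (g := W.hom) y z hy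
  exact ⟨i, p, hp⟩

lemma piece_w {t : T ⟶ Y} {i : ι} {W : T.Etale} {U : Y.Etale} {h : W.left ⟶ U.left}
    (w : h ≫ U.hom = W.hom ≫ t) {s : V i ⟶ Y} (hs : s = k i ≫ t) :
    (pbSnd (k i) W ≫ h) ≫ U.hom = (pb (k i) W).hom ≫ s := by
  subst hs
  rw [Category.assoc, w, ← Category.assoc, pbSnd_w, Category.assoc]

/-- The values prescribed on the pieces of `W` are compatible because a common refinement of two
pieces is étale over the overlap of `V i` and `V j`, where the given points agree. -/
lemma existsUnique_piece (hk : ∀ x : T, ∃ (i : ι) (y : V i), k i y = x)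
    (x : ∀ i, SuppPoint K (V i))
    (hx : ∀ i j, (x i).pull (Limits.pullback.fst (k i) (k j)) =
      (x j).pull (Limits.pullback.snd (k i) (k j)))
    {t : T ⟶ Y} (ht : ∀ i, (x i).base = k i ≫ t) {W : T.Etale} {U : Y.Etale}
    (h : W.left ⟶ U.left) (w : h ≫ U.hom = W.hom ≫ t) (m : K.sec U) :
    ∃ s : (supp T).sec W, ∀ i, (supp T).res (pieceHom k W i) s =
      (x i).co.map (pbSnd (k i) W ≫ h) (piece_w w (ht i)) m := by
  refine (supp_isLog T).gluing.glue (pieceHom k W) (jointlySurj_pieceHom hk W)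
    (fun i => (x i).co.map (pbSnd (k i) W ≫ h) (piece_w w (ht i)) m) fun i j Z a b hab => ?_
  have hab' : a.left ≫ pbSnd (k i) W = b.left ≫ pbSnd (k j) W :=
    congrArg (fun f : Z ⟶ W => f.left) hab
  have ha : (a.left ≫ (pb (k i) W).hom) ≫ k i = Z.hom := (Category.assoc _ _ _).trans (left_w a)
  have hb : (b.left ≫ (pb (k j) W).hom) ≫ k j = Z.hom := (Category.assoc _ _ _).trans (left_w b)
  let l : Z.left ⟶ Limits.pullback (k i) (k j) :=
    Limits.pullback.lift (a.left ≫ (pb (k i) W).hom) (b.left ≫ (pb (k j) W).hom) (ha.trans hb.symm)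
  have hl₁ : l ≫ Limits.pullback.fst (k i) (k j) = a.left ≫ (pb (k i) W).hom :=
    Limits.pullback.lift_fst _ _ _
  have hl₂ : l ≫ Limits.pullback.snd (k i) (k j) = b.left ≫ (pb (k j) W).hom :=
    Limits.pullback.lift_snd _ _ _
  have hl : Etale l := etale_lift l (Limits.pullback.fst (k i) (k j) ≫ k i) Z.hom
    inferInstance Z.prop (by rw [← Category.assoc, hl₁, ha])
  let Z' : (Limits.pullback (k i) (k j)).Etale := MorphismProperty.Over.mk ⊤ l hl
  have w₁ : (a.left ≫ pbSnd (k i) W ≫ h) ≫ U.hom =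
      (shr (Limits.pullback.fst (k i) (k j)) Z').hom ≫ (x i).base := by
    exact (whisker_w _ (piece_w w (ht i))).trans (congrArg (· ≫ (x i).base) hl₁).symm
  have w₂ : (b.left ≫ pbSnd (k j) W ≫ h) ≫ U.hom =
      (shr (Limits.pullback.snd (k i) (k j)) Z').hom ≫ (x j).base := by
    exact (whisker_w _ (piece_w w (ht j))).trans (congrArg (· ≫ (x j).base) hl₂).symm
  have e₁ := (x i).co.map_comp_left (V' := shr (Limits.pullback.fst (k i) (k j)) Z')
    (mkHom a.left hl₁.symm) (pbSnd (k i) W ≫ h) (piece_w w (ht i)) w₁ m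
  have e₂ := (x j).co.map_comp_left (V' := shr (Limits.pullback.snd (k i) (k j)) Z')
    (mkHom b.left hl₂.symm) (pbSnd (k j) W ≫ h) (piece_w w (ht j)) w₂ m
  have hh : a.left ≫ pbSnd (k i) W ≫ h = b.left ≫ pbSnd (k j) W ≫ h :=
    comp_comp_congr hab' h
  have w₁' : (a.left ≫ pbSnd (k i) W ≫ h) ≫ U.hom =
      Z'.hom ≫ Limits.pullback.fst (k i) (k j) ≫ (x i).base := w₁.trans (Category.assoc _ _ _)
  have w₂' : (b.left ≫ pbSnd (k j) W ≫ h) ≫ U.hom =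
      Z'.hom ≫ Limits.pullback.snd (k i) (k j) ≫ (x j).base := w₂.trans (Category.assoc _ _ _)
  have e₃ := pull_map (Limits.pullback.fst (k i) (k j)) (x i) (V := Z') _ w₁' w₁ m
  have e₄ := pull_map (Limits.pullback.snd (k i) (k j)) (x j) (V := Z') _ w₂' w₂ m
  refine e₁.symm.trans (e₃.symm.trans (Eq.trans ?_ (e₄.trans e₂)))
  refine (map_eq_of_eq (hx i j) (V := Z') _ w₁' (hh ▸ w₂') m).trans ?_
  exact ((x j).pull (Limits.pullback.snd (k i) (k j))).co.map_congr (V := Z') hh (hh ▸ w₂') m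

/-- The morphisms to `Y` glue by étale descent. The comorphism is then glued value by value, because
`supp T` is a sheaf on the étale site of `T`. -/
theorem existsUnique_glue (hk : ∀ x : T, ∃ (i : ι) (y : V i), k i y = x)
    (x : ∀ i, SuppPoint K (V i))
    (hx : ∀ i j, (x i).pull (Limits.pullback.fst (k i) (k j)) =
      (x j).pull (Limits.pullback.snd (k i) (k j))) : ∃! r : SuppPoint K T, ∀ i, r.pull (k i) =
          x i := by
  obtain ⟨t, ht, htu⟩ := LogGeom.existsUnique_glue k hk (fun i => (x i).base)
    fun i j => congrArg SuppPoint.base (hx i j)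
  have ht' : ∀ i, (x i).base = k i ≫ t := fun i => (ht i).symm
  have hext : ∀ {W : T.Etale} {s s' : (supp T).sec W},
      (∀ i, (supp T).res (pieceHom k W i) s = (supp T).res (pieceHom k W i) s') → s = s' :=
    fun {W s s'} h => (supp_isLog T).gluing.ext _ (jointlySurj_pieceHom hk W) s s' h
  have hex := fun {W : T.Etale} {U : Y.Etale} (h : W.left ⟶ U.left) (w : h ≫ U.hom = W.hom ≫ t)
    (m : K.sec U) => existsUnique_piece hk x hx ht' h w m
  let φ := fun {W : T.Etale} {U : Y.Etale} (h : W.left ⟶ U.left) (w : h ≫ U.hom = W.hom ≫ t)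
    (m : K.sec U) => (hex h w m).choose
  have hφ : ∀ {W : T.Etale} {U : Y.Etale} (h : W.left ⟶ U.left) (w : h ≫ U.hom = W.hom ≫ t)
      (m : K.sec U) (i), (supp T).res (pieceHom k W i) (φ h w m) =
        (x i).co.map (pbSnd (k i) W ≫ h) (piece_w w (ht' i)) m :=
    fun h w m => (hex h w m).choose_spec
  let c : Comorphism t (supp T) K :=
    { map := fun {W U} h w =>
        { toFun := φ h w
          map_one' := hext fun i => (hφ h w 1 i).trans
            ((map_one _).trans (map_one ((supp T).res _)).symm)
          map_mul' := fun m n => hext fun i => (hφ h w (m * n) i).trans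
            ((map_mul _ m n).trans (((map_mul ((supp T).res _) _ _).trans
              (congrArg₂ _ (hφ h w m i) (hφ h w n i))).symm)) }
      map_comp_left := fun {W' W U} l h w w' m => hext fun i => by
        refine (hφ _ w' m i).trans ?_
        have e : pieceHom k W' i ≫ l = shrMap (k i) (pbMap (k i) l) ≫ pieceHom k W i :=
          et_hom_ext (pbMap_snd (k i) l).symm
        refine Eq.trans ?_ ((supp T).res_res (pieceHom k W' i) l (φ h w m)).symm
        refine Eq.trans ?_ (congrArg (fun f => (supp T).res f (φ h w m)) e).symm
        refine Eq.trans ?_ ((supp T).res_res _ (pieceHom k W i) (φ h w m))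
        refine Eq.trans ?_ (congrArg ((supp T).res _) (hφ h w m i)).symm
        exact ((x i).co.res_map (pbMap (k i) l) (piece_w w (ht' i)) (piece_w w' (ht' i)) (by
          rw [← Category.assoc, pbMap_snd, Category.assoc]) m).symm
      map_comp_right := fun {W U' U} h l w w' m => hext fun i => by
        refine (hφ _ w' m i).trans (Eq.trans ?_ (hφ h w _ i).symm)
        exact ((x i).co.map_res l (piece_w w (ht' i)) (piece_w w' (ht' i)) (Category.assoc _ _ _)
          m).symm
      val_map := fun {W U} h w m => (jointlySurj_pieceHom hk W).ext_fun fun i => by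
        refine ((supp T).val_res (pieceHom k W i) (φ h w m)).symm.trans ?_
        refine (congrArg ((supp T).val _) (hφ h w m i)).trans ?_
        exact ((x i).co.val_map _ (piece_w w (ht' i)) m).trans (appTop_comp_apply _ _ _) }
  have wpb : ∀ i {W : (V i).Etale} {U : Y.Etale} {h : W.left ⟶ U.left},
      h ≫ U.hom = W.hom ≫ k i ≫ t → h ≫ U.hom = (shr (k i) W).hom ≫ t :=
    fun i W U h w => w.trans (Category.assoc _ _ _).symm
  refine ⟨⟨t, c⟩, fun i => ext_map (ht i) fun {W U} h w w' m => ?_, fun r hr => ?_⟩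
  · refine (pull_map (k i) ⟨t, c⟩ h w (wpb i w) m).trans ?_
    -- The graph of `W → V i`: it splits the `i`-th piece of `W` viewed over `T`, so the glued value
    -- can be read off on this one piece.
    let σ : W ⟶ pb (k i) (shr (k i) W) := toPb (k i) (𝟙 W.left) (Category.id_comp _)
    have hσ : σ.left ≫ pbSnd (k i) (shr (k i) W) = 𝟙 W.left := toPb_snd _ _ _
    have e : shrMap (k i) σ ≫ pieceHom k (shr (k i) W) i = 𝟙 (shr (k i) W) := et_hom_ext hσ
    refine ((supp T).res_id (shr (k i) W) (φ (W := shr (k i) W) h (wpb i w) m)).symm.trans ?_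
    refine (congrArg (fun f => (supp T).res f (φ (W := shr (k i) W) h (wpb i w) m)) e).symm.trans ?_
    refine ((supp T).res_res _ (pieceHom k (shr (k i) W) i) _).symm.trans ?_
    refine (congrArg ((supp T).res _) (hφ (W := shr (k i) W) h (wpb i w) m i)).trans ?_
    exact (x i).co.res_map σ (piece_w (W := shr (k i) W) (wpb i w) (ht' i)) w'
      (comp_comp_eq hσ h) m
  · have hrt : r.base = t := htu _ fun i => congrArg SuppPoint.base (hr i)
    refine ext_map hrt fun {W U} h w w' m => hext fun i => ?_
    refine Eq.trans ?_ (hφ h w' m i).symm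
    have w₁ : (pbSnd (k i) W ≫ h) ≫ U.hom = (pb (k i) W).hom ≫ k i ≫ r.base := by
      rw [hrt]; exact piece_w w' rfl
    refine Eq.trans ?_ (map_eq_of_eq (hr i) (V := pb (k i) W) _ w₁ (piece_w w' (ht' i)) m)
    refine Eq.trans ?_ (pull_map (k i) r (V := pb (k i) W) _ w₁
      (w₁.trans (Category.assoc _ _ _).symm) m).symm
    exact r.co.res_map (pieceHom k W i) w (w₁.trans (Category.assoc _ _ _).symm) rfl m

end

variable (K) in
/-- The functor of points with support. -/
def functor : PointFunctor Y where
  pt T := SuppPoint K T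
  base x := x.base
  pull k x := x.pull k
  base_pull _ _ := rfl
  pull_id := pull_id
  pull_comp l k x := pull_comp l k x
  glue k _ hk x hx := existsUnique_glue hk x hx

end SuppPoint

end LogGeom
end

noncomputable section

namespace LogGeom

open PrelogStructure Comorphism

/-! ### Morphisms to affine schemes -/

section

variable {T T' : Scheme.{u}} {A B : Type u} [CommRing A] [CommRing B]

/-- The morphism to an affine scheme given by a ring homomorphism. -/
def toSpec (φ : A →+* Γ(T, ⊤)) : T ⟶ Spec (.of A) := T.toSpecΓ ≫ Spec.map (CommRingCat.ofHom φ)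

/-- The ring homomorphism given by a morphism to an affine scheme. -/
def ofSpec (f : T ⟶ Spec (.of A)) : A →+* Γ(T, ⊤) :=
  f.appTop.hom.comp (Scheme.ΓSpecIso (.of A)).inv.hom

lemma ofSpec_comp (k : T' ⟶ T) (f : T ⟶ Spec (.of A)) :
    ofSpec (k ≫ f) = k.appTop.hom.comp (ofSpec f) :=
  RingHom.ext fun a => appTop_comp_apply k f ((Scheme.ΓSpecIso (.of A)).inv.hom a)

lemma ofSpec_comp_map (f : T ⟶ Spec (.of B)) (ψ : A →+* B) :
    ofSpec (f ≫ Spec.map (CommRingCat.ofHom ψ)) = (ofSpec f).comp ψ := by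
  refine RingHom.ext fun a => ?_
  refine (appTop_comp_apply f (Spec.map (CommRingCat.ofHom ψ))
    ((Scheme.ΓSpecIso (.of A)).inv.hom a)).trans ?_
  have := Scheme.ΓSpecIso_inv_naturality (CommRingCat.ofHom ψ)
  exact congrArg (fun l => f.appTop.hom (l.hom a)) this.symm

lemma toSpec_ofSpec (f : T ⟶ Spec (.of A)) : toSpec (ofSpec f) = f := by
  have : CommRingCat.ofHom (ofSpec f) = (Scheme.ΓSpecIso (.of A)).inv ≫ f.appTop := rfl
  rw [toSpec, this, Spec.map_comp, ← Scheme.toSpecΓ_naturality_assoc]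
  simp

lemma ofSpec_toSpec (φ : A →+* Γ(T, ⊤)) : ofSpec (toSpec φ) = φ := by
  rw [toSpec, ofSpec_comp_map]
  have : ofSpec T.toSpecΓ = RingHom.id _ := by
    refine RingHom.ext fun a => ?_
    change T.toSpecΓ.appTop.hom _ = a
    rw [Scheme.toSpecΓ_appTop]
    exact CommRingCat.hom_inv_apply (Scheme.ΓSpecIso Γ(T, ⊤)) a
  rw [this, RingHom.id_comp]

lemma ofSpec_injective {f g : T ⟶ Spec (.of A)} (h : ofSpec f = ofSpec g) : f = g := by
  rw [← toSpec_ofSpec f, h, toSpec_ofSpec]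

end

/-! ### Values on charts -/

section

variable {Y U : Scheme.{u}} {K : PrelogStructure Y} {L : PrelogStructure U} {j : U ⟶ Y}
  (c : Comorphism j L K) {Q : Type u} [CommMonoid Q] (β : Q →* L.sec (topEt U))

/-- The values of a point with support on a chart. -/
def IsVal {T : Scheme.{u}} (t : T ⟶ U) (x : SuppPoint K T) (γ : Q →* supported Γ(T, ⊤)) : Prop :=
  ∃ d : Comorphism t (supp T) L, Factors d c x.co ∧
    ∀ q, (show supported Γ(T, ⊤) from d.top (β q)) = γ q

variable {c β} {T : Scheme.{u}} {t : T ⟶ U} {x y : SuppPoint K T} {γ δ : Q →* supported Γ(T, ⊤)}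

lemma IsVal.snd (h : IsVal c β t x γ) (q : Q) :
    (γ q).1.2 = t.appTop.hom (L.val _ (β q)) := by
  obtain ⟨d, -, hd⟩ := h
  rw [← hd q]
  exact d.top_val (β q)

lemma IsVal.pull (h : IsVal c β t x γ) {T' : Scheme.{u}} (k : T' ⟶ T) (ht : t ≫ j = x.base) :
    IsVal c β (k ≫ t) (x.pull k) ((supportedMap k.appTop.hom).comp γ) := by
  obtain ⟨d, hd, hd'⟩ := h
  refine ⟨(suppCo k).comp d, ?_, fun q => ?_⟩
  · exact ((factors_comp (suppCo k) d).assoc hd rfl ht rfl).1 (SuppPoint.factors_pull k x)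
  · refine ((factors_comp (suppCo k) d).top_eq rfl (β q)).symm.trans ?_
    exact congrArg (supportedMap k.appTop.hom) (hd' q)

/-- The universal property of the chart makes a comorphism from `L` determined by its values on `β`.
-/
lemma IsVal.unique_point (hβ : L.IsChart β) (hx : x.base = t ≫ j) (hy : y.base = t ≫ j)
    (h : IsVal c β t x γ) (h' : IsVal c β t y γ) : x = y := by
  obtain ⟨d, hd, hd₂⟩ := h
  obtain ⟨d', hd', hd₂'⟩ := h'
  have hs : ∀ q, (γ q).1.2 = t.appTop.hom (L.val _ (β q)) := IsVal.snd ⟨d, hd, hd₂⟩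
  have : d = d' := (hβ.existsUnique t (supp_isLog T) γ hs).unique hd₂ hd₂'
  subst this
  obtain ⟨b, cx⟩ := x
  obtain ⟨b', cy⟩ := y
  obtain rfl : b = t ≫ j := hx
  obtain rfl : b' = t ≫ j := hy
  congr 1
  exact hd.unique rfl hd'

lemma IsVal.unique_val (hc : c.IsCart) (hx : x.base = t ≫ j)
    (h : IsVal c β t x γ) (h' : IsVal c β t x δ) : γ = δ := by
  obtain ⟨d, hd, hd₂⟩ := h
  obtain ⟨d', hd', hd₂'⟩ := h'
  have : d = d' := (hc hx.symm (supp_isLog T) x.co).unique hd hd'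
  subst this
  exact MonoidHom.ext fun q => (hd₂ q).symm.trans (hd₂' q)

lemma exists_isVal (hc : c.IsCart) (hx : x.base = t ≫ j) : ∃ γ, IsVal c β t x γ := by
  obtain ⟨d, hd, -⟩ := hc hx.symm (supp_isLog T) x.co
  exact ⟨d.top.comp β, d, hd, fun q => rfl⟩

variable (c) in
-- Together with `IsVal.unique_point`, `IsVal.unique_val` and `exists_isVal`: for a chart `β` and
-- cartesian `c`, points with support over `t ≫ j` are the homomorphisms `γ` whose second coordinate
-- is the value of the chart. Only a multiplicative family of idempotents remains to be chosen.
lemma exists_point (hβ : L.IsChart β)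
    (hγ : ∀ q, (γ q).1.2 = t.appTop.hom (L.val _ (β q))) :
    ∃ x : SuppPoint K T, x.base = t ≫ j ∧ IsVal c β t x γ := by
  obtain ⟨d, hd, -⟩ := hβ.existsUnique t (supp_isLog T) γ hγ
  exact ⟨⟨t ≫ j, d.comp c⟩, rfl, d, factors_comp _ _, hd⟩

end

/-! ### Representability on charts -/

section

variable {S Q : Type u} [CommRing S] [CommMonoid Q] (θ : Q →* S)

/-- The ideal of relations of `supportRing`. -/
def supportIdeal : Ideal (MonoidAlgebra S Q) :=
  Ideal.span (Set.range (fun q => MonoidAlgebra.of S Q q * MonoidAlgebra.of S Q q -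
      MonoidAlgebra.of S Q q) ∪
    Set.range fun q => algebraMap S _ (θ q) * MonoidAlgebra.of S Q q - algebraMap S _ (θ q))

/-- The universal ring with a multiplicative system of idempotents `e q` such that
`e q * θ q = θ q`. -/
abbrev SupportRing : Type u := MonoidAlgebra S Q ⧸ supportIdeal θ

/-- The universal idempotents. -/
def supportIdem : Q →* SupportRing θ :=
  (Ideal.Quotient.mk (supportIdeal θ) : _ →* _).comp (MonoidAlgebra.of S Q)

lemma supportIdem_mul_self (q : Q) : supportIdem θ q * supportIdem θ q = supportIdem θ q := by
  have : MonoidAlgebra.of S Q q * MonoidAlgebra.of S Q q - MonoidAlgebra.of S Q q ∈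
    supportIdeal θ := Ideal.subset_span (Or.inl ⟨q, rfl⟩)
  have := (Ideal.Quotient.mk_eq_mk_iff_sub_mem _ _).2 this
  rwa [map_mul] at this

lemma supportIdem_mul (q : Q) : supportIdem θ q * algebraMap S (SupportRing θ) (θ q) =
    algebraMap S (SupportRing θ) (θ q) := by
  have : algebraMap S _ (θ q) * MonoidAlgebra.of S Q q - algebraMap S _ (θ q) ∈
    supportIdeal θ := Ideal.subset_span (Or.inr ⟨q, rfl⟩)
  have := (Ideal.Quotient.mk_eq_mk_iff_sub_mem _ _).2 this
  rw [map_mul] at this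
  rw [mul_comm]
  exact this

lemma existsUnique_supportRing_hom {D : Type u} [CommRing D] (f : S →+* D) (e : Q →* D)
    (he : ∀ q, e q * e q = e q) (he' : ∀ q, e q * f (θ q) = f (θ q)) :
    ∃! ψ : SupportRing θ →+* D, ψ.comp (algebraMap S (SupportRing θ)) = f ∧
      ∀ q, ψ (supportIdem θ q) = e q := by
  let _ : Algebra S D := f.toAlgebra
  let ψ₀ : MonoidAlgebra S Q →ₐ[S] D := MonoidAlgebra.lift S D Q e
  have h₀ : ∀ q, ψ₀ (MonoidAlgebra.of S Q q) = e q := fun q => MonoidAlgebra.lift_of _ _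
  have h₁ : ∀ s, ψ₀ (algebraMap S _ s) = f s := fun s => ψ₀.commutes s
  have hI : supportIdeal θ ≤ RingHom.ker ψ₀.toRingHom := by
    refine Ideal.span_le.2 ?_
    rintro _ (⟨q, rfl⟩ | ⟨q, rfl⟩)
    · change ψ₀ _ = 0
      rw [map_sub, map_mul, h₀, he, sub_self]
    · change ψ₀ _ = 0
      rw [map_sub, map_mul, h₀, h₁, mul_comm, he', sub_self]
  refine ⟨Ideal.Quotient.lift _ ψ₀.toRingHom fun a ha => hI ha, ⟨RingHom.ext h₁, h₀⟩, ?_⟩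
  rintro ψ ⟨hψ, hψ'⟩
  refine Ideal.Quotient.ringHom_ext (MonoidAlgebra.ringHom_ext (fun s => ?_) fun q => ?_)
  · refine (congrArg (fun l => l s) hψ).trans ?_
    exact (h₁ s).symm
  · exact (hψ' q).trans (h₀ q).symm

end

/-! ### The functor of supports over an affine chart -/

section

variable {Y U : Scheme.{u}} {K : PrelogStructure Y} {L : PrelogStructure U} {j : U ⟶ Y}
  {c : Comorphism j L K} {Q : Type u} [CommMonoid Q] {β : Q →* L.sec (topEt U)}

/-- By the dictionary between points and their values, a point over `Spec S` is a multiplicative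
family of idempotents fixing the functions `θ q`, and `SupportRing θ` carries the universal one. -/
lemma exists_isRep_chart (hc : c.IsCart) (hβ : L.IsChart β) {S : Type u} [CommRing S]
    (r : Spec (.of S) ⟶ U) :
    ∃ (C : Type u) (_ : CommRing C) (_ : Algebra S C) (x : (SuppPoint.functor K).pt (Spec (.of C))),
      (SuppPoint.functor K).IsRep (r ≫ j) (Spec.map (CommRingCat.ofHom (algebraMap S C))) x := by
  let θ : Q →* S := (((Scheme.ΓSpecIso (.of S)).hom.hom.comp r.appTop.hom :
    Γ(U, ⊤) →+* S) : Γ(U, ⊤) →* S).comp ((L.val (topEt U)).comp β)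
  have hθ : ∀ {T : Scheme.{u}} (t : T ⟶ Spec (.of S)) (q : Q),
      ofSpec t (θ q) = (t ≫ r).appTop.hom (L.val (topEt U) (β q)) := by
    intro T t q
    refine Eq.trans ?_ (appTop_comp_apply t r _).symm
    exact congrArg (fun l => t.appTop.hom l) (CommRingCat.inv_hom_apply (Scheme.ΓSpecIso (.of S)) _)
  let C := SupportRing θ
  let a : Spec (.of C) ⟶ Spec (.of S) := Spec.map (CommRingCat.ofHom (algebraMap S C))
  have ha : ∀ {T : Scheme.{u}} (g : T ⟶ Spec (.of C)), ofSpec (g ≫ a) =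
      (ofSpec g).comp (algebraMap S C) := fun g => ofSpec_comp_map g _
  let i : C →+* Γ(Spec (.of C), ⊤) := ofSpec (𝟙 _)
  have hi : ∀ {T : Scheme.{u}} (g : T ⟶ Spec (.of C)) (z : C), g.appTop.hom (i z) = ofSpec g z := by
    intro T g z
    rw [← Category.comp_id g, ofSpec_comp, Category.comp_id]
    rfl
  have hia : ∀ q, i (algebraMap S C (θ q)) = (a ≫ r).appTop.hom (L.val (topEt U) (β q)) := by
    intro q
    rw [← hθ a q, ← Category.id_comp a, ha]
    rfl
  let γ : Q →* supported Γ(Spec (.of C), ⊤) :=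
    { toFun := fun q => ⟨(i (supportIdem θ q), i (algebraMap S C (θ q))), by
        rw [← map_mul, supportIdem_mul_self], by rw [← map_mul, supportIdem_mul]⟩
      map_one' := Subtype.ext (Prod.ext (by simp) (by simp))
      map_mul' := fun p q => Subtype.ext (Prod.ext (by simp) (by simp)) }
  obtain ⟨x, hx, hxv⟩ := exists_point c (t := a ≫ r) (γ := γ) hβ hia
  have hx' : x.base = a ≫ r ≫ j := by rw [hx, Category.assoc]
  refine ⟨C, inferInstance, inferInstance, x, hx', fun {T} t x' hx'b => ?_⟩
  have hb : x'.base = (t ≫ r) ≫ j := by rw [Category.assoc]; exact hx'b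
  obtain ⟨δ, hδ⟩ := exists_isVal (t := t ≫ r) (β := β) hc hb
  -- The second coordinates are fixed by the morphism to `U`, so equality of points is equality of
  -- idempotents.
  have key : ∀ g : T ⟶ Spec (.of C), g ≫ a = t →
      (x.pull g = x' ↔ ∀ q, ofSpec g (supportIdem θ q) = (δ q).1.1) := by
    intro g hg
    have hp := hxv.pull g hx.symm
    have hgt : g ≫ a ≫ r = t ≫ r := by rw [← Category.assoc, hg]
    rw [hgt] at hp
    have hpb : (x.pull g).base = (t ≫ r) ≫ j := by
      change g ≫ x.base = _
      rw [hx, ← Category.assoc, hgt]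
    constructor
    · intro h q
      rw [h] at hp
      rw [hδ.unique_val hc hb hp, ← hi]
      rfl
    · intro h
      refine hp.unique_point hβ hpb hb ?_
      convert hδ using 1
      refine MonoidHom.ext fun q => Subtype.ext (Prod.ext ?_ ?_)
      · exact (hi g _).trans (h q)
      · rw [hδ.snd q, hp.snd q]
  have hδs : ∀ q, (δ q).1.2 = ofSpec t (θ q) := fun q => (hδ.snd q).trans (hθ t q).symm
  obtain ⟨ψ, ⟨hψ, hψ'⟩, hu⟩ := existsUnique_supportRing_hom θ (ofSpec t)
    (((MonoidHom.fst _ _).comp (Submonoid.subtype _)).comp δ) (fun q => (δ q).2.1) fun q => by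
      rw [← hδs]
      exact (δ q).2.2
  refine ⟨toSpec ψ, ⟨?_, ?_⟩, fun g ⟨hg, hg'⟩ => ?_⟩
  · exact ofSpec_injective (by rw [ha, ofSpec_toSpec, hψ])
  · exact (key _ (ofSpec_injective (by rw [ha, ofSpec_toSpec, hψ]))).2 fun q => by
      rw [ofSpec_toSpec]
      exact hψ' q
  · refine ofSpec_injective ?_
    rw [ofSpec_toSpec]
    exact hu _ ⟨by rw [← ha, hg], (key g hg).1 hg'⟩

end

end LogGeom
end

noncomputable section

namespace LogGeom

open PrelogStructure Comorphism

/-! ### Existence of the universal support -/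

/-- The image of an étale morphism is open, so an affine neighbourhood can be shrunk into the image
to obtain an étale surjection. Working inside an affine `V₀` keeps the source affine without
separatedness of `Y`. -/
lemma exists_affine_etale_cover {Y U : Scheme.{u}} (j : U ⟶ Y) [Etale j] (z : U) :
    ∃ (V : Y.Opens) (B' : Scheme.{u}) (i : B' ⟶ U) (p : B' ⟶ V), j z ∈ V ∧ IsAffine V ∧
      IsAffine B' ∧ Etale p ∧ Surjective p ∧ p ≫ V.ι = i ≫ j := by
  obtain ⟨V₀, hV₀, hy₀, -⟩ := exists_isAffineOpen_mem_and_subset (X := Y) (x := j z) (U :=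
      ⊤) trivial
  obtain ⟨U₁, hU₁, hz, hle⟩ := exists_isAffineOpen_mem_and_subset (X := U) (x := z)
    (U := j ⁻¹ᵁ V₀) hy₀
  have : IsAffine V₀ := hV₀
  have : IsAffine U₁ := hU₁
  let q : U₁.toScheme ⟶ Y := U₁.ι ≫ j
  have hq : Etale q := inferInstanceAs (Etale (U₁.ι ≫ j))
  let q' : U₁.toScheme ⟶ V₀ := liftOpen q V₀ fun x => hle x.2
  have hq' : q' ≫ V₀.ι = q := liftOpen_ι _ _ _
  have hq'e : Etale q' := SuppPoint.etale_lift q' V₀.ι q inferInstance hq hq'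
  have hopen : IsOpen (Set.range q) := q.isOpenMap.isOpen_range
  obtain ⟨V, hV, hyV, hVle⟩ := exists_isAffineOpen_mem_and_subset (X := Y) (x := j z)
    (U := V₀ ⊓ ⟨Set.range q, hopen⟩) ⟨hy₀, ⟨⟨z, hz⟩, rfl⟩⟩
  have hV' : IsAffineOpen (V₀.ι ⁻¹ᵁ V) := by
    refine hV.preimage_of_isOpenImmersion V₀.ι ?_
    rw [Scheme.Opens.opensRange_ι]
    exact fun y hy => (hVle hy).1
  -- The morphism `q'` goes between affine schemes, so it pulls affine opens back to affine opens.
  have hW : IsAffineOpen (q' ⁻¹ᵁ V₀.ι ⁻¹ᵁ V) := hV'.preimage q'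
  let W := q' ⁻¹ᵁ V₀.ι ⁻¹ᵁ V
  have hWV : ∀ w, w ∈ W ↔ q w ∈ V := fun w => by
    rw [← hq', Scheme.Hom.comp_apply]
    rfl
  let p : W.toScheme ⟶ V := liftOpen (W.ι ≫ q) V fun x => by
    rw [Scheme.Hom.comp_apply]
    exact (hWV _).1 x.2
  have hp : p ≫ V.ι = W.ι ≫ q := liftOpen_ι _ _ _
  refine ⟨V, W, W.ι ≫ U₁.ι, p, hyV, hV, hW,
    SuppPoint.etale_lift p V.ι _ inferInstance (inferInstanceAs (Etale (W.ι ≫ q))) hp, ⟨?_⟩, ?_⟩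
  · intro v
    obtain ⟨w, hw⟩ : v.1 ∈ Set.range q := (hVle v.2).2
    have hwW : w ∈ W := (hWV w).2 (by rw [hw]; exact v.2)
    refine ⟨⟨w, hwW⟩, Subtype.ext ?_⟩
    have := congrArg (fun f : W.toScheme ⟶ Y => f ⟨w, hwW⟩) hp
    exact ((Scheme.Hom.comp_apply _ _ _).symm.trans this).trans
      ((Scheme.Hom.comp_apply _ _ _).trans hw)
  · rw [hp, Category.assoc]

lemma PointFunctor.IsRep.affine_descend' {Y : Scheme.{u}} {G : PointFunctor Y} {B B' : Scheme.{u}}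
    [IsAffine B] [IsAffine B'] {b : B ⟶ Y} (p : B' ⟶ B) [Etale p] [Surjective p]
    (h : ∀ (S : Type u) [CommRing S] (e : Spec (.of S) ⟶ B'), ∃ (C : Type u) (_ : CommRing C)
      (_ : Algebra S C) (x : G.pt (Spec (.of C))), G.IsRep (e ≫ p ≫ b)
        (Spec.map (CommRingCat.ofHom (algebraMap S C))) x) :
    ∃ (A : Scheme.{u}) (a : A ⟶ B) (x : G.pt A), G.IsRep b a x := by
  let _ : Algebra Γ(B, ⊤) Γ(B', ⊤) := p.appTop.hom.toAlgebra
  have hp : Spec.map (CommRingCat.ofHom (algebraMap Γ(B, ⊤) Γ(B', ⊤))) =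
      B'.isoSpec.inv ≫ p ≫ B.isoSpec.hom := by
    have := Scheme.isoSpec_inv_naturality p
    rw [← Category.assoc, ← this, Category.assoc, Iso.inv_hom_id, Category.comp_id]
    rfl
  obtain ⟨C, _, _, x, hx⟩ := h Γ(B', ⊤) B'.isoSpec.inv
  have hb : B'.isoSpec.inv ≫ p ≫ b = Spec.map (CommRingCat.ofHom (algebraMap Γ(B, ⊤) Γ(B', ⊤))) ≫
      B.isoSpec.inv ≫ b := by
    rw [hp]
    simp
  rw [hb] at hx
  have : Etale (Spec.map (CommRingCat.ofHom (algebraMap Γ(B, ⊤) Γ(B', ⊤)))) := by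
    rw [hp]; infer_instance
  have : Surjective (Spec.map (CommRingCat.ofHom (algebraMap Γ(B, ⊤) Γ(B', ⊤)))) := by
    rw [hp]; infer_instance
  obtain ⟨A₀, a₀, x₀, h₀⟩ := hx.affine_descend
  have := exists_pullback_opens h₀ B.isoSpec.hom
  rwa [Iso.hom_inv_id_assoc] at this

/-- The functor of points with support of a log scheme is representable. -/
theorem LogScheme.exists_isRep (Y : LogScheme.{u}) :
    ∃ (E : Scheme.{u}) (e : E ⟶ Y.toScheme) (x : (SuppPoint.functor Y.str).pt E),
      (SuppPoint.functor Y.str).IsRep (𝟙 Y.toScheme) e x := by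
  refine PointFunctor.exists_isRep_id fun y => ?_
  obtain ⟨U, j, L, c, Q, _, β, hj, ⟨z, rfl⟩, hL, hc, -, hβ⟩ := Y.exists_chart y
  obtain ⟨V, B', i, p, hzV, _, _, hp, hps, hw⟩ := exists_affine_etale_cover j z
  refine ⟨V, hzV, PointFunctor.IsRep.affine_descend' p fun S _ e => ?_⟩
  rw [hw, ← Category.assoc]
  exact exists_isRep_chart hc.isCart hβ (e ≫ i)

end LogGeom
end

noncomputable section

namespace LogGeom

open PrelogStructure Comorphism

/-! ### Factorizations of pointed comorphisms -/

namespace Comorphism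

section

variable {T X Y : Scheme.{u}} {e : T ⟶ X} {f : X ⟶ Y} {g : T ⟶ Y} {N : PrelogStructure T}
  {L : PrelogStructure X} {K : PrelogStructure Y}

lemma resOver_comp {V : T.Etale} {W : X.Etale} {U : Y.Etale} (h : V.left ⟶ W.left)
    (k : W.left ⟶ U.left) (D : U.left.Opens) (E : V.left.Opens) (e' : E ≤ h ⁻¹ᵁ k ⁻¹ᵁ D)
    (e'' : E ≤ (h ≫ k) ⁻¹ᵁ D) :
    resOver h (k ⁻¹ᵁ D) E e' ≫ resOver k D (k ⁻¹ᵁ D) le_rfl = resOver (h ≫ k) D E e'' :=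
  restr_left_ext (by
    rw [Category.assoc, resOver_ιl, ← Category.assoc, resOver_ιl, resOver_ιl, Category.assoc])

lemma Factors.pointed {a : Comorphism e N L} {b : Comorphism f L K} {c : Comorphism g N K}
    (H : Factors a b c) : Factors a.pointed b.pointed c.pointed :=
  ⟨fun {V W U} h k w₁ w₂ w₃ s => (c.pmap_eq (w := w₃) (t := a.pmap h w₁ (b.pmap k w₂ s)) rfl
    (H.map_eq (resOver_w h w₁ _ _ _) (resOver_w k w₂ _ _ _) (resOver_w _ w₃ _ _ _)
      (resOver_comp h k _ _ _ _) _)).symm⟩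

lemma toSupp_pmap (a : Comorphism e N L) {V : T.Etale} {W : X.Etale} (h : V.left ⟶ W.left)
    (w : h ≫ W.hom = V.hom ≫ e) (s : L.PSec W) :
    PSec.toSupp V (a.pmap h w s) = supportedMap h.appTop.hom (PSec.toSupp W s) :=
  Subtype.ext (Prod.ext (ind_preimage h s.D s.isClosed _) (a.pointed.val_map h w s))

lemma Factors.support {a : Comorphism e N L} {b : Comorphism f L.pointed K}
    {c : Comorphism g N.pointed K} (H : Factors a.pointed b c) :
    Factors (suppCo e) b.support c.support :=
  ⟨fun {V W U} h k w₁ w₂ w₃ m => (toSupp_pmap a h w₁ (b.map k w₂ m)).symm.trans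
    (congrArg (PSec.toSupp V) (H.eq h k w₁ w₂ w₃ m))⟩

lemma exists_factors (a : Comorphism e N L) (b : Comorphism f L K) (hg : e ≫ f = g) :
    ∃ c : Comorphism g N K, Factors a b c := by
  subst hg
  exact ⟨_, factors_comp a b⟩

lemma Factors.onSec {a : Comorphism e N.pointed L.pointed} {b : Comorphism f L.pointed K.pointed}
    {c : Comorphism g N.pointed K.pointed} (H : Factors a b c) : Factors a b.onSec c.onSec :=
  ⟨fun {V W U} h k w₁ w₂ w₃ m => H.eq h k w₁ w₂ w₃ (PSec.ofSec m)⟩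

lemma factors_pointed_onSec_iff {a : Comorphism e N.pointed L.pointed} {b : Comorphism f L K}
    {c : Comorphism g N.pointed K} : Factors a b.pointed.onSec c ↔ Factors a.onSec b c := by
  constructor
  · intro H
    refine ⟨fun {V W U} h k w₁ w₂ w₃ m => Eq.trans ?_ (H.eq h k w₁ w₂ w₃ m)⟩
    exact congrArg (a.map h w₁) (b.pointed_ofSec k w₂ m).symm
  · intro H
    refine ⟨fun {V W U} h k w₁ w₂ w₃ m => Eq.trans ?_ (H.eq h k w₁ w₂ w₃ m)⟩
    exact congrArg (a.map h w₁) (b.pointed_ofSec k w₂ m)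

end

/-! ### The lifting property of the universal log structure -/

section

variable {W U : Scheme.{u}} {w : W ⟶ U} {M : PrelogStructure W} {L : PrelogStructure U}

/-- Morphisms to `M` are the same as pointed comorphisms with the given support. -/
def IsUniv (ω : Comorphism w M.pointed L) : Prop :=
  ∀ {T : Scheme.{u}} {h : T ⟶ W} {g : T ⟶ U} (_ : h ≫ w = g) {N : PrelogStructure T}
    (_ : N.IsLog) (c : Comorphism g N.pointed L), Factors (suppCo h) ω.support c.support →
    ∃! d : Comorphism h N M, Factors d.pointed ω c

lemma univCo_isUniv (ξ : Comorphism w (supp W) L) : ξ.univCo.IsUniv := by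
  intro T h g hg N hN c H
  rw [univCo_support] at H
  exact existsUnique_lift hg hN c H

lemma IsUniv.restrict {ω : Comorphism w M.pointed L} (hω : ω.IsUniv) {W' : Scheme.{u}} {k : W' ⟶ W}
    {w' : W' ⟶ U} (hk : k ≫ w = w') {M' : PrelogStructure W'} {κ : Comorphism k M' M}
    (hκ : κ.IsCart) {ω' : Comorphism w' M'.pointed L} (H : Factors κ.pointed ω ω') :
    ω'.IsUniv := by
  intro T h g hg N hN c hc
  have hg' : (h ≫ k) ≫ w = g := by rw [Category.assoc, hk, hg]
  have hc' : Factors (suppCo (h ≫ k)) ω.support c.support :=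
    ((suppCo_factors h k).assoc H.support rfl hk hg).1 hc
  obtain ⟨d₁, hd₁, hu₁⟩ := hω hg' hN c hc'
  obtain ⟨d, hd, hu⟩ := hκ rfl hN d₁
  refine ⟨d, (hd.pointed.assoc H rfl hk hg).2 hd₁, fun d₂ hd₂ => hu _ ?_⟩
  have h₂ := factors_comp d₂ κ
  rwa [hu₁ _ ((h₂.pointed.assoc H rfl hk hg).1 hd₂)] at h₂

/-- Since `c` is cartesian, comorphisms into `N ∪ {∞}` starting from `L` can be compared after
composition with `c`, so universality over `Y` descends to universality over `U`. -/
lemma IsUniv.of_cart {Y : Scheme.{u}} {j : U ⟶ Y} {K : PrelogStructure Y} {c : Comorphism j L K}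
    (hc : c.IsCart) {ω : Comorphism w M.pointed L} {v : W ⟶ Y} (hv : w ≫ j = v)
    {ω' : Comorphism v M.pointed K} (H : Factors ω c ω') (hω' : ω'.IsUniv) : ω.IsUniv := by
  intro T h g hg N hN a ha
  have hg' : h ≫ v = g ≫ j := by rw [← hv, ← Category.assoc, hg]
  have H' : Factors ω.support c ω'.support := H.post _ _
  have e : Factors a.support c (a.comp c).support := (factors_comp a c).post _ _
  obtain ⟨d, hd, hu⟩ := hω' hg' hN (a.comp c) ((ha.assoc H' hg hv hg').2 e)
  refine ⟨d, ?_, fun d₂ hd₂ => hu _ ((hd₂.assoc H hg hv hg').2 (factors_comp a c))⟩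
  subst hg
  have h₁ := factors_comp d.pointed ω
  have h₂ := (h₁.assoc H rfl hv hg').1 hd
  rwa [(hc rfl (pointed_isLog hN) _).unique h₂ (factors_comp a c)] at h₁

end

end Comorphism

/-! ### Restriction of log schemes along étale morphisms -/

/-- Morphisms out of `N` over the identity are comorphisms out of `L` along `f`, and those are
classified by their values on `β`. -/
lemma PrelogStructure.IsChart.of_cart {T U : Scheme.{u}} {L : PrelogStructure U} {Q : Type u}
    [CommMonoid Q] {β : Q →* L.sec (topEt U)} (hβ : L.IsChart β) {f : T ⟶ U}
    {N : PrelogStructure T} {a : Comorphism f N L} (ha : a.IsCart) : N.IsChart (a.top.comp β) := by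
  refine isChart_of fun N' hN' γ hγ => ?_
  obtain ⟨d, hd, hu⟩ := hβ.existsUnique f hN' γ fun q => (hγ q).trans (a.top_val _)
  obtain ⟨d', hd', hu'⟩ := ha (Category.id_comp f) hN' d
  refine ⟨d', fun q => (hd'.top_eq (Category.id_comp f) _).trans (hd q), fun d₂ hd₂ => hu' _ ?_⟩
  obtain ⟨b, hb⟩ := exists_factors d₂ a (Category.id_comp f)
  rwa [hu b fun q => (hb.top_eq (Category.id_comp f) _).symm.trans (hd₂ q)] at hb

namespace LogScheme

variable (X : LogScheme.{u})

/-- The restriction of a log scheme along an étale morphism. -/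
def restrict {T : Scheme.{u}} (j : T ⟶ X.toScheme) [Etale j] : LogScheme where
  toScheme := T
  str := X.str.restrict j
  isLog := restrict_isLog j X.isLog
  exists_chart x := by
    obtain ⟨U, j', K, c, Q, _, β, hj', ⟨y, hy⟩, hK, hc, hQ, hβ⟩ := X.exists_chart (j x)
    obtain ⟨z, hz, -⟩ := Scheme.Pullback.exists_preimage_pullback (f := j) (g := j') x y hy.symm
    let p := Limits.pullback.fst j j'
    let q := Limits.pullback.snd j j'
    have hw : p ≫ j = q ≫ j' := Limits.pullback.condition
    have h₁ : (X.str.restrictCo j).IsCart := restrictCo_isCart j X.str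
    have h₂ : (K.restrictCo q).IsCart := restrictCo_isCart q K
    obtain ⟨d, hd, -⟩ := h₁ hw (restrict_isLog q hK) ((K.restrictCo q).comp c)
    have h₃ : ((K.restrictCo q).comp c).IsCart := h₂.comp hc.isCart (factors_comp _ _) rfl
    have h₄ : d.IsCart := h₁.of_comp h₃ hd hw
    exact ⟨_, p, K.restrict q, d, Q, inferInstance, _, inferInstance, ⟨z, hz⟩,
      restrict_isLog q hK, h₄.isStrict, hQ, hβ.of_cart h₂⟩

/-- The canonical morphism from a restriction. -/
def restrictHom {T : Scheme.{u}} (j : T ⟶ X.toScheme) [Etale j] : LogHom (X.restrict j) X :=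
  ⟨j, X.str.restrictCo j⟩

lemma restrictHom_isCart {T : Scheme.{u}} (j : T ⟶ X.toScheme) [Etale j] :
    (X.restrictHom j).comor.IsCart := restrictCo_isCart j X.str

section

variable {S T : Scheme.{u}} {i : S ⟶ X.toScheme} {j : T ⟶ X.toScheme} [Etale i] [Etale j]

lemma exists_restrictMap (h : S ⟶ T) (w : h ≫ j = i) : ∃ d : Comorphism h (X.str.restrict i)
    (X.str.restrict j),
    Factors d (X.str.restrictCo j) (X.str.restrictCo i) :=
  (restrictCo_isCart j X.str w (restrict_isLog i X.isLog) _).exists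

/-- The functoriality of restrictions. -/
def restrictMap (h : S ⟶ T) (w : h ≫ j = i) : LogHom (X.restrict i) (X.restrict j) := ⟨h,
    (X.exists_restrictMap h w).choose⟩

lemma restrictMap_factors (h : S ⟶ T) (w : h ≫ j = i) : Factors (X.restrictMap h w).comor
    (X.restrictHom j).comor
    (X.restrictHom i).comor := (X.exists_restrictMap h w).choose_spec

lemma restrictMap_isCart (h : S ⟶ T) (w : h ≫ j = i) : (X.restrictMap h w).comor.IsCart := by
  have h₁ : (X.restrictHom j).comor.IsCart := X.restrictHom_isCart j
  have h₂ : (X.restrictHom i).comor.IsCart := X.restrictHom_isCart i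
  exact fun {_ _ _} hg {_} hN d =>
    IsCart.of_comp h₁ h₂ (X.restrictMap_factors h w) w hg hN d

lemma restrictMap_comp_factors (h : S ⟶ T) (w : h ≫ j = i) {R : Scheme.{u}} {l : R ⟶ X.toScheme}
    [Etale l] (h' : R ⟶ S)
    (w' : h' ≫ i = l) (w'' : (h' ≫ h) ≫ j = l) : Factors (X.restrictMap h' w').comor
      (X.restrictMap h w).comor (X.restrictMap (h' ≫ h) w'').comor := by
  have h₁ := factors_comp (X.restrictMap h' w').comor (X.restrictMap h w).comor
  have h₂ := (h₁.assoc (X.restrictMap_factors h w) rfl w w').1 (X.restrictMap_factors h' w')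
  have h₃ : (X.restrictHom j).comor.IsCart := X.restrictHom_isCart j
  rwa [(h₃ w'' (X.restrict l).isLog _).unique h₂ (X.restrictMap_factors (h' ≫ h) w'')] at h₁

end

end LogScheme

/-! ### Pointed morphisms -/

namespace PointedHom

variable {X Y Z : LogScheme.{u}}

/-- The pointed morphism given by its values on sections. -/
def ofCo {f : X.toScheme ⟶ Y.toScheme} (c : Comorphism f X.str.pointed Y.str) : PointedHom X Y :=
  ⟨f, extend X.isLog.gluing c, fun h w => extend_preservesInfty X.isLog.gluing c h w⟩

lemma ofCo_onSec {f : X.toScheme ⟶ Y.toScheme} (c : Comorphism f X.str.pointed Y.str) :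
    (ofCo c).comor.onSec = c := extend_onSec _ _

lemma comp_eq_iff {f : PointedHom X Y} {g : PointedHom Y Z} {h : PointedHom X Z}
    (hb : f.base ≫ g.base = h.base) :
    f.comp g = h ↔ Factors f.comor g.comor.onSec h.comor.onSec := by
  constructor
  · rintro rfl
    exact Factors.onSec (factors_comp f.comor g.comor)
  · intro H
    obtain ⟨b, c, hc⟩ := h
    obtain rfl : f.base ≫ g.base = b := hb
    refine PointedHom.ext rfl (heq_of_eq ?_)
    refine PreservesInfty.ext (f.comp g).map_infty hc X.isLog.gluing Z.isLog.gluing ?_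
    exact Factors.unique rfl (Factors.onSec (factors_comp f.comor g.comor)) H

lemma comp_assoc {T : LogScheme.{u}} (f : PointedHom X Y) (g : PointedHom Y Z)
    (h : PointedHom Z T) : (f.comp g).comp h = f.comp (g.comp h) := by
  have e : (f.comp g).base ≫ h.base = (f.comp (g.comp h)).base := Category.assoc _ _ _
  refine (comp_eq_iff e).2 ?_
  exact ((factors_comp f.comor g.comor).assoc (factors_comp g.comor h.comor).onSec rfl rfl e.symm).1
    (factors_comp f.comor (g.comp h).comor).onSec

lemma comp_toPointed_eq_iff {f : PointedHom X Y} {g : LogHom Y Z} {h : PointedHom X Z}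
    (hb : f.base ≫ g.base = h.base) :
    f.comp g.toPointed = h ↔ Factors f.comor.onSec g.comor h.comor.onSec :=
  (comp_eq_iff hb).trans factors_pointed_onSec_iff

lemma _root_.LogGeom.LogHom.toPointed_comp {f : LogHom X Y} {g : LogHom Y Z} {h : LogHom X Z}
    (hb : f.base ≫ g.base = h.base) (H : Factors f.comor g.comor h.comor) :
    f.toPointed.comp g.toPointed = h.toPointed :=
  (comp_eq_iff hb).2 (Factors.onSec H.pointed)

lemma exists_strict_lift {f : PointedHom X Z} {g : LogHom Y Z} (hg : g.comor.IsCart)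
    (t : X.toScheme ⟶ Y.toScheme) (ht : t ≫ g.base = f.base) :
    ∃ h : PointedHom X Y, h.base = t ∧ h.comp g.toPointed = f := by
  obtain ⟨d, hd, -⟩ := hg ht (pointed_isLog X.isLog) f.comor.onSec
  refine ⟨ofCo d, rfl, (comp_toPointed_eq_iff ht).2 ?_⟩
  rwa [ofCo_onSec]

end PointedHom

end LogGeom
end

set_option linter.unusedSectionVars false

noncomputable section

namespace LogGeom

open PrelogStructure Comorphism

/-! ### The universal support over a chart -/

/-- `ω` is a universal pointed comorphism to a log scheme with a chart. -/
structure IsChartUniv {U : LogScheme.{u}} {Q : Type u} [CommMonoid Q]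
    (β : Q →* U.str.sec (topEt U.toScheme)) {W : Scheme.{u}} {w : W ⟶ U.toScheme}
    {M : PrelogStructure W} (ω : Comorphism w M.pointed U.str) : Prop where
  isLog : M.IsLog
  isChart : U.str.IsChart β
  lift : ω.IsUniv
  rep : ∀ {T : Scheme.{u}} (a : T ⟶ U.toScheme) (γ : Q →* supported Γ(T, ⊤)),
    (∀ q, (γ q).1.2 = a.appTop.hom (U.str.val _ (β q))) → ∃! g : T ⟶ W, g ≫ w = a ∧
      ∀ q, supportedMap g.appTop.hom
        (show supported Γ(W, ⊤) from ω.support.top (β q)) = γ q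

/-- The lifting property is that of `univCo`, restricted along `k` and then transferred from `Y` to
`U`. The description of morphisms to `W` is base change of representability, with points translated
into values on the chart. -/
lemma IsChartUniv.of_isRep {Y U : LogScheme.{u}} {E W : Scheme.{u}} {x : SuppPoint Y.str E}
    (hx : (SuppPoint.functor Y.str).IsRep (𝟙 Y.toScheme) x.base x) {j : LogHom U Y}
    (hj : j.comor.IsCart) {Q : Type u} [CommMonoid Q] {β : Q →* U.str.sec (topEt U.toScheme)}
    (hβ : U.str.IsChart β) {k : W ⟶ E} {w : W ⟶ U.toScheme} (hW : IsPullback k w x.base j.base)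
    {M : PrelogStructure W} (hM : M.IsLog) {κ : Comorphism k M x.co.univLog} (hκ : κ.IsCart)
    {ω₁ : Comorphism (k ≫ x.base) M.pointed Y.str} (H₁ : Factors κ.pointed x.co.univCo ω₁)
    {ω : Comorphism w M.pointed U.str} (H : Factors ω j.comor ω₁) : IsChartUniv β ω := by
  refine ⟨hM, hβ, ?_, fun {T} a γ hγ => ?_⟩
  · have h₁ : ω₁.IsUniv := fun {_ _ _} hg {_} hN c =>
      IsUniv.restrict (univCo_isUniv x.co) rfl hκ H₁ hg hN c
    exact fun {_ _ _} hg {_} hN c => IsUniv.of_cart hj hW.w.symm H h₁ hg hN c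
  · have hR : (SuppPoint.functor Y.str).IsRep j.base w (x.pull k) :=
      hx.baseChange hW (Category.comp_id _)
    obtain ⟨x', hx', hv⟩ := exists_point j.comor hβ hγ
    have hval : IsVal j.comor β w (x.pull k) (ω.support.top.comp β) := by
      refine ⟨ω.support, ?_, fun q => rfl⟩
      have h₁ : Factors (suppCo k) x.co ω₁.support := by
        have := H₁.support
        rwa [univCo_support] at this
      have h₂ : ω₁.support = (x.pull k).co := h₁.unique rfl (factors_comp _ _)
      rw [← h₂]
      exact H.post _ _
    have hb : (x.pull k).base = w ≫ j.base := hW.w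
    have key : ∀ g : T ⟶ W, g ≫ w = a → ((x.pull k).pull g = x' ↔
        ∀ q, supportedMap g.appTop.hom
          (show supported Γ(W, ⊤) from ω.support.top (β q)) = γ q) := by
      intro g hg
      have hp := hval.pull g hb.symm
      rw [hg] at hp
      have hpb : ((x.pull k).pull g).base = a ≫ j.base := by
        change g ≫ (x.pull k).base = _
        rw [hb, ← Category.assoc, hg]
      constructor
      · intro h q
        rw [h] at hp
        exact congrArg (fun l => l q) (hp.unique_val hj hx' hv)
      · intro h
        refine hp.unique_point hβ hpb hx' ?_
        convert hv using 1
        exact MonoidHom.ext h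
    obtain ⟨g, ⟨hg, hg'⟩, hu⟩ := hR.univ a x' hx'
    exact ⟨g, ⟨hg, (key g hg).1 hg'⟩, fun g' ⟨h₁, h₂⟩ => hu g' ⟨h₁, (key g' h₁).2 h₂⟩⟩

section

variable {U : LogScheme.{u}} {Q : Type u} [CommMonoid Q]
  {β : Q →* U.str.sec (topEt U.toScheme)} {W : Scheme.{u}} {w : W ⟶ U.toScheme}
  {M : PrelogStructure W} (ω : Comorphism w M.pointed U.str)

variable (β) in
/-- The locus where an element of the chart is finite. -/
def chartOpen (q : Q) : W.Opens := (ω.top (β q) : M.PSec (topEt W)).D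

lemma chartOpen_isClosed (q : Q) : IsClosed (chartOpen β ω q : Set W) :=
  (ω.top (β q) : M.PSec (topEt W)).isClosed

lemma chartOpen_one : chartOpen β ω 1 = ⊤ :=
  congrArg (fun s : M.PSec (topEt W) => s.D) (map_one (ω.top.comp β))

lemma chartOpen_mul (q r : Q) : chartOpen β ω (q * r) = chartOpen β ω q ⊓ chartOpen β ω r :=
  congrArg (fun s : M.PSec (topEt W) => s.D) (map_mul (ω.top.comp β) q r)

variable (β) in
/-- The prime ideal of elements of the chart which are infinite at a point. -/
def primeAt (z : W) : Set Q := {q | z ∉ chartOpen β ω q}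

lemma primeAt_isPrimeIdeal (z : W) : IsPrimeIdeal (primeAt β ω z) where
  mul_mem a ha b hb := ha (by
    rw [chartOpen_mul] at hb
    exact hb.1)
  ne_univ h := by
    have : (1 : Q) ∈ primeAt β ω z := h ▸ Set.mem_univ _
    refine this ?_
    rw [chartOpen_one]
    trivial
  mem_or_mem a b hab := by
    by_contra! h
    refine hab ?_
    rw [chartOpen_mul]
    exact ⟨not_not.1 h.1, not_not.1 h.2⟩

/-- A product is finite exactly where both factors are, so the prime at a point is determined by the
generators it contains. Finitely many open and closed conditions define a neighbourhood on which it
is constant. -/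
lemma primeAt_isLocallyConstant [Monoid.FG Q] : IsLocallyConstant (primeAt β ω) := by
  obtain ⟨s, hs⟩ := (Monoid.fg_def (M := Q)).1 inferInstance
  have key : ∀ z z' : W, (∀ q ∈ s, z ∈ chartOpen β ω q ↔ z' ∈ chartOpen β ω q) →
      primeAt β ω z' = primeAt β ω z := by
    intro z z' h
    have : ∀ q ∈ Submonoid.closure (s : Set Q), (z ∈ chartOpen β ω q ↔ z' ∈ chartOpen β ω q) := by
      intro q hq
      induction hq using Submonoid.closure_induction with
      | mem q hq => exact h q hq
      | one => rw [chartOpen_one]; exact Iff.rfl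
      | mul a b _ _ ha hb =>
        rw [chartOpen_mul]
        exact and_congr ha hb
    ext q
    exact not_congr (this q (by rw [hs]; trivial)).symm
  classical
  refine (IsLocallyConstant.iff_exists_open _).2 fun z => ?_
  refine ⟨⋂ q ∈ s, if z ∈ chartOpen β ω q then (chartOpen β ω q : Set W)
    else (chartOpen β ω q : Set W)ᶜ, ?_, ?_, fun z' hz' => ?_⟩
  · refine isOpen_biInter_finset fun q _ => ?_
    split_ifs
    · exact (chartOpen β ω q).isOpen
    · exact (chartOpen_isClosed ω q).isOpen_compl
  · refine Set.mem_iInter₂.2 fun q _ => ?_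
    split_ifs with h
    · exact h
    · exact h
  · refine key z z' fun q hq => ?_
    have := Set.mem_iInter₂.1 hz' q hq
    split_ifs at this with h
    · exact ⟨fun _ => this, fun _ => h⟩
    · exact ⟨fun h' => (h h').elim, fun h' => (this h').elim⟩

lemma ind_eq_one_iff {T : Scheme.{u}} {D : T.Opens} (hD : IsClosed (D : Set T)) :
    ind D hD = 1 ↔ ∀ z, z ∈ D := by
  constructor
  · intro h z
    rw [← basicOpen_ind D hD, h, Scheme.basicOpen_of_isUnit _ isUnit_one]
    trivial
  · intro h
    obtain rfl : D = ⊤ := top_le_iff.1 fun z _ => h z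
    exact ind_top _

lemma ind_eq_zero_iff {T : Scheme.{u}} {D : T.Opens} (hD : IsClosed (D : Set T)) :
    ind D hD = 0 ↔ ∀ z, z ∉ D := by
  constructor
  · intro h z
    rw [← basicOpen_ind D hD, h, Scheme.basicOpen_zero]
    exact fun h => h
  · intro h
    refine glue_unique D hD ?_ ?_
    · have : IsEmpty D := ⟨fun x => h _ x.2⟩
      exact Subsingleton.elim _ _
    · rw [ind_compl, map_zero]

lemma pullback_support_fst {T : Scheme.{u}} (g : T ⟶ W) (q : Q) :
    (supportedMap g.appTop.hom (show supported Γ(W, ⊤) from ω.support.top (β q))).1.1 =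
      ind (g ⁻¹ᵁ chartOpen β ω q) ((chartOpen_isClosed ω q).preimage g.continuous) :=
  (ind_preimage g _ (chartOpen_isClosed ω q) _).symm

lemma pullback_support_snd {T : Scheme.{u}} (g : T ⟶ W) (q : Q) :
    (supportedMap g.appTop.hom (show supported Γ(W, ⊤) from ω.support.top (β q))).1.2 =
      (g ≫ w).appTop.hom (U.str.val _ (β q)) :=
  (congrArg g.appTop.hom (ω.support.top_val (β q))).trans (appTop_comp_apply g w _).symm

/-- Where the idempotent is `0`, the equation `e * a = a` kills the value. This is why a stratum
lies over the closed subscheme cut out by `p`. -/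
lemma appTop_eq_zero_of_mem {T : Scheme.{u}} {g : T ⟶ W} {q : Q}
    (h : ∀ z, q ∈ primeAt β ω (g z)) : (g ≫ w).appTop.hom (U.str.val _ (β q)) = 0 := by
  have h₁ := (supportedMap g.appTop.hom
    (show supported Γ(W, ⊤) from ω.support.top (β q))).2.2
  have h₂ := (pullback_support_fst ω g q).trans ((ind_eq_zero_iff
    ((chartOpen_isClosed ω q).preimage g.continuous)).2 fun z => h z)
  exact (pullback_support_snd ω g q).symm.trans
    (h₁.symm.trans ((congrArg (· * _) h₂).trans (zero_mul _)))

/-- A section of the log structure of supports for a prime ideal. -/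
lemma exists_supported_of_prime {T : Scheme.{u}} {p : Set Q} (hp : IsPrimeIdeal p)
    (θ : Q →* Γ(T, ⊤)) (hθ : ∀ q ∈ p, θ q = 0) :
    ∃ γ : Q →* supported Γ(T, ⊤), (∀ q, (γ q).1.2 = θ q) ∧ (∀ q ∈ p, (γ q).1.1 = 0) ∧
      ∀ q ∉ p, (γ q).1.1 = 1 := by
  classical
  have h1 : (1 : Q) ∉ p := hp.face.one_mem
  refine ⟨{ toFun := fun q => ⟨(if q ∈ p then 0 else 1, θ q), ?_, ?_⟩
            map_one' := Subtype.ext (Prod.ext (if_neg h1) (map_one θ))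
            map_mul' := fun a b => Subtype.ext (Prod.ext ?_ (map_mul θ a b)) },
    fun q => rfl, fun q hq => if_pos hq, fun q hq => if_neg hq⟩
  · dsimp; split_ifs <;> simp
  · dsimp
    split_ifs with h
    · rw [hθ q h, mul_zero]
    · rw [one_mul]
  · change (if a * b ∈ p then 0 else 1) = (if a ∈ p then 0 else 1) * (if b ∈ p then 0 else 1)
    by_cases ha : a ∈ p
    · rw [if_pos ha, if_pos (hp.mul_mem a ha b), zero_mul]
    · by_cases hb : b ∈ p
      · rw [if_pos hb, if_pos (mul_comm b a ▸ hp.mul_mem b hb a), mul_zero]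
      · rw [if_neg ha, if_neg hb, if_neg fun h => (hp.mem_or_mem a b h).elim ha hb, one_mul]

end

end LogGeom
end

set_option linter.unusedSectionVars false

noncomputable section

namespace LogGeom

open PrelogStructure Comorphism

/-! ### The strata are the faces of the chart -/

lemma isPullback_of_existsUnique {P A B C : Scheme.{u}} {fst : P ⟶ A} {snd : P ⟶ B} {f : A ⟶ C}
    {g : B ⟶ C} [Mono g] (sq : CommSq fst snd f g)
    (H : ∀ {T : Scheme.{u}} (a : T ⟶ A) (b : T ⟶ B), a ≫ f = b ≫ g → ∃! l : T ⟶ P, l ≫ fst = a) :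
    IsPullback fst snd f g := by
  refine ⟨sq, ⟨Limits.PullbackCone.IsLimit.mk sq.w
    (fun s => (H s.fst s.snd s.condition).choose)
    (fun s => (H s.fst s.snd s.condition).choose_spec.1) (fun s => ?_)
    (fun s m h₁ _ => (H s.fst s.snd s.condition).choose_spec.2 m h₁)⟩⟩
  rw [← cancel_mono g, Category.assoc, ← sq.w, ← Category.assoc,
    (H s.fst s.snd s.condition).choose_spec.1, s.condition]

/-- If a product lies in the face then so do both factors; hence the generators of `Q` lying in the
face generate it. -/
lemma IsPrimeIdeal.face_fg {Q : Type u} [CommMonoid Q] [Monoid.FG Q] {p : Set Q}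
    (hp : IsPrimeIdeal p) : Monoid.FG hp.face := by
  obtain ⟨s, hs⟩ := (Monoid.fg_def (M := Q)).1 inferInstance
  rw [Monoid.fg_iff_submonoid_fg, Submonoid.fg_iff]
  refine ⟨s ∩ hp.face, le_antisymm (Submonoid.closure_le.2 Set.inter_subset_right) ?_,
    s.finite_toSet.inter_of_left _⟩
  have : ∀ q ∈ Submonoid.closure (s : Set Q), q ∈ hp.face →
      q ∈ Submonoid.closure ((s : Set Q) ∩ hp.face) := by
    intro q hq
    induction hq using Submonoid.closure_induction with
    | mem q hq => exact fun h => Submonoid.subset_closure ⟨hq, h⟩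
    | one => exact fun _ => Submonoid.one_mem _
    | mul a b _ _ ha hb =>
      exact fun h => Submonoid.mul_mem _ (ha fun h' => h (hp.mul_mem a h' b))
        (hb fun h' => h (mul_comm b a ▸ hp.mul_mem b h' a))
  exact fun q hq => this q (hs ▸ trivial) hq

lemma ofSpec_toSpecMonoid {U : LogScheme.{u}} {Q : Type u} [CommMonoid Q]
    (β : Q →* U.str.sec (topEt U.toScheme)) (q : Q) :
    ofSpec (toSpecMonoid β) (MonoidAlgebra.of ℤ Q q) = U.str.val _ (β q) := by
  have : ofSpec (toSpecMonoid β) = _ := ofSpec_toSpec _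
  rw [this]
  exact MonoidAlgebra.lift_of _ _

instance {Q : Type u} [CommMonoid Q] (p : Set Q) : IsClosedImmersion (specQuot p) :=
  IsClosedImmersion.spec_of_surjective _ Ideal.Quotient.mk_surjective

section

variable {U : LogScheme.{u}} {Q : Type u} [CommMonoid Q]
  {β : Q →* U.str.sec (topEt U.toScheme)} {W : Scheme.{u}} {w : W ⟶ U.toScheme}
  {M : PrelogStructure W} {ω : Comorphism w M.pointed U.str}

lemma support_eq_of_primeAt {T : Scheme.{u}} {g : T ⟶ W} {p : Set Q}
    (hg : ∀ z, primeAt β ω (g z) = p) {γ : Q →* supported Γ(T, ⊤)}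
    (h₀ : ∀ q ∈ p, (γ q).1.1 = 0) (h₁ : ∀ q ∉ p, (γ q).1.1 = 1)
    (hγ : ∀ q, (γ q).1.2 = (g ≫ w).appTop.hom (U.str.val _ (β q))) (q : Q) :
    supportedMap g.appTop.hom (show supported Γ(W, ⊤) from ω.support.top (β q)) = γ q := by
  refine Subtype.ext (Prod.ext ((pullback_support_fst ω g q).trans ?_)
    ((pullback_support_snd ω g q).trans (hγ q).symm))
  by_cases hq : q ∈ p
  · rw [h₀ q hq]
    refine (ind_eq_zero_iff _).2 fun z => ?_
    rw [← hg z] at hq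
    exact hq
  · rw [h₁ q hq]
    refine (ind_eq_one_iff _).2 fun z => ?_
    rw [← hg z] at hq
    exact not_not.1 hq

lemma primeAt_of_support_eq {T : Scheme.{u}} {g : T ⟶ W} {p : Set Q}
    {γ : Q →* supported Γ(T, ⊤)} (h₀ : ∀ q ∈ p, (γ q).1.1 = 0) (h₁ : ∀ q ∉ p, (γ q).1.1 = 1)
    (h : ∀ q, supportedMap g.appTop.hom (show supported Γ(W, ⊤) from ω.support.top (β q)) = γ q)
    (z : T) : primeAt β ω (g z) = p := by
  have e : ∀ q, ind (g ⁻¹ᵁ chartOpen β ω q) ((chartOpen_isClosed ω q).preimage g.continuous) =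
      (γ q).1.1 := fun q => (pullback_support_fst ω g q).symm.trans
    (congrArg (fun t : supported Γ(T, ⊤) => t.1.1) (h q))
  ext q
  by_cases hq : q ∈ p
  · exact iff_of_true ((ind_eq_zero_iff _).1 ((e q).trans (h₀ q hq)) z) hq
  · exact iff_of_false (fun h' => h' ((ind_eq_one_iff _).1 ((e q).trans (h₁ q hq)) z)) hq

/-- If `a : T ⟶ U` sends the elements of `p` to `0`, then setting `e = 0` on `p` and `e = 1` off `p`
is an admissible support for `a`. It gives a unique morphism to `W`, and having this support means
landing in the stratum. -/
lemma IsChartUniv.isPullback_stratum (h : IsChartUniv β ω) {p : Set Q} (hp : IsPrimeIdeal p)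
    {Z : Scheme.{u}} (i : Z ⟶ W) [IsOpenImmersion i]
    (hi : Set.range i = {z | primeAt β ω z = p}) :
    ∃ t, IsPullback (i ≫ w) t (toSpecMonoid β) (specQuot p) := by
  have hi' : ∀ z, primeAt β ω (i z) = p := fun z =>
    (hi ▸ Set.mem_range_self z : i z ∈ {z | primeAt β ω z = p})
  have hk : ∀ x ∈ Ideal.span (MonoidAlgebra.of ℤ Q '' p),
      ((i ≫ w).appTop.hom.comp (ofSpec (toSpecMonoid β))) x = 0 := by
    have : Ideal.span (MonoidAlgebra.of ℤ Q '' p) ≤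
        RingHom.ker ((i ≫ w).appTop.hom.comp (ofSpec (toSpecMonoid β))) := by
      rw [Ideal.span_le]
      rintro _ ⟨q, hq, rfl⟩
      refine (congrArg (i ≫ w).appTop.hom (ofSpec_toSpecMonoid β q)).trans ?_
      exact appTop_eq_zero_of_mem ω fun z => (hi' z).symm ▸ hq
    exact fun x hx => this hx
  refine ⟨toSpec (Ideal.Quotient.lift _ _ hk), isPullback_of_existsUnique (CommSq.mk ?_) ?_⟩
  · refine ofSpec_injective ?_
    rw [ofSpec_comp]
    refine Eq.trans ?_ (ofSpec_comp_map _ _).symm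
    rw [ofSpec_toSpec, Ideal.Quotient.lift_comp_mk]
  · intro T a b hab
    have ha : ∀ q ∈ p, a.appTop.hom (U.str.val _ (β q)) = 0 := by
      intro q hq
      have h₁ : ofSpec (a ≫ toSpecMonoid β) (MonoidAlgebra.of ℤ Q q) =
          a.appTop.hom (U.str.val _ (β q)) := by
        rw [ofSpec_comp]
        exact congrArg a.appTop.hom (ofSpec_toSpecMonoid β q)
      have h₂ : ofSpec (b ≫ specQuot p) = (ofSpec b).comp (Ideal.Quotient.mk _) :=
        ofSpec_comp_map _ _
      rw [← h₁, hab, h₂, RingHom.comp_apply, Ideal.Quotient.eq_zero_iff_mem.2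
        (Ideal.subset_span (Set.mem_image_of_mem _ hq)), map_zero]
    let θ : Q →* Γ(T, ⊤) :=
      (a.appTop.hom : Γ(U.toScheme, ⊤) →* Γ(T, ⊤)).comp ((U.str.val _).comp β)
    obtain ⟨γ, hγ, h₀, h₁⟩ := exists_supported_of_prime hp θ ha
    obtain ⟨g, ⟨hg, hg'⟩, hu⟩ := h.rep a γ hγ
    have hr : Set.range g ⊆ Set.range i := by
      rintro _ ⟨z, rfl⟩
      rw [hi]
      exact primeAt_of_support_eq h₀ h₁ hg' z
    refine ⟨IsOpenImmersion.lift i g hr, ?_, fun l hl => ?_⟩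
    · dsimp only
      rw [← Category.assoc, IsOpenImmersion.lift_fac, hg]
    · rw [← cancel_mono i, IsOpenImmersion.lift_fac]
      have hl' : (l ≫ i) ≫ w = a := (Category.assoc _ _ _).trans hl
      refine hu _ ⟨hl', support_eq_of_primeAt (fun z => ?_) h₀ h₁ fun q => ?_⟩
      · rw [Scheme.Hom.comp_apply]
        exact hi' _
      · rw [hl']
        exact hγ q

lemma supportedMap_id_appTop {T : Scheme.{u}} (x : supported Γ(T, ⊤)) :
    supportedMap (𝟙 T : T ⟶ T).appTop.hom x = x :=
  Subtype.ext (Prod.ext (by rw [Scheme.Hom.id_appTop]; rfl) (by rw [Scheme.Hom.id_appTop]; rfl))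

lemma toSupp_infty {T : Scheme.{u}} {N N' : PrelogStructure T} (V : T.Etale) :
    PSec.toSupp V (PSec.infty V : N.PSec V) = PSec.toSupp V (PSec.infty V : N'.PSec V) :=
  Subtype.ext (Prod.ext rfl (PSec.val_infty.trans PSec.val_infty.symm))

lemma toSupp_ofSec {T : Scheme.{u}} {N N' : PrelogStructure T} {V : T.Etale} {m : N.sec V}
    {m' : N'.sec V} (h : N'.val V m' = N.val V m) :
    PSec.toSupp V (PSec.ofSec m) = PSec.toSupp V (PSec.ofSec m') :=
  Subtype.ext (Prod.ext rfl ((PSec.val_ofSec m).trans (h.symm.trans (PSec.val_ofSec m').symm)))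

/-- Morphisms from `N` to `N'` are the pointed comorphisms from `U` to `N'` with the support of the
stratum. Since `β` is a chart, these are the homomorphisms from `Q` to `N' ∪ {∞}` that are infinite
on `p` and finite off `p`, with prescribed values: exactly the homomorphisms from the face to `N'`
with those values. -/
lemma IsChartUniv.exists_face_chart (h : IsChartUniv β ω) {p : Set Q} (hp : IsPrimeIdeal p)
    {Z : Scheme.{u}} {i : Z ⟶ W} (hi : ∀ z, primeAt β ω (i z) = p) {N : PrelogStructure Z}
    (hN : N.IsLog) {κ : Comorphism i N M} (hκ : κ.IsCart) {w' : Z ⟶ U.toScheme} (hw : i ≫ w = w')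
    {ω' : Comorphism w' N.pointed U.str} (H : Factors κ.pointed ω ω') :
    ∃ γ : hp.face →* N.sec (topEt Z), N.IsChart γ ∧
      (∀ r : hp.face, ω'.top (β r) = PSec.ofSec (γ r)) ∧
      ∀ q ∈ p, ω'.top (β q) = PSec.infty _ := by
  classical
  have hD : ∀ (q : Q) (z : Z), z ∈ (ω'.top (β q) : N.PSec (topEt Z)).D ↔
      i z ∈ chartOpen β ω q := by
    intro q z
    have h₁ : (κ.pmap (V := topEt Z) (U := topEt W) i
        ((Category.comp_id _).trans (Category.id_comp _).symm) (ω.top (β q))) = ω'.top (β q) :=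
      H.top_eq hw (β q)
    rw [← h₁]
    exact Iff.rfl
  have hfin : ∀ r : hp.face, ∃ n : N.sec (topEt Z), ω'.top (β r) = PSec.ofSec n := fun r =>
    ⟨_, PSec.eq_ofSec fun (z : Z) => (hD r z).2 (not_not.1 fun h' => r.2 (hi z ▸ show (r :
        Q) ∈ primeAt β ω (i z) from h'))⟩
  have hinf : ∀ q ∈ p, ω'.top (β q) = PSec.infty _ := fun q hq =>
    PSec.eq_infty hN.gluing fun z hz => ((hi z).symm ▸ hq : q ∈ primeAt β ω (i z)) ((hD q z).1 hz)
  choose n hn using hfin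
  let γ : hp.face →* N.sec (topEt Z) :=
    { toFun := n
      map_one' := PSec.ofSec_injective ((hn 1).symm.trans
        ((map_one (ω'.top.comp β)).trans PSec.ofSec_one.symm))
      map_mul' := fun r s => PSec.ofSec_injective ((hn (r * s)).symm.trans
        ((map_mul (ω'.top.comp β) (r : Q) s).trans
          ((congrArg₂ _ (hn r) (hn s)).trans (PSec.ofSec_mul _ _).symm))) }
  have hγ : ∀ r : hp.face, ω'.top (β r) = PSec.ofSec (γ r) := hn
  refine ⟨γ, isChart_of fun N' hN' γ' hγ' => ?_, hγ, hinf⟩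
  -- Extension of `γ'` by `∞` on `p`; it is multiplicative because `p` is an ideal and its
  -- complement is closed under products.
  let δ : Q →* N'.PSec (topEt Z) :=
    { toFun := fun q => if hq : q ∈ p then PSec.infty _ else PSec.ofSec (γ' ⟨q, hq⟩)
      map_one' := (dif_neg hp.face.one_mem).trans
        ((congrArg PSec.ofSec (map_one γ')).trans PSec.ofSec_one)
      map_mul' := fun a b => by
        by_cases ha : a ∈ p
        · rw [dif_pos ha, dif_pos (hp.mul_mem a ha b), PSec.infty_mul hN'.gluing]
        · by_cases hb : b ∈ p
          · rw [dif_pos hb, dif_pos (mul_comm b a ▸ hp.mul_mem b hb a),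
              PSec.mul_infty hN'.gluing]
          · rw [dif_neg ha, dif_neg hb, dif_neg (hp.face.mul_mem ha hb), ← PSec.ofSec_mul]
            exact congrArg PSec.ofSec (map_mul γ' ⟨a, ha⟩ ⟨b, hb⟩) }
  have hδ₀ : ∀ q ∈ p, δ q = PSec.infty _ := fun q hq => dif_pos hq
  have hδ₁ : ∀ r : hp.face, δ r = PSec.ofSec (γ' r) := fun r => dif_neg r.2
  have hsupp : ∀ q, PSec.toSupp _ (show N.PSec (topEt Z) from ω'.top (β q)) =
      PSec.toSupp _ (δ q) := by
    intro q
    by_cases hq : q ∈ p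
    · rw [hδ₀ q hq, hinf q hq]
      exact toSupp_infty _
    · have h₁ := hδ₁ ⟨q, hq⟩
      have h₂ := hγ ⟨q, hq⟩
      dsimp only at h₁ h₂
      rw [h₁, h₂]
      exact toSupp_ofSec (hγ' _)
  have hval : ∀ q, N'.pointed.val _ (δ q) = w'.appTop.hom (U.str.val _ (β q)) := by
    intro q
    refine (congrArg (fun t : supported Γ(Z, ⊤) => t.1.2) (hsupp q)).symm.trans ?_
    exact ω'.top_val (β q)
  obtain ⟨c, hc, hcu⟩ := h.isChart.existsUnique w' (pointed_isLog hN') δ hval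
  -- Both supports are comorphisms out of a log structure with chart `β`, so it suffices that they
  -- agree on `β`, which is `hsupp`.
  have hcs : Factors (suppCo (𝟙 Z)) ω'.support c.support := by
    obtain ⟨b, hb⟩ := exists_factors (suppCo (𝟙 Z)) ω'.support (Category.id_comp w')
    have : b = c.support := by
      refine (h.isChart.existsUnique w' (supp_isLog Z) (c.support.top.comp β)
        fun q => c.support.top_val _).unique (fun q => ?_) fun q => rfl
      refine (hb.top_eq (Category.id_comp w') (β q)).symm.trans ?_
      have h₁ : (suppCo (𝟙 Z)).top (ω'.support.top (β q)) = ω'.support.top (β q) :=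
        supportedMap_id_appTop _
      refine h₁.trans ((hsupp q).trans ?_)
      exact congrArg (PSec.toSupp _) (hc q).symm
    rwa [this] at hb
  have hω' : ω'.IsUniv := fun {_ _ _} hg {_} hN c =>
    IsUniv.restrict h.lift hw hκ H hg hN c
  obtain ⟨d, hd, hdu⟩ := hω' (Category.id_comp w') hN' c hcs
  refine ⟨d, fun r => PSec.ofSec_injective ?_, fun d₂ hd₂ => hdu _ ?_⟩
  · refine (d.pointed_ofSec (V := topEt Z) (U := topEt Z) _ _ (γ r)).symm.trans ?_
    refine (congrArg d.pointed.top (hγ r)).symm.trans ?_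
    exact (hd.top_eq (Category.id_comp w') _).trans ((hc r).trans (hδ₁ r))
  · obtain ⟨c₂, hc₂⟩ := exists_factors d₂.pointed ω' (Category.id_comp w')
    rwa [hcu c₂ fun q => ?_] at hc₂
    refine (hc₂.top_eq (Category.id_comp w') _).symm.trans ?_
    by_cases hq : q ∈ p
    · refine (congrArg d₂.pointed.top (hinf q hq)).trans (Eq.trans ?_ (hδ₀ q hq).symm)
      exact d₂.pmap_infty (V := topEt Z) (U := topEt Z) (𝟙 Z) (id_w (topEt Z))
    · refine (congrArg d₂.pointed.top (hγ ⟨q, hq⟩)).trans (Eq.trans ?_ (hδ₁ ⟨q, hq⟩).symm)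
      refine (d₂.pointed_ofSec (V := topEt Z) (U := topEt Z) _ _ (γ ⟨q, hq⟩)).trans ?_
      exact congrArg PSec.ofSec (hd₂ ⟨q, hq⟩)

end

end LogGeom
end

set_option linter.unusedSectionVars false

noncomputable section

namespace LogGeom

open PrelogStructure Comorphism

/-! ### The log scheme of supports -/

/-- A log structure with a chart by a finitely generated monoid gives a log scheme. -/
def LogScheme.ofChart {U : Scheme.{u}} {K : PrelogStructure U} (hK : K.IsLog) {Q : Type u}
    [CommMonoid Q] [Monoid.FG Q] {β : Q →* K.sec (topEt U)} (hβ : K.IsChart β) : LogScheme.{u} where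
  toScheme := U
  str := K
  isLog := hK
  exists_chart x := by
    have h : (K.restrictCo (𝟙 U)).IsCart := restrictCo_isCart (𝟙 U) K
    exact ⟨U, 𝟙 U, K.restrict (𝟙 U), K.restrictCo (𝟙 U), Q, inferInstance, _, inferInstance,
      ⟨x, rfl⟩, restrict_isLog _ hK, h.isStrict, inferInstance, hβ.of_cart h⟩

section

variable {U : LogScheme.{u}} {Q : Type u} [CommMonoid Q] [Monoid.FG Q]
  (β : Q →* U.str.sec (topEt U.toScheme)) {W : Scheme.{u}} {w : W ⟶ U.toScheme}
  {M : PrelogStructure W} (ω : Comorphism w M.pointed U.str)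

/-- The open and closed subset where the elements of the chart in `p` are infinite and the others
are finite. -/
def stratum (p : Set Q) : W.Opens :=
  ⟨{z | primeAt β ω z = p}, (primeAt_isLocallyConstant ω).isOpen_fiber p⟩

lemma range_stratum_ι (p : Set Q) : Set.range (stratum β ω p).ι = {z | primeAt β ω z = p} :=
  Scheme.Opens.range_ι _

lemma primeAt_stratum_ι {p : Set Q} (z : stratum β ω p) :
    primeAt β ω ((stratum β ω p).ι z) = p := z.2

end

section

variable {Y U : LogScheme.{u}} {E W : Scheme.{u}} {x : SuppPoint Y.str E}

lemma exists_isChartUniv (hx : (SuppPoint.functor Y.str).IsRep (𝟙 Y.toScheme) x.base x) {j :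
    LogHom U Y}
    (hj : j.comor.IsCart) {Q : Type u} [CommMonoid Q] {β : Q →* U.str.sec (topEt U.toScheme)}
    (hβ : U.str.IsChart β) {k : W ⟶ E} [Etale k] {w : W ⟶ U.toScheme}
    (hW : IsPullback k w x.base j.base) :
    ∃ (ω₁ : Comorphism (k ≫ x.base) (x.co.univLog.restrict k).pointed Y.str)
      (ω : Comorphism w (x.co.univLog.restrict k).pointed U.str), IsChartUniv β ω ∧
      Factors (x.co.univLog.restrictCo k).pointed x.co.univCo ω₁ ∧ Factors ω j.comor ω₁ := by
  have hM : (x.co.univLog.restrict k).IsLog := restrict_isLog k x.co.univLog_isLog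
  obtain ⟨ω₁, H₁⟩ := exists_factors (x.co.univLog.restrictCo k).pointed x.co.univCo rfl
  obtain ⟨ω, H, -⟩ := hj hW.w.symm (pointed_isLog hM) ω₁
  exact ⟨ω₁, ω, IsChartUniv.of_isRep hx hj hβ hW hM (restrictCo_isCart k x.co.univLog) H₁ H, H₁, H⟩

/-- The log scheme which classifies the supports of pointed morphisms to `Y`. -/
def suppScheme (hx : (SuppPoint.functor Y.str).IsRep (𝟙 Y.toScheme) x.base x) :
    LogScheme.{u} where
  toScheme := E
  str := x.co.univLog
  isLog := x.co.univLog_isLog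
  exists_chart z := by
    obtain ⟨U, j, K, c, Q, _, β, hj, ⟨y, hy⟩, hK, hc, hQ, hβ⟩ := Y.exists_chart (x.base z)
    let U' : LogScheme.{u} := LogScheme.ofChart hK hβ
    let j' : LogHom U' Y := ⟨j, c⟩
    obtain ⟨z', hz', -⟩ := Scheme.Pullback.exists_preimage_pullback (f := x.base) (g := j) z y
      hy.symm
    let k := Limits.pullback.fst x.base j
    let w : Limits.pullback x.base j ⟶ U'.toScheme := Limits.pullback.snd x.base j
    have hW : IsPullback k w x.base j'.base := IsPullback.of_hasPullback _ _
    obtain ⟨ω₁, ω, hω, -, -⟩ := exists_isChartUniv hx (j := j') hc.isCart hβ hW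
    -- Near `z'` the log structure is charted by the face of elements finite at `z'`; the stratum of
    -- `z'` is the étale neighbourhood carrying this chart.
    let p := primeAt β ω z'
    have hp : IsPrimeIdeal p := primeAt_isPrimeIdeal ω z'
    let i := (stratum β ω p).ι
    let N := (x.co.univLog.restrict k).restrict i
    have hN : N.IsLog := restrict_isLog i hω.isLog
    have hκ : ((x.co.univLog.restrict k).restrictCo i).IsCart := restrictCo_isCart i _
    have hκ' : (x.co.univLog.restrictCo k).IsCart := restrictCo_isCart k _
    obtain ⟨ω', H⟩ := exists_factors ((x.co.univLog.restrict k).restrictCo i).pointed ω rfl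
    obtain ⟨γ, hγ, -⟩ := hω.exists_face_chart hp (primeAt_stratum_ι β ω) hN hκ rfl H
    have hc' : (((x.co.univLog.restrict k).restrictCo i).comp
        (x.co.univLog.restrictCo k)).IsCart := IsCart.comp hκ hκ' (factors_comp _ _) rfl
    exact ⟨_, i ≫ k, N, _, hp.face, inferInstance, γ, inferInstance,
      ⟨⟨z', rfl⟩, (Scheme.Hom.comp_apply i k _).trans hz'⟩, hN, hc'.isStrict, hp.face_fg, hγ⟩

end

end LogGeom
end

set_option linter.unusedSectionVars false

noncomputable section

namespace LogGeom

open PrelogStructure Comorphism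

/-! ### Connected components -/

/-- An irreducible component meeting a connected component lies inside it. So the complement is the
union of the irreducible components disjoint from it, finitely many closed sets. -/
lemma isOpen_connectedComponent_of_noetherianSpace {α : Type u} [TopologicalSpace α]
    [NoetherianSpace α] (x : α) : IsOpen (connectedComponent x) := by
  have h : (connectedComponent x)ᶜ =
      ⋃ Z ∈ {Z ∈ irreducibleComponents α | Disjoint Z (connectedComponent x)}, Z := by
    ext y
    rw [Set.mem_iUnion₂]
    constructor
    · intro hy
      refine ⟨irreducibleComponent y, ⟨irreducibleComponent_mem_irreducibleComponents y, ?_⟩,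
        mem_irreducibleComponent⟩
      rw [Set.disjoint_left]
      intro z hz hzx
      have hyz : irreducibleComponent y ⊆ connectedComponent z :=
        isIrreducible_irreducibleComponent.isConnected.isPreconnected.subset_connectedComponent hz
      rw [← connectedComponent_eq hzx] at hyz
      exact hy (hyz mem_irreducibleComponent)
    · rintro ⟨Z, hZ, hy⟩ hyx
      exact Set.disjoint_left.1 hZ.2 hy hyx
  rw [← isClosed_compl_iff, h]
  exact (NoetherianSpace.finite_irreducibleComponents.subset (Set.sep_subset _ _)).isClosed_biUnion
    fun Z hZ => isClosed_of_mem_irreducibleComponents Z hZ.1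

instance (priority := 100) {α : Type u} [TopologicalSpace α] [NoetherianSpace α] :
    LocallyConnectedSpace α := by
  refine locallyConnectedSpace_iff_connectedComponentIn_open.2 fun F hF x hx => ?_
  rw [connectedComponentIn_eq_image hx]
  exact hF.isOpenMap_subtype_val _ (isOpen_connectedComponent_of_noetherianSpace _)

/-- The image of a connected neighbourhood under a continuous open map is a connected neighbourhood.
-/
lemma locallyConnectedSpace_of_isOpenMap {α : Type u} [TopologicalSpace α]
    (h : ∀ x : α, ∃ (β : Type u) (_ : TopologicalSpace β) (f : β → α),
      LocallyConnectedSpace β ∧ Continuous f ∧ IsOpenMap f ∧ x ∈ Set.range f) :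
    LocallyConnectedSpace α := by
  refine locallyConnectedSpace_iff_connected_subsets.2 fun x U hU => ?_
  obtain ⟨β, _, f, hβ, hf, ho, y, rfl⟩ := h x
  obtain ⟨V, hV, hVc, hVU⟩ := locallyConnectedSpace_iff_connected_subsets.1 hβ y _
    (hf.continuousAt.preimage_mem_nhds hU)
  exact ⟨f '' V, ho.image_mem_nhds hV, hVc.image f hf.continuousOn, Set.image_subset_iff.2 hVU⟩

instance (S : Scheme.{u}) [IsLocallyNoetherian S] : LocallyConnectedSpace S := by
  refine locallyConnectedSpace_of_isOpenMap fun x => ?_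
  obtain ⟨V, hV, hx, -⟩ := S.isBasis_affineOpens.exists_subset_of_mem_open
    (Set.mem_univ x) isOpen_univ
  obtain ⟨V, hV', rfl⟩ := hV
  have := IsLocallyNoetherian.component_noetherian ⟨V, hV'⟩
  have := noetherianSpace_of_isAffineOpen V hV'
  exact ⟨V, inferInstance, Subtype.val, inferInstance, continuous_subtype_val,
    V.isOpen.isOpenMap_subtype_val, ⟨x, hx⟩, rfl⟩

section

variable (S : Scheme.{u}) [LocallyConnectedSpace S]

/-- A connected component, as an open subscheme. -/
def componentOpen (c : _root_.ConnectedComponents S) : S.Opens :=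
  ⟨_root_.ConnectedComponents.mk ⁻¹' {c},
      (isOpen_discrete _).preimage _root_.ConnectedComponents.continuous_coe⟩

lemma componentOpen_isClosed (c : _root_.ConnectedComponents S) : IsClosed (componentOpen S c :
    Set S) :=
  (isClosed_discrete {c}).preimage _root_.ConnectedComponents.continuous_coe

instance (c : _root_.ConnectedComponents S) : ConnectedSpace (componentOpen S c) := by
  obtain ⟨x, rfl⟩ := _root_.ConnectedComponents.surjective_coe c
  refine Subtype.connectedSpace ?_
  change _root_.IsConnected (_root_.ConnectedComponents.mk ⁻¹' {_root_.ConnectedComponents.mk x})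
  rw [connectedComponents_preimage_singleton]
  exact isConnected_connectedComponent

lemma nonempty_isColimit_components : Nonempty (Limits.IsColimit
    (Limits.Cofan.mk S (fun c : _root_.ConnectedComponents S => (componentOpen S c).ι))) := by
  refine nonempty_isColimit_cofanMk_of _ ?_ ?_
  · refine top_unique fun x _ => Opens.mem_iSup.2 ⟨_root_.ConnectedComponents.mk x, ?_⟩
    rw [Scheme.Opens.opensRange_ι]
    exact rfl
  · intro c d hcd
    rw [Function.onFun, Scheme.Opens.opensRange_ι, Scheme.Opens.opensRange_ι, disjoint_iff]
    ext x
    refine iff_of_false (fun hx => hcd ?_) id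
    exact hx.1.symm.trans hx.2

end

/-! ### Decomposition into components and cancellation of strict morphisms -/

variable (X : LogScheme.{u})

lemma LogScheme.isDisjointUnion_restrict {S : Scheme.{u}} [LocallyConnectedSpace S]
    (j : S ⟶ X.toScheme) [Etale j] : IsDisjointUnion
      (fun c : _root_.ConnectedComponents S => X.restrictMap (i := (componentOpen S c).ι ≫ j)
        (componentOpen S c).ι rfl) where
  isStrict c := by
    have : (X.restrictMap (i := (componentOpen S c).ι ≫ j)
        (componentOpen S c).ι rfl).comor.IsCart :=
      X.restrictMap_isCart _ rfl
    exact this.isStrict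
  isColimit := nonempty_isColimit_components S

lemma LogScheme.isDisjointUnion_components [LocallyConnectedSpace X.toScheme] : IsDisjointUnion
      (fun c : _root_.ConnectedComponents X.toScheme => X.restrictHom (componentOpen _ c).ι) where
  isStrict c := by
    have : (X.restrictHom (componentOpen X.toScheme c).ι).comor.IsCart :=
      X.restrictHom_isCart _
    exact this.isStrict
  isColimit := nonempty_isColimit_components _

lemma PointedHom.cancel_strict {X Y Z : LogScheme.{u}} {f g : PointedHom X Y} {j : LogHom Y Z}
    (hj : j.comor.IsCart) (hb : f.base = g.base) (h : f.comp j.toPointed = g.comp j.toPointed) :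
    f = g := by
  have hb' : f.base ≫ j.base = (g.comp j.toPointed).base := by
    rw [hb]
    rfl
  have h₁ := (comp_toPointed_eq_iff hb').1 h
  have h₂ := (comp_toPointed_eq_iff (f := g) (g := j) rfl).1 rfl
  obtain ⟨b, c, hc⟩ := f
  obtain ⟨b', c', hc'⟩ := g
  obtain rfl : b = b' := hb
  refine PointedHom.ext rfl (heq_of_eq ?_)
  refine PreservesInfty.ext hc hc' X.isLog.gluing Y.isLog.gluing ?_
  exact (hj rfl (pointed_isLog X.isLog) _).unique h₁ h₂

end LogGeom
end

set_option linter.unusedSectionVars false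

noncomputable section

namespace LogGeom

open PrelogStructure Comorphism

/-! ### The universal pointed morphism is a disjoint union of face maps -/

section

variable {U : LogScheme.{u}} {Q : Type u} [CommMonoid Q] [Monoid.FG Q]
  {β : Q →* U.str.sec (topEt U.toScheme)} {W : Scheme.{u}} {w : W ⟶ U.toScheme}
  {M : PrelogStructure W} {ω : Comorphism w M.pointed U.str}

lemma IsChartUniv.isClosedImmersion_stratum (h : IsChartUniv β ω) {p : Set Q}
    (hp : IsPrimeIdeal p) : IsClosedImmersion ((stratum β ω p).ι ≫ w) := by
  obtain ⟨t, ht⟩ := h.isPullback_stratum hp _ (range_stratum_ι β ω p)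
  exact MorphismProperty.of_isPullback (P := @IsClosedImmersion) ht.flip inferInstance

/-- Each stratum is open in `W` and closed in `U`, so it is locally Noetherian and thereby locally
connected. -/
lemma IsChartUniv.locallyConnectedSpace (h : IsChartUniv β ω) [IsLocallyNoetherian U.toScheme] :
    LocallyConnectedSpace W := by
  refine locallyConnectedSpace_of_isOpenMap fun z => ?_
  have := h.isClosedImmersion_stratum (primeAt_isPrimeIdeal (β := β) ω z)
  have : IsLocallyNoetherian (stratum β ω (primeAt β ω z)) :=
    LocallyOfFiniteType.isLocallyNoetherian ((stratum β ω (primeAt β ω z)).ι ≫ w)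
  exact ⟨stratum β ω (primeAt β ω z), inferInstance, Subtype.val, inferInstance,
    continuous_subtype_val, (stratum β ω (primeAt β ω z)).isOpen.isOpenMap_subtype_val,
    ⟨z, rfl⟩, rfl⟩

end

section

variable {Y : LogScheme.{u}} {E : Scheme.{u}} {x : SuppPoint Y.str E}
  (hx : (SuppPoint.functor Y.str).IsRep (𝟙 Y.toScheme) x.base x)

/-- The universal pointed morphism to `Y`. -/
def suppMap : PointedHom (suppScheme hx) Y := PointedHom.ofCo (X := suppScheme hx) x.co.univCo

variable {U : LogScheme.{u}} {j : LogHom U Y} {Q : Type u} [CommMonoid Q]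
  {β : Q →* U.str.sec (topEt U.toScheme)} {W : Scheme.{u}} {k : W ⟶ (suppScheme hx).toScheme}
  [Etale k] {w : W ⟶ U.toScheme}

lemma suppScheme_exists_isChartUniv (hj : j.comor.IsCart) (hβ : U.str.IsChart β)
    (hW : IsPullback k w (suppMap hx).base j.base) :
    ∃ ω : Comorphism w ((suppScheme hx).restrict k).str.pointed U.str, IsChartUniv β ω ∧
      Factors ω j.comor (((suppScheme hx).restrictHom k).toPointed.comp
        (suppMap hx)).comor.onSec := by
  let k' : W ⟶ E := k
  have hk : Etale k' := ‹Etale k›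
  have hW' : IsPullback k' w x.base j.base := hW
  obtain ⟨ω₁, ω, hω, H₁, H⟩ := exists_isChartUniv hx hj hβ hW'
  refine ⟨ω, hω, ?_⟩
  have h₂ := (factors_comp ((suppScheme hx).restrictHom k).toPointed.comor
    (suppMap hx).comor).onSec
  have h₃ : (suppMap hx).comor.onSec = x.co.univCo := PointedHom.ofCo_onSec _
  rw [h₃] at h₂
  have h₄ : ω₁ = _ := H₁.unique rfl h₂
  exact (congrArg (fun c => Factors ω j.comor c) h₄).mp H

lemma exists_isFaceOfChart [Monoid.FG Q]
    {ω : Comorphism w ((suppScheme hx).restrict k).str.pointed U.str} (hω : IsChartUniv β ω)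
    (H : Factors ω j.comor (((suppScheme hx).restrictHom k).toPointed.comp
        (suppMap hx)).comor.onSec) (hw : w ≫ j.base = k ≫ (suppMap hx).base)
    {p : Set Q} (hp : IsPrimeIdeal p) :
    ∃ z : PointedHom ((suppScheme hx).restrict ((stratum β ω p).ι ≫ k)) U,
      z.base = (stratum β ω p).ι ≫ w ∧ IsFaceOfChart β hp z ∧
      z.comp j.toPointed = ((suppScheme hx).restrictHom ((stratum β ω p).ι ≫ k)).toPointed.comp
        (suppMap hx) := by
  let R := (suppScheme hx).restrictMap (i := (stratum β ω p).ι ≫ k) (stratum β ω p).ι rfl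
  have hR : R.comor.IsCart := (suppScheme hx).restrictMap_isCart _ rfl
  obtain ⟨ω', H'⟩ := exists_factors R.comor.pointed ω rfl
  let z := PointedHom.ofCo (X := (suppScheme hx).restrict ((stratum β ω p).ι ≫ k)) ω'
  have hz : z.comor.onSec = ω' := PointedHom.ofCo_onSec _
  refine ⟨z, rfl, ⟨hω.isPullback_stratum hp (stratum β ω p).ι (range_stratum_ι β ω p), ?_⟩, ?_⟩
  · obtain ⟨γ, h₁, h₂, h₃⟩ := hω.exists_face_chart hp (primeAt_stratum_ι β ω)
      ((suppScheme hx).restrict ((stratum β ω p).ι ≫ k)).isLog hR rfl H'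
    have hm : ∀ m, z.mapTop (PSec.ofSec m) = ω'.top m := fun m =>
      congrArg (fun c => c.top m) hz
    exact ⟨γ, h₁, fun r => (hm _).trans (h₂ r), fun q hq => (hm _).trans (h₃ q hq)⟩
  · let ρ := ((suppScheme hx).restrictHom k).toPointed.comp (suppMap hx)
    have hb : z.base ≫ j.base = R.base ≫ ρ.base :=
      (Category.assoc _ _ _).trans (congrArg (R.base ≫ ·) hw)
    have h₁ : z.comp j.toPointed = R.toPointed.comp ρ := by
      refine (PointedHom.comp_toPointed_eq_iff (h := R.toPointed.comp ρ) hb).2 ?_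
      have h₂ : Factors R.comor.pointed ρ.comor.onSec (R.toPointed.comp ρ).comor.onSec :=
        (factors_comp R.toPointed.comor ρ.comor).onSec
      rw [hz]
      exact (H'.assoc H rfl hw rfl).1 h₂
    rw [h₁]
    refine (PointedHom.comp_assoc _ _ _).symm.trans (congrArg (PointedHom.comp · _) ?_)
    exact LogHom.toPointed_comp rfl ((suppScheme hx).restrictMap_factors _ _)

/-- As the prime is constant on `D`, the inclusion of `D` factors through one stratum, in which `D`
is open and closed. The two pointed morphisms to `U` need only be compared after composition with
the strict morphism to `Y`. -/
lemma isComponentOfFace [Monoid.FG Q] (hj : j.comor.IsCart)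
    {ω : Comorphism w ((suppScheme hx).restrict k).str.pointed U.str} (hω : IsChartUniv β ω)
    (H : Factors ω j.comor (((suppScheme hx).restrictHom k).toPointed.comp
        (suppMap hx)).comor.onSec) (hw : w ≫ j.base = k ≫ (suppMap hx).base)
    {p : Set Q} (hp : IsPrimeIdeal p) {D : Scheme.{u}} [ConnectedSpace D] (m : D ⟶ W)
    [IsOpenImmersion m] (hm : IsClosed (Set.range m)) (hmp : ∀ z, primeAt β ω (m z) = p)
    {l : D ⟶ (suppScheme hx).toScheme} [Etale l] (hl : m ≫ k = l)
    {v : PointedHom ((suppScheme hx).restrict l) U} (hv : v.base = m ≫ w)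
    (hvj : v.comp j.toPointed = ((suppScheme hx).restrictHom l).toPointed.comp (suppMap hx)) :
    IsComponentOfFace β hp v := by
  obtain ⟨z, hz, hface, hzj⟩ := exists_isFaceOfChart hx hω H hw hp
  have hr : Set.range m ⊆ Set.range (stratum β ω p).ι := by
    rintro _ ⟨y, rfl⟩
    exact (range_stratum_ι β ω p).ge (hmp y)
  let h := IsOpenImmersion.lift (stratum β ω p).ι m hr
  have hh : h ≫ (stratum β ω p).ι = m := IsOpenImmersion.lift_fac _ _ _
  have hh' : h ≫ (stratum β ω p).ι ≫ k = l := by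
    rw [← Category.assoc, hh, hl]
  have ho : IsOpenImmersion h := by
    have : IsOpenImmersion (h ≫ (stratum β ω p).ι) := by rwa [hh]
    exact IsOpenImmersion.of_comp h (stratum β ω p).ι
  let e := (suppScheme hx).restrictMap h hh'
  have he : e.comor.IsCart := (suppScheme hx).restrictMap_isCart h hh'
  refine ⟨_, z, e, hface, ho, ?_, ‹ConnectedSpace D›, he.isStrict, ?_⟩
  · have : Set.range h = (stratum β ω p).ι ⁻¹' Set.range m := by
      rw [← hh]
      ext y
      constructor
      · rintro ⟨y, rfl⟩
        exact ⟨y, Scheme.Hom.comp_apply _ _ _⟩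
      · rintro ⟨y', hy'⟩
        refine ⟨y', (stratum β ω p).ι.injective ?_⟩
        rw [← hy', Scheme.Hom.comp_apply]
    change IsClosed (Set.range h)
    rw [this]
    exact hm.preimage (stratum β ω p).ι.continuous
  · refine PointedHom.cancel_strict hj ?_ ?_
    · change h ≫ z.base = v.base
      rw [hv, hz, ← hh, Category.assoc]
    · rw [hvj, PointedHom.comp_assoc, hzj, ← PointedHom.comp_assoc]
      refine congrArg (PointedHom.comp · _) ?_
      exact LogHom.toPointed_comp hh' ((suppScheme hx).restrictMap_factors _ _)

end

end LogGeom
end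

set_option linter.unusedSectionVars false

noncomputable section

namespace LogGeom

open PrelogStructure Comorphism

/-! ### Face maps and the factorization of pointed morphisms -/

section

variable {Y : LogScheme.{u}} {E : Scheme.{u}} {x : SuppPoint Y.str E}
  (hx : (SuppPoint.functor Y.str).IsRep (𝟙 Y.toScheme) x.base x)

lemma suppScheme_locallyConnectedSpace [IsLocallyNoetherian Y.toScheme] :
    LocallyConnectedSpace (suppScheme hx).toScheme := by
  refine locallyConnectedSpace_of_isOpenMap fun z => ?_
  obtain ⟨U, j, K, c, Q, _, β, hj, ⟨y, hy⟩, hK, hc, hQ, hβ⟩ :=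
    Y.exists_chart ((suppMap hx).base z)
  let U' : LogScheme.{u} := LogScheme.ofChart hK hβ
  let j' : LogHom U' Y := ⟨j, c⟩
  obtain ⟨z', hz', -⟩ := Scheme.Pullback.exists_preimage_pullback (f := (suppMap hx).base) (g := j)
    z y hy.symm
  let k := Limits.pullback.fst (suppMap hx).base j
  let w : Limits.pullback (suppMap hx).base j ⟶ U'.toScheme :=
    Limits.pullback.snd (suppMap hx).base j
  have hW : IsPullback k w (suppMap hx).base j'.base := IsPullback.of_hasPullback _ _
  obtain ⟨ω, hω, -⟩ := suppScheme_exists_isChartUniv hx (j := j') hc.isCart hβ hW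
  have hje : Etale j := hj
  have hU : IsLocallyNoetherian U := LocallyOfFiniteType.isLocallyNoetherian j
  have hU' : IsLocallyNoetherian U'.toScheme := hU
  have hk : IsOpenMap k := k.isOpenMap
  exact ⟨_, inferInstance, k, hω.locallyConnectedSpace, k.continuous, hk, z', hz'⟩

/-- Over `U`, the scheme `S` becomes an open and closed part of `W`. Each of its components lies in
one stratum, because the prime is locally constant, and is a component of that face. Two components
with the same prime have disjoint images, because the stratum is a closed subscheme of `U`. -/
lemma suppMap_isFaceMap [IsLocallyNoetherian Y.toScheme] {S : Scheme.{u}} [ConnectedSpace S]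
    (ι : S ⟶ (suppScheme hx).toScheme) [IsOpenImmersion ι] (hι : IsClosed (Set.range ι)) :
    IsFaceMap (((suppScheme hx).restrictHom ι).toPointed.comp (suppMap hx)) := by
  refine ⟨‹ConnectedSpace S›, fun U j hj hje Q _ _ β hβ => ?_⟩
  have hjc : j.comor.IsCart := IsStrict.isCart hj
  let ψ : S ⟶ Y.toScheme := ι ≫ (suppMap hx).base
  let k := Limits.pullback.fst (suppMap hx).base j.base
  let w := Limits.pullback.snd (suppMap hx).base j.base
  have hW : IsPullback k w (suppMap hx).base j.base := IsPullback.of_hasPullback _ _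
  obtain ⟨ω, hω, H⟩ := suppScheme_exists_isChartUniv hx hjc hβ hW
  have hU : IsLocallyNoetherian U.toScheme := LocallyOfFiniteType.isLocallyNoetherian j.base
  have hWl := hω.locallyConnectedSpace
  let a := Limits.pullback.fst ψ j.base
  let b := Limits.pullback.snd ψ j.base
  have hP : IsPullback a b ψ j.base := IsPullback.of_hasPullback _ _
  let m := hW.lift (a ≫ ι) b ((Category.assoc _ _ _).trans hP.w)
  have hmk : m ≫ k = a ≫ ι := hW.lift_fst _ _ _
  have hmw : m ≫ w = b := hW.lift_snd _ _ _
  -- `m` is a base change of `ι`, so it is both an open and a closed immersion.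
  have hm : IsPullback m a k ι := by
    refine IsPullback.of_right (h₁₂ := w) (h₂₂ := (suppMap hx).base) ?_ hmk hW.flip
    rw [hmw]
    exact hP.flip
  have hmo : IsOpenImmersion m :=
    MorphismProperty.of_isPullback (P := @IsOpenImmersion) hm.flip inferInstance
  have hmc : IsClosedImmersion m :=
    MorphismProperty.of_isPullback (P := @IsClosedImmersion) hm.flip
      (IsClosedImmersion.of_isPreimmersion ι hι)
  have hPl : LocallyConnectedSpace (Limits.pullback ψ j.base : Scheme.{u}) :=
    m.isOpenEmbedding.locallyConnectedSpace
  let kS := (suppScheme hx).restrictMap (i := a ≫ ι) (j := ι) a rfl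
  have hkS : kS.comor.IsCart := (suppScheme hx).restrictMap_isCart a rfl
  -- Strictness of `j` lifts the pointed morphism to `Y` to one with target `U`, once the underlying
  -- morphism of schemes is given.
  obtain ⟨wP, hwb, hwP⟩ := PointedHom.exists_strict_lift
    (f := kS.toPointed.comp (((suppScheme hx).restrictHom ι).toPointed.comp (suppMap hx)))
    hjc b hP.w.symm
  have hprime : ∀ c : _root_.ConnectedComponents (Limits.pullback ψ j.base : Scheme.{u}),
      ∃ p : Set Q, IsPrimeIdeal p ∧
        ∀ z, primeAt β ω (((componentOpen _ c).ι ≫ m) z) = p := by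
    intro c
    have z₀ : componentOpen (Limits.pullback ψ j.base : Scheme.{u}) c :=
      (inferInstance : ConnectedSpace (componentOpen (Limits.pullback ψ j.base :
          Scheme.{u}) c)).toNonempty.some
    refine ⟨_, primeAt_isPrimeIdeal (β := β) ω (((componentOpen _ c).ι ≫ m) z₀), fun z => ?_⟩
    exact ((primeAt_isLocallyConstant ω).comp_continuous
      ((componentOpen _ c).ι ≫ m).continuous).apply_eq_of_isPreconnected
        isPreconnected_univ trivial trivial
  choose p hp hpm using hprime
  refine ⟨(suppScheme hx).restrict (a ≫ ι), kS, wP, hkS.isStrict, ?_, hwP.symm, _, _, _, p, hp,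
    (suppScheme hx).isDisjointUnion_restrict (a ≫ ι), fun c => ?_, fun c d hcd hpcd => ?_⟩
  · rw [hwb]
    exact hP
  · have hcl : IsClosed (Set.range ((componentOpen _ c).ι ≫ m)) := by
      rw [Scheme.Hom.comp_base, TopCat.coe_comp, Set.range_comp, Scheme.Opens.range_ι]
      exact m.isClosedEmbedding.isClosedMap _ (componentOpen_isClosed _ c)
    refine isComponentOfFace hx hjc hω H hW.w.symm (hp c) ((componentOpen _ c).ι ≫ m) hcl (hpm c)
      (by rw [Category.assoc, hmk]) ?_ ?_
    · change (componentOpen _ c).ι ≫ wP.base = _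
      rw [hwb, Category.assoc, hmw]
    · rw [PointedHom.comp_assoc, hwP, ← PointedHom.comp_assoc, ← PointedHom.comp_assoc]
      refine congrArg (PointedHom.comp · _) ?_
      refine (congrArg (PointedHom.comp · _) (LogHom.toPointed_comp rfl
        ((suppScheme hx).restrictMap_comp_factors a rfl _ rfl (Category.assoc _ _ _)))).trans ?_
      exact LogHom.toPointed_comp (Category.assoc _ _ _)
        ((suppScheme hx).restrictMap_factors _ _)
  · have hinj : Function.Injective ((stratum β ω (p c)).ι ≫ w) :=
      have := hω.isClosedImmersion_stratum (hp c)
      ((stratum β ω (p c)).ι ≫ w).isClosedEmbedding.injective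
    rw [Set.disjoint_left]
    rintro _ ⟨y, rfl⟩ ⟨y', hy'⟩
    have key : ∀ (c : _root_.ConnectedComponents (Limits.pullback ψ j.base : Scheme.{u}))
        (y : componentOpen _ c), w (((componentOpen _ c).ι ≫ m) y) =
          ((componentOpen _ c).ι ≫ wP.base) y := by
      intro c y
      rw [hwb, ← hmw, ← Category.assoc]
      exact (Scheme.Hom.comp_apply ((componentOpen _ c).ι ≫ m) w y).symm
    have h₁ := (key d y').trans (hy'.trans (key c y).symm)
    have h₂ : ((componentOpen _ d).ι ≫ m) y' = ((componentOpen _ c).ι ≫ m) y := by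
      have := @hinj ⟨_, (hpm d y').trans hpcd.symm⟩ ⟨_, hpm c y⟩ h₁
      exact congrArg Subtype.val this
    have h₃ : (componentOpen _ d).ι y' = (componentOpen _ c).ι y :=
      m.isOpenEmbedding.injective h₂
    exact hcd (y.2.symm.trans ((congrArg _root_.ConnectedComponents.mk h₃).symm.trans y'.2))

/-- The support of `f` is classified by a morphism of schemes `g` to `E`. Then `f` has the support
pulled back along `g`, so `existsUnique_lift` supplies the map of log structures. -/
lemma exists_comp_suppMap_eq {X : LogScheme.{u}} (f : PointedHom X Y) :
    ∃ g : LogHom X (suppScheme hx), g.toPointed.comp (suppMap hx) = f := by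
  let c := f.comor.onSec
  obtain ⟨g, ⟨hg, hgx⟩, -⟩ := hx.univ f.base (⟨f.base, c.support⟩ : SuppPoint Y.str X.toScheme)
    (Category.comp_id _).symm
  have H : ∀ y : SuppPoint Y.str X.toScheme, x.pull g = y → Factors (suppCo g) x.co y.co := by
    rintro _ rfl
    exact SuppPoint.factors_pull g x
  obtain ⟨d, hd, -⟩ := existsUnique_lift hg X.isLog c (H _ hgx)
  let g' : LogHom X (suppScheme hx) := ⟨g, d⟩
  refine ⟨g', (PointedHom.comp_eq_iff (f := g'.toPointed) (g := suppMap hx) hg).2 ?_⟩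
  have h₁ : (suppMap hx).comor.onSec = x.co.univCo := PointedHom.ofCo_onSec _
  rw [h₁]
  exact hd

end

end LogGeom

theorem mainTheorem8 {X Y : LogGeom.LogScheme.{u}} [IsLocallyNoetherian Y.toScheme]
    (f : LogGeom.PointedHom X Y) :
    ∃ (F : LogGeom.LogScheme.{u}) (g : LogGeom.LogHom X F) (φ : LogGeom.PointedHom F Y),
      LogGeom.IsDisjointUnionOfFaceMaps φ ∧ g.toPointed.comp φ = f := by
  obtain ⟨E, e, x, hx⟩ := Y.exists_isRep
  obtain rfl : x.base = e := hx.base.trans (Category.comp_id e)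
  have := LogGeom.suppScheme_locallyConnectedSpace hx
  obtain ⟨g, hgf⟩ := LogGeom.exists_comp_suppMap_eq hx f
  exact ⟨LogGeom.suppScheme hx, g, LogGeom.suppMap hx, ⟨_, _, _,
    (LogGeom.suppScheme hx).isDisjointUnion_components, fun c => LogGeom.suppMap_isFaceMap hx _
      (by
        rw [Scheme.Opens.range_ι]
        exact LogGeom.componentOpen_isClosed _ c)⟩, hgf⟩

end
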